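/- Let $\Sigma$ be a finite alphabet and $\Xi$ a countably infinite set of variables. **Regex.** A regex is built from $\emptyset$, $\varepsilon$, terminals $\mathsf a\in\Sigma$ and memory recalls $x\in\Xi$ by $\vee$, $\cdot$, ${}^*$, ${}^+$ and memory definitions $\langle x\colon\delta\rangle$, where $x$ is neither recalled nor defined in $\delta$. The expression $\langle x\colon\delta\rangle$ matches what $\delta$ matches and saves the matched word in memory $x$; a recall $x$ matches the current content of memory $x$, which is $\varepsilon$ if nothing has been saved to it. $\mathcal L(\gamma)\subseteq\Sigma^*$ is the language of $\gamma$. Mark the occurrences of terminals and recalls in $\gamma$, write $[_x$ and $]_x$ for the beginning and the end of a memory definition, and let $R(\gamma)$ be the regular language of words over marked occurrences and brackets that results. The position (Glushkov) automaton $M_\gamma$ has an initial state and one state for each occurrence (and a trap state for failed recalls); for each word in $R(\gamma)$ and each occurrence $q$ in it, there is a transition to $q$, labelled with the terminal or recalled memory of $q$, from the preceding occurrence in this word (from the initial state if there is none), which performs on every memory the net effect (open, close, reset, unchanged) of the brackets in between. $\gamma$ is *deterministic* if in $M_\gamma$ every state has at most one transition (target and memory actions) for each label, and a state with a recall transition has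 no transition with another label. **FC-Datalog.** A program $P=(\mathfrak u,\mathcal R,\Phi)$ has a universe variable $\mathfrak u\in\Xi$, a finite set $\mathcal R\ni\mathrm{Ans}$ of relation symbols with arities, and a finite set $\Phi$ of rules $R(\vec x)\leftarrow\varphi_1,\dots,\varphi_m$ with $m\ge1$; each $\varphi_i$ is a relation atom $R'(\vec y)$ with variables $\vec y$ or a pattern equation $x\doteq\alpha$ with $\alpha\in(\Sigma\cup\Xi)^*$ and $x$ not in $\alpha$, and every head variable occurs in the body. On input $w\in\Sigma^*$ the relations are the least fixed point of the rules under substitutions $\theta$ with $\theta(\mathfrak u)=w$ that map every variable of the rule to a factor of $w$. If $\mathrm{ar}(\mathrm{Ans})=0$, then $P$ is Boolean and $\mathcal L(P)$ is the set of all $w$ for which $\mathrm{Ans}=\{()\}$. We write $(w,\theta)\models\rho$ if $\theta$ is such a substitution and all body atoms of $\rho$ hold under $\theta$ with respect to these relations. Two relation symbols are mutually recursive if each depends on the other (transitively, from the head of a rule to its body). $P$ is *linear* if each rule has at most one body atom (its recursive atom) whose symbol is mutually recursive with that of the head. For a rule $\rho$, $\mathrm{top}(\rho)$ consists of the head variables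 followed by $\mathfrak u$, and $\mathrm{bottom}(\rho)$ is the tuple of variables of the recursive atom (empty if there is none). A *top tuple* of $\rho$ on $w$ is $\theta(\mathrm{top}(\rho))$ for a substitution $\theta$ as above that satisfies the pattern equations of $\rho$. $P$ is *globally deterministic* if for no $w$ two distinct rules with the same head symbol have a common top tuple. The *uniquely defined* variables of $\rho$ are the least set that contains $\mathrm{top}(\rho)$ and, for every pattern equation of $\rho$ all of whose variables but one are in the set, also that remaining variable. $P$ is *DOLLA+* if it is linear, globally deterministic, and all variables of each rule are uniquely defined. Let $\Phi'$ be the set of rules that have a recursive atom and at least one pattern equation. A DOLLA+ program is *strictly decreasing* (SD) if for every $\rho\in\Phi'$ one can choose $x_\rho\in\mathrm{top}(\rho)$ and $y_\rho\in\mathrm{bottom}(\rho)$ such that 1. $x_\rho$ and $y_\rho$ occur in a common pattern equation of $\rho$, and $|\theta(y_\rho)|<|\theta(x_\rho)|$ for all $w$ and $\theta$ with $(w,\theta)\models\rho$; and 2. if the symbol of the recursive atom $R'(\vec y)$ of $\rho\in\Phi'$ is the head symbol of $\chi\in\Phi'$ with head $R'(\vec x')$, then $\theta(y_\rho)=\theta'(x_\chi)$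 for all $w,\theta,\theta'$ with $(w,\theta)\models\rho$, $(w,\theta')\models\chi$ and $\theta(\vec y)=\theta'(\vec x')$. **Theorem.** Let $\gamma$ be a deterministic regex with $n$ occurrences of terminals and memory recalls in total. Then there is a Boolean SD-DOLLA+ FC-Datalog program $P$ with $\mathcal L(P)=\mathcal L(\gamma)$ that has at most $n+2$ relation symbols and at most $n(n+3)+1$ rules. -/

import Mathlib

/-! ## Regex with back-references -/

namespace DetRegex

/-- Regular expressions over the terminal alphabet `A`, extended with recalls `ref x` and
memory definitions `bind x δ` (written `⟨x : δ⟩` on paper). Memories are named by `ℕ`. -/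
inductive Regex (A : Type*) where
  | empty : Regex A
  | eps : Regex A
  | char (a : A) : Regex A
  | ref (x : ℕ) : Regex A
  | alt (α β : Regex A) : Regex A
  | cat (α β : Regex A) : Regex A
  | star (α : Regex A) : Regex A
  | plus (α : Regex A) : Regex A
  | bind (x : ℕ) (α : Regex A) : Regex A

/-- Memory operations that occur between two letters of a ref-word: start and stop saving. -/
inductive MemOp where
  | opn (x : ℕ) : MemOp
  | cls (x : ℕ) : MemOp

/-- The memory to which an operation applies. -/
def MemOp.mem : MemOp → ℕ
  | .opn x => x
  | .cls x => x

/-- The action of one transition of a memory automaton on one memory: open it (with empty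
content), close it, reset it (to a closed memory with empty content), or leave it unchanged. -/
inductive MemInstr where
  | opn : MemInstr
  | cls : MemInstr
  | rst : MemInstr
  | keep : MemInstr

/-- The net effect of a sequence of operations on the memory `x`. -/
def memInstr (l : List MemOp) (x : ℕ) : MemInstr :=
  match (l.filter fun o => o.mem = x).reverse with
  | [] => .keep
  | .opn _ :: _ => .opn
  | [.cls _] => .cls
  | .cls _ :: _ :: _ => .rst

/-- Memory automata with trap state and without `ε`-transitions. A transition reads a terminal
(`Sum.inl a`) or recalls a memory (`Sum.inr x`), and performs an action on every memory. -/
structure MemoryAutomaton (A : Type*) where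
  /-- the states -/
  State : Type
  /-- the initial state -/
  start : State
  /-- the state that is entered when the content of a recalled memory is not found in the input -/
  trap : State
  /-- the transition function -/
  trans : State → A ⊕ ℕ → Set (State × (ℕ → MemInstr))
  /-- the accepting states -/
  accepting : Set State

/-- At most one transition for each state and label, and a state that has a recall transition
has no transition with another label. -/
def MemoryAutomaton.IsDeterministic {A : Type*} (M : MemoryAutomaton A) : Prop :=
  (∀ q b, (M.trans q b).Subsingleton) ∧
  ∀ q x b, (M.trans q (Sum.inr x)).Nonempty → b ≠ Sum.inr x → M.trans q b = ∅

/-- States of the position automaton: an initial state, one state for each position, a trap. -/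
inductive PosState (P : Type) where
  | src : PosState P
  | pos (p : P) : PosState P
  | trap : PosState P

namespace Regex

variable {A : Type*}

/-- The memories that are recalled or defined in a regex. -/
def mems : Regex A → Set ℕ
  | empty => ∅
  | eps => ∅
  | char _ => ∅
  | ref x => {x}
  | alt α β => α.mems ∪ β.mems
  | cat α β => α.mems ∪ β.mems
  | star α => α.mems
  | plus α => α.mems
  | bind x α => insert x α.mems

/-- A memory is neither recalled nor defined inside its own definition. -/
def WellFormed : Regex A → Prop
  | empty => True
  | eps => True
  | char _ => True
  | ref _ => True
  | alt α β => α.WellFormed ∧ β.WellFormed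
  | cat α β => α.WellFormed ∧ β.WellFormed
  | star α => α.WellFormed
  | plus α => α.WellFormed
  | bind x α => x ∉ α.mems ∧ α.WellFormed

/-- The total number of occurrences of terminals and of memory recalls. -/
def occ : Regex A → ℕ
  | empty => 0
  | eps => 0
  | char _ => 1
  | ref _ => 1
  | alt α β => α.occ + β.occ
  | cat α β => α.occ + β.occ
  | star α => α.occ
  | plus α => α.occ
  | bind _ α => α.occ

/-- `α.Match s w t`: started with memory contents `s`, the regex `α` can match the word `w` and
end with memory contents `t`. -/
inductive Match : Regex A → (ℕ → List A) → List A → (ℕ → List A) → Prop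
  | eps (s) : Match eps s [] s
  | char (a s) : Match (char a) s [a] s
  | ref (x s) : Match (ref x) s (s x) s
  | altLeft {α β s w t} : Match α s w t → Match (alt α β) s w t
  | altRight {α β s w t} : Match β s w t → Match (alt α β) s w t
  | cat {α β s v r w t} : Match α s v r → Match β r w t → Match (cat α β) s (v ++ w) t
  | starNil {α} (s) : Match (star α) s [] s
  | starCons {α s v r w t} :
      Match α s v r → Match (star α) r w t → Match (star α) s (v ++ w) t
  | plus {α s v r w t} :
      Match α s v r → Match (star α) r w t → Match (plus α) s (v ++ w) t
  | bind {x α s w t} : Match α s w t → Match (bind x α) s w (Function.update t x w)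

/-- The language of a regex; memories that have not been saved to have the content `ε`. -/
def language (γ : Regex A) : Language A :=
  {w | ∃ t, Match γ (fun _ => []) w t}

/-- The positions of a regex: the occurrences of terminals and of memory recalls. -/
def Pos : Regex A → Type
  | empty => Empty
  | eps => Empty
  | char _ => Unit
  | ref _ => Unit
  | alt α β => α.Pos ⊕ β.Pos
  | cat α β => α.Pos ⊕ β.Pos
  | star α => α.Pos
  | plus α => α.Pos
  | bind _ α => α.Pos

/-- The terminal or memory at a position. -/
def sym : (γ : Regex A) → γ.Pos → A ⊕ ℕ
  | empty, p => Empty.elim p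
  | eps, p => Empty.elim p
  | char a, _ => Sum.inl a
  | ref x, _ => Sum.inr x
  | alt α β, p => Sum.elim α.sym β.sym p
  | cat α β, p => Sum.elim α.sym β.sym p
  | star α, p => α.sym p
  | plus α, p => α.sym p
  | bind _ α, p => α.sym p

/-- The language that contains exactly one word. -/
def single {B : Type*} (w : List B) : Language B :=
  {v | v = w}

/-- The ref-words of the marked regex: words over positions and memory operations. -/
def refLang : (γ : Regex A) → Language (MemOp ⊕ γ.Pos)
  | empty => (0 : Language (MemOp ⊕ Empty))
  | eps => (1 : Language (MemOp ⊕ Empty))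
  | char _ => (single [Sum.inr ()] : Language (MemOp ⊕ Unit))
  | ref _ => (single [Sum.inr ()] : Language (MemOp ⊕ Unit))
  | alt α β =>
      (Language.map (Sum.map id Sum.inl) α.refLang +
        Language.map (Sum.map id Sum.inr) β.refLang : Language (MemOp ⊕ (α.Pos ⊕ β.Pos)))
  | cat α β =>
      (Language.map (Sum.map id Sum.inl) α.refLang *
        Language.map (Sum.map id Sum.inr) β.refLang : Language (MemOp ⊕ (α.Pos ⊕ β.Pos)))
  | star α => (KStar.kstar α.refLang : Language (MemOp ⊕ α.Pos))
  | plus α => (α.refLang * KStar.kstar α.refLang : Language (MemOp ⊕ α.Pos))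
  | bind x α =>
      (single [Sum.inl (MemOp.opn x)] * α.refLang * single [Sum.inl (MemOp.cls x)] :
        Language (MemOp ⊕ α.Pos))

/-- From state `p` the position `q` can be the next one, with the memory operations `l` performed
in between. -/
def Follows (γ : Regex A) (p : PosState γ.Pos) (l : List MemOp) (q : γ.Pos) : Prop :=
  match p with
  | .src => ∃ s, l.map Sum.inl ++ Sum.inr q :: s ∈ γ.refLang
  | .pos p => ∃ r s, r ++ Sum.inr p :: (l.map Sum.inl ++ Sum.inr q :: s) ∈ γ.refLang
  | .trap => False

/-- A ref-word can end in state `p`, up to memory operations. -/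
def EndsIn (γ : Regex A) (p : PosState γ.Pos) : Prop :=
  match p with
  | .src => ∃ l : List MemOp, l.map Sum.inl ∈ γ.refLang
  | .pos p => ∃ (r : List (MemOp ⊕ γ.Pos)) (l : List MemOp),
      r ++ Sum.inr p :: l.map Sum.inl ∈ γ.refLang
  | .trap => False

/-- The position (Glushkov) automaton of a regex. -/
def toAutomaton (γ : Regex A) : MemoryAutomaton A where
  State := PosState γ.Pos
  start := .src
  trap := .trap
  trans p b := {t | (p = .trap ∧ (∃ a, b = Sum.inl a) ∧ t = (.trap, fun _ => .keep)) ∨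
    ∃ q l, γ.Follows p l q ∧ γ.sym q = b ∧ t = (.pos q, memInstr l)}
  accepting := {p | γ.EndsIn p}

/-- Deterministic regex. -/
def IsDRX (γ : Regex A) : Prop :=
  γ.WellFormed ∧ γ.toAutomaton.IsDeterministic

end Regex

end DetRegex

/-! ## FC-Datalog -/

namespace FCDatalog

/-- Atoms: pattern equations `x ≐ α`, where the pattern `α` is a word over terminals (`Sum.inl`)
and variables (`Sum.inr`), and relation atoms. The variables are the natural numbers. -/
inductive Atom (A Rel : Type*) where
  | eq (x : ℕ) (α : List (A ⊕ ℕ)) : Atom A Rel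
  | rel (R : Rel) (ys : List ℕ) : Atom A Rel

/-- Rules `head(args) ← body`. -/
structure Rule (A Rel : Type*) where
  /-- the relation symbol of the head -/
  head : Rel
  /-- the variables of the head -/
  args : List ℕ
  /-- the atoms of the body -/
  body : List (Atom A Rel)

/-- The set of variables of an atom. -/
def Atom.vars {A Rel : Type*} : Atom A Rel → Set ℕ
  | .eq x α => {y | y = x ∨ Sum.inr y ∈ α}
  | .rel _ ys => {y | y ∈ ys}

/-- The set of variables that occur in the body of a rule. -/
def Rule.vars {A Rel : Type*} (ρ : Rule A Rel) : Set ℕ :=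
  {x | ∃ φ ∈ ρ.body, x ∈ φ.vars}

/-- FC-Datalog programs over the alphabet `A`. -/
structure Program (A : Type*) where
  /-- the universe variable -/
  univ : ℕ
  /-- the relation symbols -/
  Rel : Type
  finite_rel : Finite Rel
  /-- the arity of each relation symbol -/
  ar : Rel → ℕ
  /-- the output relation symbol -/
  ans : Rel
  /-- the rules -/
  rules : Finset (Rule A Rel)
  body_ne_nil : ∀ ρ ∈ rules, ρ.body ≠ []
  length_args : ∀ ρ ∈ rules, ρ.args.length = ar ρ.head
  length_atom : ∀ ρ ∈ rules, ∀ R ys, Atom.rel R ys ∈ ρ.body → ys.length = ar R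
  args_mem_vars : ∀ ρ ∈ rules, ∀ x ∈ ρ.args, x ∈ ρ.vars
  eq_notMem : ∀ ρ ∈ rules, ∀ x α, Atom.eq x α ∈ ρ.body → Sum.inr x ∉ α

/-- The image of a pattern under the substitution `θ`. -/
def subst {A : Type*} (θ : ℕ → List A) (α : List (A ⊕ ℕ)) : List A :=
  α.flatMap (Sum.elim (fun a => [a]) θ)

namespace Program

variable {A : Type*} (P : Program A)

/-- `θ` is a `w`-substitution for the rule `ρ`: the universe variable is mapped to `w` and every
variable of `ρ` is mapped to a factor of `w`. -/
def IsSubst (w : List A) (ρ : Rule A P.Rel) (θ : ℕ → List A) : Prop :=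
  θ P.univ = w ∧ ∀ x ∈ ρ.vars, θ x <:+: w

/-- All pattern equations of `ρ` hold under the `w`-substitution `θ`. -/
def SatEqs (w : List A) (ρ : Rule A P.Rel) (θ : ℕ → List A) : Prop :=
  P.IsSubst w ρ θ ∧ ∀ x α, Atom.eq x α ∈ ρ.body → θ x = subst θ α

/-- The least fixed point of the rules: `P.Derives w R t` says that, on input `w`, the tuple `t`
belongs to the final content of the relation `R`. -/
inductive Derives (w : List A) : P.Rel → List (List A) → Prop
  | intro (ρ : Rule A P.Rel) (θ : ℕ → List A) (hρ : ρ ∈ P.rules) (hθ : P.SatEqs w ρ θ)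
      (h : ∀ R ys, Atom.rel R ys ∈ ρ.body → Derives w R (ys.map θ)) :
      Derives w ρ.head (ρ.args.map θ)

/-- All atoms of `ρ` hold under the `w`-substitution `θ`. -/
def Sat (w : List A) (ρ : Rule A P.Rel) (θ : ℕ → List A) : Prop :=
  P.SatEqs w ρ θ ∧ ∀ R ys, Atom.rel R ys ∈ ρ.body → P.Derives w R (ys.map θ)

/-- A program is Boolean if its output relation has arity `0`. -/
def IsBoolean : Prop :=
  P.ar P.ans = 0

/-- The language of a Boolean program: the words for which the output relation is `{()}`. -/
def language : Language A :=
  {w | P.Derives w P.ans []}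

/-- `R'` occurs in the body of a rule with head relation symbol `R`. -/
def Uses (R R' : P.Rel) : Prop :=
  ∃ ρ ∈ P.rules, ρ.head = R ∧ ∃ ys, Atom.rel R' ys ∈ ρ.body

/-- Mutually recursive relation symbols. -/
def MutRec (R R' : P.Rel) : Prop :=
  Relation.TransGen P.Uses R R' ∧ Relation.TransGen P.Uses R' R

/-- `φ` is a relation atom whose symbol is mutually recursive with the head symbol of `ρ`. -/
def IsRecAtom (ρ : Rule A P.Rel) : Atom A P.Rel → Prop
  | .eq _ _ => False
  | .rel R _ => P.MutRec ρ.head R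

open Classical in
/-- The atoms of the body whose symbol is mutually recursive with the head symbol. -/
noncomputable def recAtoms (ρ : Rule A P.Rel) : List (Atom A P.Rel) :=
  ρ.body.filter fun φ => decide (P.IsRecAtom ρ φ)

/-- Linear programs: at most one such atom in each rule. -/
def IsLinear : Prop :=
  ∀ ρ ∈ P.rules, (P.recAtoms ρ).length ≤ 1

/-- The top variables of a rule. -/
def top (ρ : Rule A P.Rel) : List ℕ :=
  ρ.args ++ [P.univ]

/-- The bottom variables of a rule of a linear program: the variables of the atom that is mutually
recursive with the head, if there is one, and the empty tuple otherwise. -/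
noncomputable def bottom (ρ : Rule A P.Rel) : List ℕ :=
  (P.recAtoms ρ).flatMap fun φ => match φ with
    | .eq _ _ => []
    | .rel _ ys => ys

/-- The pairs of a top tuple and a bottom tuple of a rule. -/
def topBottom (w : List A) (ρ : Rule A P.Rel) : Set (List (List A) × List (List A)) :=
  {t | ∃ θ, P.SatEqs w ρ θ ∧ t = ((P.top ρ).map θ, (P.bottom ρ).map θ)}

/-- Globally deterministic programs: two distinct rules with the same head relation symbol have no
top tuple in common. -/
def IsGloballyDeterministic : Prop :=
  ∀ w : List A, ∀ ρ ∈ P.rules, ∀ χ ∈ P.rules, ρ.head = χ.head → ρ ≠ χ →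
    ¬ ∃ t t' t'', (t, t') ∈ P.topBottom w ρ ∧ (t, t'') ∈ P.topBottom w χ

/-- The uniquely defined variables of a rule: the top variables, and each variable of a pattern
equation all of whose other variables are uniquely defined. -/
inductive UniquelyDefined (ρ : Rule A P.Rel) : ℕ → Prop
  | top (x : ℕ) (hx : x ∈ P.top ρ) : UniquelyDefined ρ x
  | step (x : ℕ) (α : List (A ⊕ ℕ)) (y : ℕ) (hφ : Atom.eq x α ∈ ρ.body)
      (hy : y ∈ (Atom.eq x α : Atom A P.Rel).vars)
      (h : ∀ z ∈ (Atom.eq x α : Atom A P.Rel).vars, z ≠ y → UniquelyDefined ρ z) :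
      UniquelyDefined ρ y

/-- DOLLA+ programs. -/
def IsDollaPlus : Prop :=
  P.IsLinear ∧ P.IsGloballyDeterministic ∧
    ∀ ρ ∈ P.rules, ∀ x, x ∈ ρ.vars ∨ x ∈ ρ.args → P.UniquelyDefined ρ x

/-- The rules that have an atom mutually recursive with the head, and a pattern equation. -/
def recRules : Set (Rule A P.Rel) :=
  {ρ | ρ ∈ P.rules ∧ (∃ φ ∈ ρ.body, P.IsRecAtom ρ φ) ∧ ∃ x α, Atom.eq x α ∈ ρ.body}

/-- The top variable `x` and the bottom variable `y` occur in a common pattern equation of `ρ`, and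
the value of `y` is always shorter than the value of `x`. -/
def Decreases (ρ : Rule A P.Rel) (x y : ℕ) : Prop :=
  x ∈ P.top ρ ∧ y ∈ P.bottom ρ ∧
  (∃ z α, Atom.eq z α ∈ ρ.body ∧ x ∈ (Atom.eq z α : Atom A P.Rel).vars ∧
    y ∈ (Atom.eq z α : Atom A P.Rel).vars) ∧
  ∀ w θ, P.Sat w ρ θ → (θ y).length < (θ x).length

/-- Strictly decreasing programs: in each rule `ρ` of `recRules` a bottom variable `y ρ` is shorter
than a top variable `x ρ`, and when the evaluation of `ρ` calls the rule `χ` (the head of `χ`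
receives the values of the recursive atom of `ρ`), the value of `y ρ` becomes that of `x χ`. -/
def IsStrictlyDecreasing : Prop :=
  ∃ x y : Rule A P.Rel → ℕ, ∀ ρ ∈ P.recRules, P.Decreases ρ (x ρ) (y ρ) ∧
    ∀ R' ys, Atom.rel R' ys ∈ ρ.body → P.MutRec ρ.head R' →
      ∀ χ ∈ P.recRules, χ.head = R' →
        ∀ w θ θ', P.Sat w ρ θ → P.Sat w χ θ' → χ.args.map θ' = ys.map θ →
          θ (y ρ) = θ' (x χ)

/-- SD-DOLLA+ programs. -/
def IsSDDollaPlus : Prop :=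
  P.IsDollaPlus ∧ P.IsStrictlyDecreasing

end Program

end FCDatalog

/-! The words of `γ.language` are the terminal words read off the ref-words of `γ`. Ref-words are
local: what may follow a position does not depend on what precedes it. Hence runs of the position
automaton, equipped with memory contents, accept exactly the language (`mem_language_iff_accepts`).
By determinism, state and label fix the next position and the set of memories erased on the way, and
all transitions from a state with a recall transition carry the same label. The program simulates
this `RecallAutomaton`. It has one relation symbol for each position, the output symbol, and a
symbol for the relation of all tuples of factors.

A tuple holds the unread input and the memory contents. Reading a terminal shortens the unread
input, but a recalled memory may be empty, and then nothing decreases. So a recalled word is not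
read when its position is entered; it becomes a pending word, and the rules of the position inspect
it. If it is nonempty, a pattern equation strips it off and the unread input gets strictly shorter.
If it is empty, `passRule` moves on without any pattern equation: emptiness is tested by repeating a
head variable, and the new contents are old variables or ε. Such a rule is exempt from the decrease
condition. The atom for all tuples makes its head variables occur in the body.

`passRule` cannot look at the unread input, so it would clash with a rule that accepts in the same
position. Acceptance is therefore postponed too: a flag becomes ε when an accepting state is left by
a recall. Empty flag and empty unread input are honoured at a nonempty pending word, at a position
without recall transitions, or at a position passed before since input was last read. In the last
case determinism traps the run in a cycle that recalls only empty memories (`eq_nil_of_accepts`). It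
reads nothing more, and the flag already tells whether the cycle contains an accepting state. The
input itself, if nonempty, is the nonempty value of flags and marks; the empty input has its own
rule.

Nonemptiness is tested through the first letter, with one rule per terminal position of `γ`.
Determinism lets alternative kinds of rules share an index, which gives the bound on their number.
`StateRule.unique` gives global determinism, `correct_of_derives` soundness, and
`derives_of_accepts` completeness. -/

set_option linter.unusedSectionVars false

/-! ## Ref-words -/

namespace DetRegex

namespace Regex

variable {A B C : Type*}

/-- A letter in a word that is a concatenation belongs to one of the factors. -/
theorem mem_mul_split {L M : Language B} {r s : List B} {c : B} (h : r ++ c :: s ∈ L * M) :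
    (∃ s₁ s₂, s = s₁ ++ s₂ ∧ r ++ c :: s₁ ∈ L ∧ s₂ ∈ M) ∨
      ∃ r₁ r₂, r = r₁ ++ r₂ ∧ r₁ ∈ L ∧ r₂ ++ c :: s ∈ M := by
  obtain ⟨u, hu, v, hv, huv⟩ := Language.mem_mul.1 h
  rcases List.append_eq_append_iff.1 huv with ⟨r₂, hr, hv'⟩ | ⟨t, hu', hv'⟩
  · exact Or.inr ⟨u, r₂, hr, hu, hv' ▸ hv⟩
  · rcases t with _ | ⟨d, t⟩
    · refine Or.inr ⟨u, [], by simpa using hu'.symm, hu, ?_⟩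
      rw [List.nil_append] at hv'
      exact hv' ▸ hv
    · obtain ⟨rfl, rfl⟩ := List.cons.inj hv'
      exact Or.inl ⟨t, v, rfl, hu' ▸ hu, hv⟩

theorem kstar_append {L : Language B} {u v : List B} (hu : u ∈ KStar.kstar L)
    (hv : v ∈ KStar.kstar L) : u ++ v ∈ KStar.kstar L := by
  obtain ⟨U, rfl, hU⟩ := Language.mem_kstar.1 hu
  obtain ⟨V, rfl, hV⟩ := Language.mem_kstar.1 hv
  exact Language.mem_kstar.2
    ⟨U ++ V, by simp, fun y hy => (List.mem_append.1 hy).elim (hU y) (hV y)⟩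

theorem mem_kstar_of_mem {L : Language B} {u : List B} (hu : u ∈ L) : u ∈ KStar.kstar L :=
  Language.mem_kstar.2 ⟨[u], by simp, by simpa using hu⟩

/-- A letter in a word of an iteration belongs to one of the iterates. -/
theorem mem_kstar_split {L : Language B} {r s : List B} {c : B}
    (h : r ++ c :: s ∈ KStar.kstar L) :
    ∃ r₁ r₂ s₁ s₂, r = r₁ ++ r₂ ∧ s = s₁ ++ s₂ ∧ r₁ ∈ KStar.kstar L ∧ r₂ ++ c :: s₁ ∈ L ∧
      s₂ ∈ KStar.kstar L := by
  obtain ⟨U, hU, hL⟩ := Language.mem_kstar.1 h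
  clear h
  induction U generalizing r with
  | nil => simp at hU
  | cons u U ih =>
    have hu : u ∈ L := hL u (by simp)
    have hUs : ∀ y ∈ U, y ∈ L := fun y hy => hL y (by simp [hy])
    have key : r ++ c :: s ∈ L * (KStar.kstar L : Language B) := by
      rw [hU]
      exact Language.append_mem_mul hu (Language.join_mem_kstar hUs)
    rw [List.flatten_cons] at hU
    rcases List.append_eq_append_iff.1 hU with ⟨t, hu', hv'⟩ | ⟨r₂, hr, hv'⟩
    · rcases t with _ | ⟨d, t⟩
      · rw [List.nil_append] at hv'
        obtain ⟨r₁, r₂, s₁, s₂, h1, h2, h3, h4, h5⟩ := ih (r := []) (by simpa using hv') hUs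
        obtain ⟨rfl, rfl⟩ := List.append_eq_nil_iff.1 h1.symm
        refine ⟨u, [], s₁, s₂, by simpa using hu'.symm, h2, mem_kstar_of_mem hu, h4, h5⟩
      · obtain ⟨rfl, rfl⟩ := List.cons.inj hv'
        exact ⟨[], r, t, U.flatten, rfl, rfl, Language.nil_mem_kstar L, hu' ▸ hu,
          Language.join_mem_kstar hUs⟩
    · obtain ⟨r₁, r₂', s₁, s₂, h1, h2, h3, h4, h5⟩ := ih hv'.symm hUs
      exact ⟨u ++ r₁, r₂', s₁, s₂, by rw [hr, h1, List.append_assoc], h2,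
        kstar_append (mem_kstar_of_mem hu) h3, h4, h5⟩

theorem mem_map_split {O : Type*} {f : B → C} {L : Language (O ⊕ B)} {r s : List (O ⊕ C)} {c : C}
    (h : r ++ Sum.inr c :: s ∈ Language.map (Sum.map id f) L) :
    ∃ r' b s', f b = c ∧ r' ++ Sum.inr b :: s' ∈ L ∧ r = r'.map (Sum.map id f) ∧
      s = s'.map (Sum.map id f) := by
  obtain ⟨v, hv, hvw⟩ := h
  change v.map (Sum.map id f) = _ at hvw
  obtain ⟨r', t, rfl, rfl, ht⟩ := List.map_eq_append_iff.1 hvw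
  obtain ⟨b, s', rfl, hb, rfl⟩ := List.map_eq_cons_iff.1 ht
  rcases b with o | b
  · simp at hb
  · exact ⟨r', b, s', by simpa using hb, hv, rfl, rfl⟩

theorem map_mem_map {f : B → C} {L : Language B} {v : List B} (h : v ∈ L) :
    v.map f ∈ Language.map f L := ⟨v, h, rfl⟩

theorem mem_single {w v : List B} : v ∈ single w ↔ v = w := Iff.rfl

theorem mem_bind_split {O : Type*} {L : Language (O ⊕ B)} {a b : O} {r s : List (O ⊕ B)} {c : B}
    (h : r ++ Sum.inr c :: s ∈ single [Sum.inl a] * L * single [Sum.inl b]) :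
    ∃ r' s', r = Sum.inl a :: r' ∧ s = s' ++ [Sum.inl b] ∧ r' ++ Sum.inr c :: s' ∈ L := by
  rcases mem_mul_split h with ⟨s₁, s₂, rfl, h1, h2⟩ | ⟨r₁, r₂, rfl, h1, h2⟩
  · rw [mem_single.1 h2]
    rcases mem_mul_split h1 with ⟨t₁, t₂, rfl, h3, h4⟩ | ⟨t₁, t₂, rfl, h3, h4⟩
    · have := mem_single.1 h3
      rcases r with _ | ⟨d, r⟩ <;> simp at this
    · rw [mem_single.1 h3]
      exact ⟨t₂, s₁, rfl, rfl, h4⟩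
  · have := mem_single.1 h2
    rcases r₂ with _ | ⟨d, r₂⟩ <;> simp at this

/-! ### Locality of the marked ref-words -/

/-- In words of the language, what can follow a letter `Sum.inr p` does not depend on what
precedes it. -/
def IsLocal {O : Type*} (L : Language (O ⊕ B)) : Prop :=
  ∀ ⦃p r s r' s'⦄, r ++ Sum.inr p :: s ∈ L → r' ++ Sum.inr p :: s' ∈ L → r ++ Sum.inr p :: s' ∈ L

theorem isLocal_single {O : Type*} (b : B) : IsLocal (single [(Sum.inr b : O ⊕ B)]) := by
  intro p r s r' s' h h'
  have h1 := mem_single.1 h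
  have h2 := mem_single.1 h'
  rcases r with _ | ⟨d, r⟩ <;> rcases r' with _ | ⟨d', r'⟩ <;> simp at h1 h2
  rw [h2.1, h2.2]
  exact mem_single.2 rfl

theorem isLocal_add {O : Type*} {L : Language (O ⊕ B)} {M : Language (O ⊕ C)} (hL : IsLocal L)
    (hM : IsLocal M) : IsLocal (Language.map (Sum.map id (Sum.inl : B → B ⊕ C)) L +
      Language.map (Sum.map id (Sum.inr : C → B ⊕ C)) M) := by
  intro p r s r' s' h h'
  rcases h with h | h <;> rcases h' with h' | h' <;>
  obtain ⟨t, b, u, hb, h1, rfl, rfl⟩ := mem_map_split h <;>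
  obtain ⟨t', b', u', hb', h1', rfl, rfl⟩ := mem_map_split h' <;>
  subst hb <;> cases hb'
  · exact Or.inl ⟨_, hL h1 h1', by simp⟩
  · exact Or.inr ⟨_, hM h1 h1', by simp⟩

/-- The factors share no positions, so two words through `p` pass it in the same factor, and only
tails inside that factor are exchanged. -/
theorem isLocal_mul {O : Type*} {L : Language (O ⊕ B)} {M : Language (O ⊕ C)} (hL : IsLocal L)
    (hM : IsLocal M) : IsLocal (Language.map (Sum.map id (Sum.inl : B → B ⊕ C)) L *
      Language.map (Sum.map id (Sum.inr : C → B ⊕ C)) M) := by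
  intro p r s r' s' h h'
  rcases mem_mul_split h with ⟨s₁, s₂, rfl, h1, h2⟩ | ⟨r₁, r₂, rfl, h1, h2⟩ <;>
  rcases mem_mul_split h' with ⟨s₁', s₂', rfl, h1', h2'⟩ | ⟨r₁', r₂', rfl, h1', h2'⟩
  · obtain ⟨t, b, u, hb, h3, rfl, rfl⟩ := mem_map_split h1
    obtain ⟨t', b', u', hb', h3', rfl, rfl⟩ := mem_map_split h1'
    subst hb
    cases hb'
    have := Language.append_mem_mul (map_mem_map (f := Sum.map id Sum.inl) (hL h3 h3')) h2'
    simpa using this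
  · obtain ⟨t, b, u, hb, h3, rfl, rfl⟩ := mem_map_split h1
    obtain ⟨t', b', u', hb', h3', rfl, rfl⟩ := mem_map_split h2'
    subst hb
    cases hb'
  · obtain ⟨t, b, u, hb, h3, rfl, rfl⟩ := mem_map_split h2
    obtain ⟨t', b', u', hb', h3', rfl, rfl⟩ := mem_map_split h1'
    subst hb
    cases hb'
  · obtain ⟨t, b, u, hb, h3, rfl, rfl⟩ := mem_map_split h2
    obtain ⟨t', b', u', hb', h3', rfl, rfl⟩ := mem_map_split h2'
    subst hb
    cases hb'
    have := Language.append_mem_mul h1 (map_mem_map (f := Sum.map id Sum.inr) (hM h3 h3'))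
    simpa using this

/-- Cut both words at the iterate that contains `p`, exchange the tails inside this iterate, and
continue with the remaining iterates of the second word. -/
theorem isLocal_kstar {O : Type*} {L : Language (O ⊕ B)} (hL : IsLocal L) :
    IsLocal (KStar.kstar L) := by
  intro p r s r' s' h h'
  obtain ⟨r₁, r₂, s₁, s₂, rfl, rfl, h1, h2, h3⟩ := mem_kstar_split h
  obtain ⟨r₁', r₂', s₁', s₂', rfl, rfl, h1', h2', h3'⟩ := mem_kstar_split h'
  have := kstar_append (kstar_append h1 (mem_kstar_of_mem (hL h2 h2'))) h3'
  simpa using this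

theorem mem_plus_split {O : Type*} {L : Language (O ⊕ B)} {r s : List (O ⊕ B)} {p : O ⊕ B}
    (h : r ++ p :: s ∈ L * KStar.kstar L) :
    ∃ r₁ r₂ s₁ s₂, r = r₁ ++ r₂ ∧ s = s₁ ++ s₂ ∧ (r₁ = [] ∨ r₁ ∈ L * KStar.kstar L) ∧
      r₂ ++ p :: s₁ ∈ L ∧ s₂ ∈ KStar.kstar L := by
  rcases mem_mul_split h with ⟨s₁, s₂, rfl, h1, h2⟩ | ⟨r₁, r₂, rfl, h1, h2⟩
  · exact ⟨[], r, s₁, s₂, rfl, rfl, Or.inl rfl, h1, h2⟩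
  · obtain ⟨a, b, c, d, rfl, rfl, h3, h4, h5⟩ := mem_kstar_split h2
    exact ⟨r₁ ++ a, b, c, d, by simp, rfl, Or.inr (Language.append_mem_mul h1 h3), h4, h5⟩

theorem plus_append {L : Language B} {r u s : List B} (hr : r = [] ∨ r ∈ L * KStar.kstar L)
    (hu : u ∈ L) (hs : s ∈ KStar.kstar L) : r ++ (u ++ s) ∈ L * KStar.kstar L := by
  rcases hr with rfl | hr
  · rw [List.nil_append]
    exact Language.append_mem_mul hu hs
  · obtain ⟨a, ha, b, hb, rfl⟩ := Language.mem_mul.1 hr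
    rw [List.append_assoc]
    exact Language.append_mem_mul ha (kstar_append hb (kstar_append (mem_kstar_of_mem hu) hs))

theorem isLocal_plus {O : Type*} {L : Language (O ⊕ B)} (hL : IsLocal L) :
    IsLocal (L * KStar.kstar L) := by
  intro p r s r' s' h h'
  obtain ⟨r₁, r₂, s₁, s₂, rfl, rfl, h1, h2, h3⟩ := mem_plus_split h
  obtain ⟨r₁', r₂', s₁', s₂', rfl, rfl, h1', h2', h3'⟩ := mem_plus_split h'
  simpa using plus_append h1 (hL h2 h2') h3'

theorem isLocal_bind {O : Type*} {L : Language (O ⊕ B)} {a b : O} (hL : IsLocal L) :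
    IsLocal (single [Sum.inl a] * L * single [Sum.inl b]) := by
  intro p r s r' s' h h'
  obtain ⟨t, u, rfl, rfl, h1⟩ := mem_bind_split h
  obtain ⟨t', u', rfl, rfl, h1'⟩ := mem_bind_split h'
  have := Language.append_mem_mul (Language.append_mem_mul
    (mem_single.2 (rfl : [Sum.inl a] = _)) (hL h1 h1')) (mem_single.2 (rfl : [Sum.inl b] = _))
  simpa using this

/-- Marking is essential: each position occurs only once in the regex. Without the marks, locality
fails in general. -/
theorem isLocal_refLang (γ : Regex A) : IsLocal γ.refLang := by
  induction γ with
  | empty => exact fun p => p.elim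
  | eps => exact fun p => p.elim
  | char a => exact isLocal_single ()
  | ref x => exact isLocal_single ()
  | alt α β ihα ihβ => exact isLocal_add ihα ihβ
  | cat α β ihα ihβ => exact isLocal_mul ihα ihβ
  | star α ih => exact isLocal_kstar ih
  | plus α ih => exact isLocal_plus ih
  | bind x α ih => exact isLocal_bind ih

/-! ### Balance of the memory brackets -/

/-- The set of open memories after a word. -/
def openAfter : List (MemOp ⊕ B) → Set ℕ → Set ℕ
  | [], O => O
  | Sum.inl (.opn x) :: v, O => openAfter v (insert x O)
  | Sum.inl (.cls x) :: v, O => openAfter v (O \ {x})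
  | Sum.inr _ :: v, O => openAfter v O

/-- Only closed memories are opened, and only open memories are closed. -/
def Valid : List (MemOp ⊕ B) → Set ℕ → Prop
  | [], _ => True
  | Sum.inl (.opn x) :: v, O => x ∉ O ∧ Valid v (insert x O)
  | Sum.inl (.cls x) :: v, O => x ∈ O ∧ Valid v (O \ {x})
  | Sum.inr _ :: v, O => Valid v O

theorem openAfter_append (u v : List (MemOp ⊕ B)) (O : Set ℕ) :
    openAfter (u ++ v) O = openAfter v (openAfter u O) := by
  induction u generalizing O with
  | nil => rfl
  | cons c u ih => rcases c with (x | x) | c <;> exact ih _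

theorem valid_append (u v : List (MemOp ⊕ B)) (O : Set ℕ) :
    Valid (u ++ v) O ↔ Valid u O ∧ Valid v (openAfter u O) := by
  induction u generalizing O with
  | nil => simp [Valid, openAfter]
  | cons c u ih => rcases c with (x | x) | c <;> simp [Valid, openAfter, ih, and_assoc]

theorem openAfter_map (f : B → C) (v : List (MemOp ⊕ B)) (O : Set ℕ) :
    openAfter (v.map (Sum.map id f)) O = openAfter v O := by
  induction v generalizing O with
  | nil => rfl
  | cons c u ih => rcases c with (x | x) | c <;> exact ih _

theorem valid_map (f : B → C) (v : List (MemOp ⊕ B)) (O : Set ℕ) :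
    Valid (v.map (Sum.map id f)) O ↔ Valid v O := by
  induction v generalizing O with
  | nil => rfl
  | cons c u ih => rcases c with (x | x) | c <;> simp [Valid, ih]

/-- The words of the language are valid, and they close all memories that they open. -/
def IsBalanced (L : Language (MemOp ⊕ B)) (O : Set ℕ) : Prop :=
  ∀ v ∈ L, Valid v O ∧ openAfter v O = O

theorem isBalanced_map {L : Language (MemOp ⊕ B)} {O : Set ℕ} (hL : IsBalanced L O) (f : B → C) :
    IsBalanced (Language.map (Sum.map id f) L) O := by
  rintro _ ⟨v, hv, rfl⟩
  exact ⟨(valid_map _ _ _).2 (hL v hv).1, (openAfter_map _ _ _).trans (hL v hv).2⟩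

theorem isBalanced_mul {L M : Language (MemOp ⊕ B)} {O : Set ℕ} (hL : IsBalanced L O)
    (hM : IsBalanced M O) : IsBalanced (L * M) O := by
  intro w hw
  obtain ⟨u, hu, v, hv, rfl⟩ := Language.mem_mul.1 hw
  rw [valid_append, openAfter_append, (hL u hu).2]
  exact ⟨⟨(hL u hu).1, (hM v hv).1⟩, (hM v hv).2⟩

theorem isBalanced_kstar {L : Language (MemOp ⊕ B)} {O : Set ℕ} (hL : IsBalanced L O) :
    IsBalanced (KStar.kstar L) O := by
  intro v hv
  obtain ⟨U, rfl, hU⟩ := Language.mem_kstar.1 hv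
  clear hv
  induction U with
  | nil => exact ⟨trivial, rfl⟩
  | cons u U ih =>
    obtain ⟨h1, h2⟩ := hL u (hU u (by simp))
    obtain ⟨h3, h4⟩ := ih fun y hy => hU y (by simp [hy])
    rw [List.flatten_cons, valid_append, openAfter_append, h2]
    exact ⟨⟨h1, h3⟩, h4⟩

theorem isBalanced_bind {L : Language (MemOp ⊕ B)} {O : Set ℕ} {x : ℕ} (hx : x ∉ O)
    (hL : IsBalanced L (insert x O)) :
    IsBalanced (single [Sum.inl (.opn x)] * L * single [Sum.inl (.cls x)]) O := by
  intro v hv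
  obtain ⟨_, ht, _, h2, rfl⟩ := Language.mem_mul.1 hv
  obtain ⟨_, h1, u, hu, rfl⟩ := Language.mem_mul.1 ht
  rw [mem_single.1 h1, mem_single.1 h2]
  have e : insert x O \ {x} = O := Set.insert_sdiff_self_of_notMem hx
  have h3 := hL u hu
  simp only [List.cons_append, Valid, openAfter, valid_append,
    openAfter_append, h3.2, e]
  simp [hx, h3.1]

/-- No memory is defined inside its own definition, so an opening bracket always meets a closed
memory. The set `O` stands for the enclosing definitions, which the induction step for `bind`
enlarges. -/
theorem isBalanced_refLang (γ : Regex A) (hγ : γ.WellFormed) {O : Set ℕ}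
    (hO : ∀ x ∈ γ.mems, x ∉ O) : IsBalanced γ.refLang O := by
  induction γ generalizing O with
  | empty => exact fun v hv => hv.elim
  | eps =>
    intro v hv
    have : v = [] := hv
    exact this ▸ ⟨trivial, rfl⟩
  | char a => exact fun v hv => mem_single.1 hv ▸ ⟨trivial, rfl⟩
  | ref x => exact fun v hv => mem_single.1 hv ▸ ⟨trivial, rfl⟩
  | alt α β ihα ihβ =>
    have h1 := isBalanced_map (ihα hγ.1 fun x hx => hO x (Or.inl hx)) (Sum.inl : _ → α.Pos ⊕ β.Pos)
    have h2 := isBalanced_map (ihβ hγ.2 fun x hx => hO x (Or.inr hx)) (Sum.inr : _ → α.Pos ⊕ β.Pos)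
    exact fun v hv => hv.elim (h1 v) (h2 v)
  | cat α β ihα ihβ =>
    exact isBalanced_mul
      (isBalanced_map (ihα hγ.1 fun x hx => hO x (Or.inl hx)) (Sum.inl : _ → α.Pos ⊕ β.Pos))
      (isBalanced_map (ihβ hγ.2 fun x hx => hO x (Or.inr hx)) (Sum.inr : _ → α.Pos ⊕ β.Pos))
  | star α ih => exact isBalanced_kstar (ih hγ hO)
  | plus α ih => exact isBalanced_mul (ih hγ hO) (isBalanced_kstar (ih hγ hO))
  | bind x α ih =>
    refine isBalanced_bind (hO x (Or.inl rfl)) (ih hγ.2 ?_)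
    rintro y hy (rfl | h)
    · exact hγ.1 hy
    · exact hO y (Or.inr hy) h

/-! ### Open memories as a function of the position -/

/-- The memories whose definition contains the given position. -/
def openAt : (γ : Regex A) → γ.Pos → Set ℕ
  | empty, _ => ∅
  | eps, _ => ∅
  | char _, _ => ∅
  | ref _, _ => ∅
  | alt α β, p => Sum.elim α.openAt β.openAt p
  | cat α β, p => Sum.elim α.openAt β.openAt p
  | star α, p => α.openAt p
  | plus α, p => α.openAt p
  | bind x α, p => insert x (α.openAt p)

/-- When a word of the language arrives at `p`, it has opened the memories in `f p`. -/
def OpensAt (L : Language (MemOp ⊕ B)) (O : Set ℕ) (f : B → Set ℕ) : Prop :=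
  ∀ ⦃p r s⦄, r ++ Sum.inr p :: s ∈ L → openAfter r O = O ∪ f p

theorem opensAt_single {O : Set ℕ} (b : B) :
    OpensAt (single [(Sum.inr b : MemOp ⊕ B)]) O fun _ => ∅ := by
  intro p r s h
  have h1 := mem_single.1 h
  rcases r with _ | ⟨d, r⟩ <;> simp at h1
  simp [openAfter]

theorem opensAt_map {L : Language (MemOp ⊕ B)} {O : Set ℕ} {f : B → Set ℕ} (g : B → C)
    {k : C → Set ℕ} (hk : ∀ b, k (g b) = f b) (hL : OpensAt L O f) :
    OpensAt (Language.map (Sum.map id g) L) O k := by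
  intro p r s h
  obtain ⟨t, b, u, rfl, h1, rfl, rfl⟩ := mem_map_split h
  rw [openAfter_map, hL h1, hk]

theorem opensAt_add {L M : Language (MemOp ⊕ B)} {O : Set ℕ} {f : B → Set ℕ} (hL : OpensAt L O f)
    (hM : OpensAt M O f) : OpensAt (L + M) O f := by
  rintro p r s (h | h)
  · exact hL h
  · exact hM h

theorem opensAt_mul {L M : Language (MemOp ⊕ B)} {O : Set ℕ} {f : B → Set ℕ} (hL : OpensAt L O f)
    (hb : IsBalanced L O) (hM : OpensAt M O f) : OpensAt (L * M) O f := by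
  intro p r s h
  rcases mem_mul_split h with ⟨s₁, s₂, rfl, h1, h2⟩ | ⟨r₁, r₂, rfl, h1, h2⟩
  · exact hL h1
  · rw [openAfter_append, (hb _ h1).2, hM h2]

theorem opensAt_kstar {L : Language (MemOp ⊕ B)} {O : Set ℕ} {f : B → Set ℕ} (hL : OpensAt L O f)
    (hb : IsBalanced L O) : OpensAt (KStar.kstar L) O f := by
  intro p r s h
  obtain ⟨r₁, r₂, s₁, s₂, rfl, rfl, h1, h2, h3⟩ := mem_kstar_split h
  rw [openAfter_append, (isBalanced_kstar hb _ h1).2, hL h2]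

theorem opensAt_bind {L : Language (MemOp ⊕ B)} {O : Set ℕ} {f : B → Set ℕ} {x : ℕ}
    (hL : OpensAt L (insert x O) f) :
    OpensAt (single [Sum.inl (.opn x)] * L * single [Sum.inl (.cls x)]) O
      fun p => insert x (f p) := by
  intro p r s h
  obtain ⟨t, u, rfl, rfl, h1⟩ := mem_bind_split h
  refine (hL h1).trans ?_
  ext y
  simp
  tauto

/-- Everything completed before `p` is balanced, so only the definitions that enclose `p` are still
open. -/
theorem opensAt_refLang (γ : Regex A) (hγ : γ.WellFormed) {O : Set ℕ}
    (hO : ∀ x ∈ γ.mems, x ∉ O) : OpensAt γ.refLang O γ.openAt := by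
  induction γ generalizing O with
  | empty => exact fun p => p.elim
  | eps => exact fun p => p.elim
  | char a => exact opensAt_single ()
  | ref a => exact opensAt_single ()
  | alt α β ihα ihβ =>
    exact opensAt_add
      (opensAt_map _ (fun _ => rfl) (ihα hγ.1 fun x hx => hO x (Or.inl hx)))
      (opensAt_map _ (fun _ => rfl) (ihβ hγ.2 fun x hx => hO x (Or.inr hx)))
  | cat α β ihα ihβ =>
    exact opensAt_mul
      (opensAt_map _ (fun _ => rfl) (ihα hγ.1 fun x hx => hO x (Or.inl hx)))
      (isBalanced_map (isBalanced_refLang α hγ.1 fun x hx => hO x (Or.inl hx)) _)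
      (opensAt_map _ (fun _ => rfl) (ihβ hγ.2 fun x hx => hO x (Or.inr hx)))
  | star α ih => exact opensAt_kstar (ih hγ hO) (isBalanced_refLang α hγ hO)
  | plus α ih =>
    exact opensAt_mul (ih hγ hO) (isBalanced_refLang α hγ hO)
      (opensAt_kstar (ih hγ hO) (isBalanced_refLang α hγ hO))
  | bind x α ih =>
    refine opensAt_bind (ih hγ.2 ?_)
    rintro y hy (rfl | h)
    · exact hγ.1 hy
    · exact hO y (Or.inr hy) h

end Regex

end DetRegex

/-! ## The meaning of ref-words -/

namespace DetRegex

variable {A B C : Type*}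

/-- The word that a terminal or a recall stands for. -/
def letter (m : ℕ → List A) : A ⊕ ℕ → List A :=
  Sum.elim (fun a => [a]) m

open Classical in
/-- Append a word to the contents of the open memories. -/
noncomputable def save (O : Set ℕ) (c : List A) (m : ℕ → List A) : ℕ → List A :=
  fun x => if x ∈ O then m x ++ c else m x

open Classical in
/-- Erase the contents of some memories. -/
noncomputable def erase (D : Set ℕ) (m : ℕ → List A) : ℕ → List A :=
  fun x => if x ∈ D then [] else m x

namespace Regex

/-- The terminal word that is read by a ref-word. -/
noncomputable def output : List (MemOp ⊕ (A ⊕ ℕ)) → (ℕ → List A) → Set ℕ → List A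
  | [], _, _ => []
  | Sum.inl (.opn x) :: v, m, O => output v (Function.update m x []) (insert x O)
  | Sum.inl (.cls x) :: v, m, O => output v m (O \ {x})
  | Sum.inr b :: v, m, O => letter m b ++ output v (save O (letter m b) m) O

/-- The contents of the memories after a ref-word. -/
noncomputable def contents : List (MemOp ⊕ (A ⊕ ℕ)) → (ℕ → List A) → Set ℕ → ℕ → List A
  | [], m, _ => m
  | Sum.inl (.opn x) :: v, m, O => contents v (Function.update m x []) (insert x O)
  | Sum.inl (.cls x) :: v, m, O => contents v m (O \ {x})
  | Sum.inr b :: v, m, O => contents v (save O (letter m b) m) O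

theorem output_append (u v : List (MemOp ⊕ (A ⊕ ℕ))) (m : ℕ → List A) (O : Set ℕ) :
    output (u ++ v) m O = output u m O ++ output v (contents u m O) (openAfter u O) := by
  induction u generalizing m O with
  | nil => rfl
  | cons c u ih => rcases c with (x | x) | c <;> simp [output, contents, openAfter, ih]

theorem contents_append (u v : List (MemOp ⊕ (A ⊕ ℕ))) (m : ℕ → List A) (O : Set ℕ) :
    contents (u ++ v) m O = contents v (contents u m O) (openAfter u O) := by
  induction u generalizing m O with
  | nil => rfl
  | cons c u ih => rcases c with (x | x) | c <;> exact ih _ _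

/-- The ref-words of a regex, without the marks. -/
def labLang : Regex A → Language (MemOp ⊕ (A ⊕ ℕ))
  | empty => 0
  | eps => 1
  | char a => single [Sum.inr (Sum.inl a)]
  | ref x => single [Sum.inr (Sum.inr x)]
  | alt α β => α.labLang + β.labLang
  | cat α β => α.labLang * β.labLang
  | star α => KStar.kstar α.labLang
  | plus α => α.labLang * KStar.kstar α.labLang
  | bind x α => single [Sum.inl (.opn x)] * α.labLang * single [Sum.inl (.cls x)]

theorem map_single (f : B → C) (w : List B) :
    Language.map f (single w) = single (w.map f) := by
  ext v
  constructor
  · rintro ⟨u, hu, rfl⟩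
    rw [mem_single.1 hu]
    exact mem_single.2 rfl
  · intro hv
    exact ⟨w, rfl, (mem_single.1 hv).symm⟩

theorem map_sumMap_map {O D : Type*} (g : C → D) (f : B → C) (L : Language (O ⊕ B)) :
    Language.map (Sum.map id g) (Language.map (Sum.map id f) L) =
      Language.map (Sum.map id (g ∘ f)) L := by
  rw [Language.map_map, Sum.map_comp_map, Function.id_comp]

/-- Removing the marks commutes with all regular operations. The comparison with `Match` can then
use `labLang`, whose type does not depend on the regex. -/
theorem map_refLang (γ : Regex A) : Language.map (Sum.map id γ.sym) γ.refLang = γ.labLang := by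
  induction γ with
  | empty => exact map_zero (Language.map _)
  | eps => exact map_one (Language.map _)
  | char a => exact map_single _ _
  | ref x => exact map_single _ _
  | alt α β ihα ihβ =>
    refine (map_add (Language.map (Sum.map id (Sum.elim α.sym β.sym))) _ _).trans ?_
    rw [map_sumMap_map, map_sumMap_map, Sum.elim_comp_inl, Sum.elim_comp_inr, ihα, ihβ]
    rfl
  | cat α β ihα ihβ =>
    refine (map_mul (Language.map (Sum.map id (Sum.elim α.sym β.sym))) _ _).trans ?_
    rw [map_sumMap_map, map_sumMap_map, Sum.elim_comp_inl, Sum.elim_comp_inr, ihα, ihβ]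
    rfl
  | star α ih =>
    refine (Language.map_kstar (Sum.map id α.sym) α.refLang).trans ?_
    rw [ih]
    rfl
  | plus α ih =>
    refine (map_mul (Language.map (Sum.map id α.sym)) _ _).trans ?_
    rw [Language.map_kstar, ih]
    rfl
  | bind x α ih =>
    refine (map_mul (Language.map (Sum.map id α.sym)) _ _).trans ?_
    rw [map_mul, ih, map_single, map_single]
    rfl

theorem isBalanced_labLang (γ : Regex A) (hγ : γ.WellFormed) {O : Set ℕ}
    (hO : ∀ x ∈ γ.mems, x ∉ O) : IsBalanced γ.labLang O := by
  rw [← map_refLang]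
  exact isBalanced_map (isBalanced_refLang γ hγ hO) _

/-! ### Ref-words and the matching relation -/

/-- After the ref-word `v`, the closed memories have the contents `t`, and what was read has been
appended to the open ones. -/
def EndsWith (v : List (MemOp ⊕ (A ⊕ ℕ))) (m : ℕ → List A) (O : Set ℕ) (t : ℕ → List A) : Prop :=
  (∀ x ∉ O, contents v m O x = t x) ∧ ∀ x ∈ O, contents v m O x = m x ++ output v m O

theorem EndsWith.append {u v : List (MemOp ⊕ (A ⊕ ℕ))} {m t t' : ℕ → List A} {O : Set ℕ}
    (hu : EndsWith u m O t) (ho : openAfter u O = O) (hv : EndsWith v (contents u m O) O t') :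
    EndsWith (u ++ v) m O t' := by
  rw [EndsWith, contents_append, output_append, ho]
  refine ⟨hv.1, fun x hx => ?_⟩
  rw [hv.2 x hx, hu.2 x hx, List.append_assoc]

theorem endsWith_nil {m s : ℕ → List A} {O : Set ℕ} (h : ∀ x ∉ O, m x = s x) :
    EndsWith [] m O s :=
  ⟨h, fun x _ => (List.append_nil (m x)).symm⟩

theorem endsWith_letter {m s : ℕ → List A} {O : Set ℕ} (h : ∀ x ∉ O, m x = s x) (b : A ⊕ ℕ) :
    EndsWith [Sum.inr b] m O s := by
  constructor
  · intro x hx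
    simp [contents, save, hx, h]
  · intro x hx
    simp [contents, output, save, hx]

/-- `Match` writes a memory when its definition ends, while a ref-word fills it letter by letter.
Both agree because the opening bracket empties the memory and everything read up to the closing
bracket is appended. -/
theorem endsWith_bind {x : ℕ} {u : List (MemOp ⊕ (A ⊕ ℕ))} {m t : ℕ → List A} {O : Set ℕ}
    (hx : x ∉ O) (h : EndsWith u (Function.update m x []) (insert x O) t) :
    EndsWith ([Sum.inl (.opn x)] ++ u ++ [Sum.inl (.cls x)]) m O (Function.update t x
      (output ([Sum.inl (.opn x)] ++ u ++ [Sum.inl (.cls x)]) m O)) := by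
  have e1 : contents ([Sum.inl (.opn x)] ++ u ++ [Sum.inl (.cls x)]) m O =
      contents u (Function.update m x []) (insert x O) := by
    simp [contents_append, contents]
  have e2 : output ([Sum.inl (.opn x)] ++ u ++ [Sum.inl (.cls x)]) m O =
      output u (Function.update m x []) (insert x O) := by
    simp [output_append, output]
  rw [EndsWith, e1, e2]
  constructor
  · intro y hy
    by_cases hyx : y = x
    · subst hyx
      simpa using h.2 y (Or.inl rfl)
    · rw [Function.update_of_ne hyx]
      exact h.1 y (by simp [hyx, hy])
  · intro y hy
    have hyx : y ≠ x := fun e => hx (e ▸ hy)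
    rw [h.2 y (Or.inr hy), Function.update_of_ne hyx]

theorem match_star_of_mem {α : Regex A} {O : Set ℕ} (hb : IsBalanced α.labLang O)
    (ih : ∀ {v m s}, v ∈ α.labLang → (∀ x ∉ O, m x = s x) →
      ∃ t, Match α s (output v m O) t ∧ EndsWith v m O t)
    {v : List (MemOp ⊕ (A ⊕ ℕ))} {m s : ℕ → List A} (hv : v ∈ KStar.kstar α.labLang)
    (hs : ∀ x ∉ O, m x = s x) :
    ∃ t, Match (star α) s (output v m O) t ∧ EndsWith v m O t := by
  obtain ⟨U, rfl, hU⟩ := Language.mem_kstar.1 hv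
  clear hv
  induction U generalizing m s with
  | nil => exact ⟨s, .starNil s, endsWith_nil hs⟩
  | cons u U ihU =>
    have hu := hU u (by simp)
    obtain ⟨t, h1, h2⟩ := ih hu hs
    obtain ⟨t', h3, h4⟩ := ihU h2.1 fun y hy => hU y (by simp [hy])
    refine ⟨t', ?_, h2.append (hb u hu).2 h4⟩
    rw [List.flatten_cons, output_append, (hb u hu).2]
    exact .starCons h1 h3

theorem forall_notMem_insert {x : ℕ} {S O : Set ℕ} (hx : x ∉ S) (hO : ∀ y ∈ insert x S, y ∉ O) :
    ∀ y ∈ S, y ∉ insert x O := by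
  rintro y hy (rfl | h)
  · exact hx hy
  · exact hO y (Or.inr hy) h

theorem update_agree {x : ℕ} {O : Set ℕ} {m s : ℕ → List A} (hs : ∀ y ∉ O, m y = s y) :
    ∀ y ∉ insert x O, Function.update m x [] y = s y := by
  intro y hy
  rw [Function.update_of_ne fun e => hy (Or.inl e)]
  exact hs y fun h => hy (Or.inr h)

theorem output_bind (x : ℕ) (u : List (MemOp ⊕ (A ⊕ ℕ))) (m : ℕ → List A) (O : Set ℕ) :
    output ([Sum.inl (.opn x)] ++ u ++ [Sum.inl (.cls x)]) m O =
      output u (Function.update m x []) (insert x O) := by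
  simp [output_append, output]

/-- The contents `m` and `s` have to agree only outside `O`: the memories in `O` are under
construction, and `γ` cannot recall them. -/
theorem match_of_mem_labLang (γ : Regex A) (hγ : γ.WellFormed) {O : Set ℕ}
    (hO : ∀ x ∈ γ.mems, x ∉ O) {v : List (MemOp ⊕ (A ⊕ ℕ))} (hv : v ∈ γ.labLang)
    {m s : ℕ → List A} (hs : ∀ x ∉ O, m x = s x) :
    ∃ t, Match γ s (output v m O) t ∧ EndsWith v m O t := by
  induction γ generalizing O v m s with
  | empty => exact hv.elim
  | eps =>
    have : v = [] := hv
    subst this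
    exact ⟨s, .eps s, endsWith_nil hs⟩
  | char a =>
    obtain rfl := mem_single.1 hv
    exact ⟨s, .char a s, endsWith_letter hs _⟩
  | ref y =>
    obtain rfl := mem_single.1 hv
    refine ⟨s, ?_, endsWith_letter hs _⟩
    have : output [Sum.inr (Sum.inr y)] m O = s y := by
      simp [output, letter, hs y (hO y rfl)]
    rw [this]
    exact .ref y s
  | alt α β ihα ihβ =>
    rcases hv with hv | hv
    · obtain ⟨t, h1, h2⟩ := ihα hγ.1 (fun x hx => hO x (Or.inl hx)) hv hs
      exact ⟨t, .altLeft h1, h2⟩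
    · obtain ⟨t, h1, h2⟩ := ihβ hγ.2 (fun x hx => hO x (Or.inr hx)) hv hs
      exact ⟨t, .altRight h1, h2⟩
  | cat α β ihα ihβ =>
    obtain ⟨u, hu, v, hv', rfl⟩ := Language.mem_mul.1 hv
    obtain ⟨t, h1, h2⟩ := ihα hγ.1 (fun x hx => hO x (Or.inl hx)) hu hs
    obtain ⟨t', h3, h4⟩ := ihβ hγ.2 (fun x hx => hO x (Or.inr hx)) hv' h2.1
    have ho := (isBalanced_labLang α hγ.1 (fun x hx => hO x (Or.inl hx)) u hu).2
    refine ⟨t', ?_, h2.append ho h4⟩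
    rw [output_append, ho]
    exact .cat h1 h3
  | star α ih =>
    exact match_star_of_mem (isBalanced_labLang α hγ hO) (fun hv hs => ih hγ hO hv hs) hv hs
  | plus α ih =>
    obtain ⟨u, hu, v, hv', rfl⟩ := Language.mem_mul.1 hv
    obtain ⟨t, h1, h2⟩ := ih hγ hO hu hs
    have hb := isBalanced_labLang α hγ hO
    obtain ⟨t', h3, h4⟩ := match_star_of_mem hb (fun hv hs => ih hγ hO hv hs) hv' h2.1
    refine ⟨t', ?_, h2.append (hb u hu).2 h4⟩
    rw [output_append, (hb u hu).2]
    exact .plus h1 h3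
  | bind x α ih =>
    obtain ⟨_, ht, _, h2, rfl⟩ := Language.mem_mul.1 hv
    obtain ⟨_, h1, u, hu, rfl⟩ := Language.mem_mul.1 ht
    obtain rfl := mem_single.1 h1
    obtain rfl := mem_single.1 h2
    obtain ⟨t, h3, h4⟩ := ih hγ.2 (forall_notMem_insert hγ.1 hO) hu (update_agree hs)
    refine ⟨_, ?_, endsWith_bind (hO x (Or.inl rfl)) h4⟩
    rw [output_bind]
    exact .bind h3

theorem mem_labLang_of_match {γ : Regex A} {s t : ℕ → List A} {w : List A} (h : Match γ s w t)
    (hγ : γ.WellFormed) {O : Set ℕ} (hO : ∀ x ∈ γ.mems, x ∉ O) {m : ℕ → List A}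
    (hs : ∀ x ∉ O, m x = s x) :
    ∃ v ∈ γ.labLang, output v m O = w ∧ EndsWith v m O t := by
  induction h generalizing O m with
  | eps s => exact ⟨[], rfl, rfl, endsWith_nil hs⟩
  | char a s => exact ⟨_, mem_single.2 rfl, rfl, endsWith_letter hs _⟩
  | ref y s =>
    refine ⟨_, mem_single.2 rfl, ?_, endsWith_letter hs _⟩
    simp [output, letter, hs y (hO y rfl)]
  | altLeft _ ih =>
    obtain ⟨v, h1, h2⟩ := ih hγ.1 (fun x hx => hO x (Or.inl hx)) hs
    exact ⟨v, Or.inl h1, h2⟩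
  | altRight _ ih =>
    obtain ⟨v, h1, h2⟩ := ih hγ.2 (fun x hx => hO x (Or.inr hx)) hs
    exact ⟨v, Or.inr h1, h2⟩
  | cat _ _ ih ih' =>
    obtain ⟨u, h1, rfl, h2⟩ := ih hγ.1 (fun x hx => hO x (Or.inl hx)) hs
    obtain ⟨v, h3, rfl, h4⟩ := ih' hγ.2 (fun x hx => hO x (Or.inr hx)) h2.1
    have ho := (isBalanced_labLang _ hγ.1 (fun x hx => hO x (Or.inl hx)) u h1).2
    refine ⟨u ++ v, Language.append_mem_mul h1 h3, ?_, h2.append ho h4⟩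
    rw [output_append, ho]
  | starNil s => exact ⟨[], Language.nil_mem_kstar _, rfl, endsWith_nil hs⟩
  | @starCons α s v r w t _ _ ih ih' =>
    obtain ⟨u, h1, rfl, h2⟩ := ih hγ hO hs
    obtain ⟨v, h3, rfl, h4⟩ := ih' hγ hO h2.1
    have ho := (isBalanced_labLang α hγ hO u h1).2
    refine ⟨u ++ v, kstar_append (mem_kstar_of_mem h1) h3, ?_, h2.append ho h4⟩
    rw [output_append, ho]
  | @plus α s v r w t _ _ ih ih' =>
    obtain ⟨u, h1, rfl, h2⟩ := ih hγ hO hs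
    obtain ⟨v, h3, rfl, h4⟩ := ih' hγ hO h2.1
    have ho := (isBalanced_labLang α hγ hO u h1).2
    refine ⟨u ++ v, Language.append_mem_mul h1 h3, ?_, h2.append ho h4⟩
    rw [output_append, ho]
  | @bind x α s w t _ ih =>
    obtain ⟨u, h1, rfl, h2⟩ := ih hγ.2 (forall_notMem_insert hγ.1 hO) (update_agree hs)
    have := endsWith_bind (hO x (Or.inl rfl)) h2
    rw [output_bind] at this
    exact ⟨_, Language.append_mem_mul (Language.append_mem_mul (mem_single.2 rfl) h1)
      (mem_single.2 rfl), output_bind _ _ _ _, this⟩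

theorem mem_language_iff {γ : Regex A} (hγ : γ.WellFormed) {w : List A} :
    w ∈ γ.language ↔ ∃ v ∈ γ.refLang,
      output (v.map (Sum.map id γ.sym)) (fun _ => []) ∅ = w := by
  constructor
  · rintro ⟨t, ht⟩
    obtain ⟨v, h1, h2, -⟩ := mem_labLang_of_match ht hγ (fun x _ => Set.notMem_empty x)
      (fun _ _ => rfl)
    rw [← map_refLang] at h1
    obtain ⟨v, hv, rfl⟩ := h1
    exact ⟨v, hv, h2⟩
  · rintro ⟨v, hv, rfl⟩
    have h1 : v.map (Sum.map id γ.sym) ∈ γ.labLang := by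
      rw [← map_refLang]
      exact map_mem_map hv
    obtain ⟨t, h2, -⟩ := match_of_mem_labLang γ hγ (fun x _ => Set.notMem_empty x) h1
      (s := fun _ => []) (fun _ _ => rfl)
    exact ⟨t, h2⟩

end Regex

/-! ## Recall automata -/

/-- Position automata with memories: each state except the initial state `none` is labelled with
the terminal or recall that leads to it, and knows which memories are open. In a transition
`step p q D`, the contents of the memories in `D` are erased. -/
structure RecallAutomaton (A : Type*) (P : Type) where
  /-- the terminal or memory at a position -/
  lab : P → A ⊕ ℕ
  /-- the memories that can be recalled -/
  mems : Finset ℕ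
  /-- the memories that are open in a state -/
  opened : Option P → Set ℕ
  /-- the transitions -/
  step : Option P → P → Set ℕ → Prop
  /-- the accepting states -/
  acc : Option P → Prop
  lab_mem : ∀ {q x}, lab q = Sum.inr x → x ∈ mems
  opened_step : ∀ {p q D x}, step p q D → x ∈ opened (some q) → x ∈ D ∨ x ∈ opened p
  step_unique : ∀ {p q D q' D'}, step p q D → step p q' D' → lab q = lab q' → q = q' ∧ D = D'
  step_recall : ∀ {p q D q' D' x}, step p q D → lab q = Sum.inr x → step p q' D' →
    lab q' = Sum.inr x

/-- From the state `p` with memory contents `m`, the rest `z` of the input can be accepted. -/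
inductive RecallAutomaton.Accepts {P : Type} (G : RecallAutomaton A P) :
    Option P → List A → (ℕ → List A) → Prop
  | done {p m} : G.acc p → Accepts G p [] m
  | step {p q D z m} : G.step p q D →
      Accepts G (some q) z (save (G.opened (some q)) (letter (erase D m) (G.lab q)) (erase D m)) →
      Accepts G p (letter (erase D m) (G.lab q) ++ z) m

/-! ### From a deterministic regex to a recall automaton -/

namespace Regex

theorem exists_ops (s : List (MemOp ⊕ B)) :
    ∃ l : List MemOp, s = l.map Sum.inl ∨ ∃ q s', s = l.map Sum.inl ++ Sum.inr q :: s' := by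
  induction s with
  | nil => exact ⟨[], Or.inl rfl⟩
  | cons c s ih =>
    rcases c with o | q
    · obtain ⟨l, rfl | ⟨q, s', rfl⟩⟩ := ih
      · exact ⟨o :: l, Or.inl rfl⟩
      · exact ⟨o :: l, Or.inr ⟨q, s', rfl⟩⟩
    · exact ⟨[], Or.inr ⟨q, s, rfl⟩⟩

/-- The memories that are opened by a sequence of operations. -/
def dropped (l : List MemOp) : Set ℕ :=
  {x | MemOp.opn x ∈ l}

theorem output_ops (l : List MemOp) (m : ℕ → List A) (O : Set ℕ) :
    output (l.map Sum.inl) m O = [] := by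
  induction l generalizing m O with
  | nil => rfl
  | cons o l ih => rcases o with x | x <;> exact ih _ _

/-- Closing a memory keeps its content, so only the openings in `l` matter, and neither their order
nor `O` does. -/
theorem contents_ops (l : List MemOp) (m : ℕ → List A) (O : Set ℕ) :
    contents (l.map Sum.inl) m O = erase (dropped l) m := by
  induction l generalizing m O with
  | nil =>
    ext1 y
    simp [contents, erase, dropped]
  | cons o l ih =>
    rcases o with x | x
    · refine (ih _ _).trans ?_
      ext1 y
      by_cases hy : MemOp.opn y ∈ l
      · simp [erase, dropped, hy]
      · by_cases hyx : y = x
        · subst hyx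
          simp [erase, dropped, hy]
        · simp [erase, dropped, hy, hyx]
    · refine (ih _ _).trans ?_
      simp [dropped]

theorem mem_openAfter_ops (l : List MemOp) (O : Set ℕ) {x : ℕ}
    (h : x ∈ openAfter (l.map (Sum.inl : MemOp → MemOp ⊕ B)) O) : x ∈ dropped l ∨ x ∈ O := by
  induction l generalizing O with
  | nil => exact Or.inr h
  | cons o l ih =>
    rcases o with y | y
    · rcases ih _ h with h | rfl | h
      · exact Or.inl (List.mem_cons_of_mem _ h)
      · exact Or.inl List.mem_cons_self
      · exact Or.inr h
    · rcases ih _ h with h | h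
      · exact Or.inl (List.mem_cons_of_mem _ h)
      · exact Or.inr h.1

/-- In a valid sequence the operations on `x` alternate, so of any two consecutive ones one is an
opening; if `x` starts closed, the first one is. -/
theorem length_filter_ops (l : List MemOp) (O : Set ℕ) {x : ℕ}
    (hv : Valid (l.map (Sum.inl : MemOp → MemOp ⊕ B)) O) (hx : x ∉ dropped l) :
    (l.filter fun o => o.mem = x).length ≤ 1 ∧
      (x ∉ O → l.filter (fun o => o.mem = x) = []) := by
  induction l generalizing O with
  | nil => simp
  | cons o l ih =>
    have hx' : x ∉ dropped l := fun h => hx (List.mem_cons_of_mem _ h)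
    rcases o with y | y
    · have hyx : y ≠ x := by
        rintro rfl
        exact hx List.mem_cons_self
      obtain ⟨h1, h2⟩ := ih _ hv.2 hx'
      rw [List.filter_cons_of_neg (by simp [MemOp.mem, hyx])]
      refine ⟨h1, fun h => h2 ?_⟩
      rintro (h3 | h3)
      · exact hyx h3.symm
      · exact h h3
    · obtain ⟨h1, h2⟩ := ih _ hv.2 hx'
      by_cases hyx : y = x
      · subst hyx
        rw [List.filter_cons_of_pos (by simp [MemOp.mem]), h2 (by simp)]
        exact ⟨by simp, fun h => (h hv.1).elim⟩
      · rw [List.filter_cons_of_neg (by simp [MemOp.mem, hyx])]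
        exact ⟨h1, fun h => h2 fun h3 => h h3.1⟩

/-- Determinism of the position automaton controls only net effects. For valid sequences these
determine the erased memories: a final closing preceded by another operation on `x` really is a
reset. -/
theorem mem_dropped_iff {l : List MemOp} {O : Set ℕ} {x : ℕ}
    (hv : Valid (l.map (Sum.inl : MemOp → MemOp ⊕ B)) O) :
    x ∈ dropped l ↔ memInstr l x = .opn ∨ memInstr l x = .rst := by
  have hf : x ∈ dropped l ↔ MemOp.opn x ∈ (l.filter fun o => o.mem = x).reverse := by
    simp [dropped, MemOp.mem]
  have hm : ∀ o ∈ (l.filter fun o => o.mem = x).reverse, o.mem = x := by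
    simp
  have hl := fun h => (length_filter_ops l O hv (x := x) h).1
  rw [← List.length_reverse] at hl
  unfold memInstr
  generalize (l.filter fun o => o.mem = x).reverse = f at hf hm hl
  match f with
  | [] => simpa using hf
  | .opn y :: f =>
    have : y = x := hm (.opn y) List.mem_cons_self
    subst this
    simpa using hf
  | [.cls y] => simpa using hf
  | .cls y :: c :: f =>
    refine ⟨fun _ => Or.inr rfl, fun _ => ?_⟩
    by_contra h
    simpa using hl h

/-- The state of the position automaton. -/
def toState {P : Type} : Option P → PosState P
  | none => .src
  | some p => .pos p

/-- What can follow a state in a ref-word. -/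
def residual (γ : Regex A) : Option γ.Pos → Language (MemOp ⊕ γ.Pos)
  | none => γ.refLang
  | some p => {s | ∃ r, r ++ Sum.inr p :: s ∈ γ.refLang}

theorem follows_iff {γ : Regex A} {p : Option γ.Pos} {l : List MemOp} {q : γ.Pos} :
    γ.Follows (toState p) l q ↔ ∃ s, l.map Sum.inl ++ Sum.inr q :: s ∈ γ.residual p := by
  rcases p with _ | p
  · exact Iff.rfl
  · exact exists_comm

theorem endsIn_iff {γ : Regex A} {p : Option γ.Pos} :
    γ.EndsIn (toState p) ↔ ∃ l : List MemOp, l.map Sum.inl ∈ γ.residual p := by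
  rcases p with _ | p
  · exact Iff.rfl
  · exact exists_comm

/-- Locality as a gluing rule: transitions taken from different ref-words can be chained into one.
-/
theorem residual_append {γ : Regex A} {p : Option γ.Pos} {q : γ.Pos}
    {r s s' : List (MemOp ⊕ γ.Pos)} (h : r ++ Sum.inr q :: s ∈ γ.residual p)
    (h' : s' ∈ γ.residual (some q)) : r ++ Sum.inr q :: s' ∈ γ.residual p := by
  obtain ⟨r', h'⟩ := h'
  rcases p with _ | p
  · exact isLocal_refLang γ h h'
  · obtain ⟨t, ht⟩ := h
    have := isLocal_refLang γ (r := t ++ Sum.inr p :: r) (s := s) (by simpa using ht) h'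
    exact ⟨t, by simpa using this⟩

theorem mem_residual_some {γ : Regex A} {p : Option γ.Pos} {q : γ.Pos}
    {r s : List (MemOp ⊕ γ.Pos)} (h : r ++ Sum.inr q :: s ∈ γ.residual p) :
    s ∈ γ.residual (some q) := by
  rcases p with _ | p
  · exact ⟨r, h⟩
  · obtain ⟨t, ht⟩ := h
    exact ⟨t ++ Sum.inr p :: r, by simpa using ht⟩

/-- The memories that are open in a state. -/
def openIn (γ : Regex A) : Option γ.Pos → Set ℕ
  | none => ∅
  | some p => γ.openAt p

theorem openAfter_residual {γ : Regex A} (hγ : γ.WellFormed) {p : Option γ.Pos} {q : γ.Pos}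
    {r s : List (MemOp ⊕ γ.Pos)} (h : r ++ Sum.inr q :: s ∈ γ.residual p) :
    openAfter r (γ.openIn p) = γ.openAt q ∧ Valid r (γ.openIn p) := by
  have hO : ∀ x ∈ γ.mems, x ∉ (∅ : Set ℕ) := fun x _ => Set.notMem_empty x
  have hb := isBalanced_refLang γ hγ hO
  have ho := opensAt_refLang γ hγ hO
  rcases p with _ | p
  · exact ⟨(ho h).trans (Set.empty_union _), ((valid_append _ _ _).1 (hb _ h).1).1⟩
  · obtain ⟨t, ht⟩ := h
    have h1 := (ho ht).trans (Set.empty_union _)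
    have h2 := (ho (r := t ++ Sum.inr p :: r) (by simpa using ht)).trans (Set.empty_union _)
    rw [openAfter_append, h1] at h2
    have h3 := ((valid_append _ _ _).1 (hb _ ht).1).2
    rw [h1] at h3
    exact ⟨h2, ((valid_append _ _ _).1 h3).1⟩

theorem sym_mem_mems {γ : Regex A} {p : γ.Pos} {x : ℕ} (h : γ.sym p = Sum.inr x) :
    x ∈ γ.mems := by
  induction γ with
  | empty => exact p.elim
  | eps => exact p.elim
  | char a => cases h
  | ref y =>
    cases h
    rfl
  | alt α β ihα ihβ =>
    rcases p with p | p
    · exact Or.inl (ihα h)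
    · exact Or.inr (ihβ h)
  | cat α β ihα ihβ =>
    rcases p with p | p
    · exact Or.inl (ihα h)
    · exact Or.inr (ihβ h)
  | star α ih => exact ih h
  | plus α ih => exact ih h
  | bind y α ih => exact Or.inr (ih h)

theorem mems_finite (γ : Regex A) : γ.mems.Finite := by
  induction γ with
  | empty => exact Set.finite_empty
  | eps => exact Set.finite_empty
  | char a => exact Set.finite_empty
  | ref x => exact Set.finite_singleton x
  | alt α β ihα ihβ => exact ihα.union ihβ
  | cat α β ihα ihβ => exact ihα.union ihβ
  | star α ih => exact ih
  | plus α ih => exact ih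
  | bind x α ih => exact ih.insert x

theorem finite_pos (γ : Regex A) : Finite γ.Pos ∧ Nat.card γ.Pos = γ.occ := by
  induction γ with
  | empty => exact ⟨inferInstanceAs (Finite Empty), Nat.card_of_isEmpty (α := Empty)⟩
  | eps => exact ⟨inferInstanceAs (Finite Empty), Nat.card_of_isEmpty (α := Empty)⟩
  | char a => exact ⟨inferInstanceAs (Finite Unit), Nat.card_unique (α := Unit)⟩
  | ref x => exact ⟨inferInstanceAs (Finite Unit), Nat.card_unique (α := Unit)⟩
  | alt α β ihα ihβ =>
    have := ihα.1
    have := ihβ.1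
    refine ⟨inferInstanceAs (Finite (α.Pos ⊕ β.Pos)), ?_⟩
    exact (Nat.card_sum (α := α.Pos) (β := β.Pos)).trans (congrArg₂ _ ihα.2 ihβ.2)
  | cat α β ihα ihβ =>
    have := ihα.1
    have := ihβ.1
    refine ⟨inferInstanceAs (Finite (α.Pos ⊕ β.Pos)), ?_⟩
    exact (Nat.card_sum (α := α.Pos) (β := β.Pos)).trans (congrArg₂ _ ihα.2 ihβ.2)
  | star α ih => exact ih
  | plus α ih => exact ih
  | bind x α ih => exact ih

/-- Equal labels give equal targets and net effects. Both operation sequences are valid from the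
open set of `p`, so they erase the same memories. -/
theorem follows_unique {γ : Regex A} (hγ : γ.IsDRX) {p : Option γ.Pos} {l l' : List MemOp}
    {q q' : γ.Pos} (h : γ.Follows (toState p) l q) (h' : γ.Follows (toState p) l' q')
    (hq : γ.sym q = γ.sym q') : q = q' ∧ dropped l = dropped l' := by
  have := hγ.2.1 (toState p) (γ.sym q) (x := (.pos q, memInstr l)) (Or.inr ⟨q, l, h, rfl, rfl⟩)
    (y := (.pos q', memInstr l')) (Or.inr ⟨q', l', h', hq.symm, rfl⟩)
  obtain ⟨h1, h2⟩ := Prod.mk.inj this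
  cases h1
  obtain ⟨s, hs⟩ := follows_iff.1 h
  obtain ⟨s', hs'⟩ := follows_iff.1 h'
  refine ⟨rfl, Set.ext fun x => ?_⟩
  rw [mem_dropped_iff (openAfter_residual hγ.1 hs).2,
    mem_dropped_iff (openAfter_residual hγ.1 hs').2,
    h2]

theorem follows_recall {γ : Regex A} (hγ : γ.IsDRX) {p : Option γ.Pos} {l l' : List MemOp}
    {q q' : γ.Pos} {x : ℕ} (h : γ.Follows (toState p) l q) (hx : γ.sym q = Sum.inr x)
    (h' : γ.Follows (toState p) l' q') : γ.sym q' = Sum.inr x := by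
  by_contra hq
  have h1 := hγ.2.2 (toState p) x (γ.sym q') ⟨(.pos q, memInstr l), Or.inr ⟨q, l, h, hx, rfl⟩⟩ hq
  have h2 : (PosState.pos q', memInstr l') ∈ γ.toAutomaton.trans (toState p) (γ.sym q') :=
    Or.inr ⟨q', l', h', rfl, rfl⟩
  exact (h1 ▸ h2 :)

/-- The recall automaton of a deterministic regex. -/
noncomputable def recallAutomaton (γ : Regex A) (hγ : γ.IsDRX) : RecallAutomaton A γ.Pos where
  lab := γ.sym
  mems := γ.mems_finite.toFinset
  opened := γ.openIn
  step p q D := ∃ l, γ.Follows (toState p) l q ∧ dropped l = D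
  acc p := γ.EndsIn (toState p)
  lab_mem h := γ.mems_finite.mem_toFinset.2 (sym_mem_mems h)
  opened_step := by
    rintro p q D x ⟨l, hl, rfl⟩ hx
    obtain ⟨s, hs⟩ := follows_iff.1 hl
    change x ∈ γ.openAt q at hx
    rw [← (openAfter_residual hγ.1 hs).1] at hx
    exact mem_openAfter_ops l _ hx
  step_unique := by
    rintro p q D q' D' ⟨l, hl, rfl⟩ ⟨l', hl', rfl⟩ h
    exact follows_unique hγ hl hl' h
  step_recall := by
    rintro p q D q' D' x ⟨l, hl, rfl⟩ hx ⟨l', hl', rfl⟩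
    exact follows_recall hγ hl hx hl'

theorem map_ops (f : B → C) (l : List MemOp) :
    (l.map (Sum.inl : MemOp → MemOp ⊕ B)).map (Sum.map id f) = l.map Sum.inl := by
  simp

theorem accepts_of_mem_residual {γ : Regex A} (hγ : γ.IsDRX) (n : ℕ) {p : Option γ.Pos}
    {s : List (MemOp ⊕ γ.Pos)} (hn : s.length ≤ n) (hs : s ∈ γ.residual p) (m : ℕ → List A) :
    (γ.recallAutomaton hγ).Accepts p (output (s.map (Sum.map id γ.sym)) m (γ.openIn p)) m := by
  -- The bound on the length serves as induction parameter because `s` is cut at its next position,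
  -- after an arbitrary block of operations.
  induction n generalizing p s m with
  | zero =>
    obtain rfl := List.length_eq_zero_iff.1 (Nat.le_zero.1 hn)
    exact .done (endsIn_iff.2 ⟨[], hs⟩)
  | succ n ih =>
    obtain ⟨l, rfl | ⟨q, s', rfl⟩⟩ := exists_ops s
    · rw [map_ops, output_ops]
      exact .done (endsIn_iff.2 ⟨l, hs⟩)
    · have h1 := (openAfter_residual hγ.1 hs).1
      rw [List.map_append, map_ops, output_append, output_ops, contents_ops]
      have h2 : openAfter (l.map (Sum.inl : MemOp → MemOp ⊕ (A ⊕ ℕ))) (γ.openIn p) =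
          γ.openAt q := by
        rw [← map_ops γ.sym, openAfter_map, h1]
      rw [h2]
      simp only [List.length_append, List.length_map, List.length_cons] at hn
      exact .step ⟨l, follows_iff.2 ⟨s', hs⟩, rfl⟩ (ih (p := some q) (by omega)
        (mem_residual_some hs) _)

/-- Each step of the run is witnessed by a ref-word of its own; `residual_append` splices them. -/
theorem exists_residual_of_accepts {γ : Regex A} (hγ : γ.IsDRX) {p : Option γ.Pos}
    {z : List A} {m : ℕ → List A} (h : (γ.recallAutomaton hγ).Accepts p z m) :
    ∃ s ∈ γ.residual p, output (s.map (Sum.map id γ.sym)) m (γ.openIn p) = z := by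
  induction h with
  | done h =>
    obtain ⟨l, hl⟩ := endsIn_iff.1 h
    exact ⟨_, hl, by rw [map_ops, output_ops]⟩
  | @step p q D z m h _ ih =>
    obtain ⟨s, hs, rfl⟩ := ih
    obtain ⟨l, hl, rfl⟩ := h
    obtain ⟨s', hs'⟩ := follows_iff.1 hl
    refine ⟨_, residual_append hs' hs, ?_⟩
    have h1 := (openAfter_residual hγ.1 hs').1
    rw [List.map_append, map_ops, output_append, output_ops, contents_ops]
    have h2 : openAfter (l.map (Sum.inl : MemOp → MemOp ⊕ (A ⊕ ℕ))) (γ.openIn p) =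
        γ.openAt q := by
      rw [← map_ops γ.sym, openAfter_map, h1]
    rw [h2]
    rfl

theorem mem_language_iff_accepts {γ : Regex A} (hγ : γ.IsDRX) {w : List A} :
    w ∈ γ.language ↔ (γ.recallAutomaton hγ).Accepts none w fun _ => [] := by
  rw [mem_language_iff hγ.1]
  constructor
  · rintro ⟨v, hv, rfl⟩
    exact accepts_of_mem_residual hγ _ le_rfl (p := none) hv _
  · intro h
    exact exists_residual_of_accepts hγ h

end Regex

end DetRegex

/-! ## The program of a recall automaton -/

namespace DetRegex

open FCDatalog

/-- The components of the tuples that represent configurations: the unread input, a word that still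
has to be read from it and to be saved in the open memories, a flag that is empty if the
computation may accept provided that the unread input is empty, the empty word, for each
position a flag that is nonempty if the position has been passed since input was last read, and the
contents of the memories. -/
inductive Key (P : Type) where
  | rest : Key P
  | pend : Key P
  | flag : Key P
  | eps : Key P
  | seen (p : P) : Key P
  | mem (x : ℕ) : Key P

/-- The variables of the rules. -/
inductive Var (P : Type) where
  | univ : Var P
  | old (k : Key P) : Var P
  | new (k : Key P) : Var P
  | aux : Var P
  | aux' : Var P

/-- Keys as elements of a sum type. -/
def Key.code {P : Type} : Key P → Fin 4 ⊕ (P ⊕ ℕ)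
  | .rest => .inl 0
  | .pend => .inl 1
  | .flag => .inl 2
  | .eps => .inl 3
  | .seen p => .inr (.inl p)
  | .mem x => .inr (.inr x)

/-- Variables as elements of a sum type. -/
def Var.code {P : Type} : Var P → Fin 3 ⊕ (Key P ⊕ Key P)
  | .univ => .inl 0
  | .aux => .inl 1
  | .aux' => .inl 2
  | .old k => .inr (.inl k)
  | .new k => .inr (.inr k)

instance {P : Type} [Finite P] : Countable (Key P) := by
  refine Function.Injective.countable (f := Key.code) fun k k' h => ?_
  cases k <;> cases k' <;> simp_all [Key.code]

instance {P : Type} [Finite P] : Countable (Var P) := by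
  refine Function.Injective.countable (f := Var.code) fun k k' h => ?_
  cases k <;> cases k' <;> simp_all [Var.code]

/-- The number of a variable. -/
noncomputable def idx {P : Type} [Finite P] : Var P → ℕ :=
  (exists_injective_nat (Var P)).choose

theorem idx_injective {P : Type} [Finite P] : Function.Injective (idx : Var P → ℕ) :=
  (exists_injective_nat (Var P)).choose_spec

/-- Rules in which the variables have not yet been numbered. The relation symbols are `none` for the
output, `some none` for the relation of all tuples, and `some (some p)` for the position `p`. -/
structure Schema (A : Type*) (P : Type) where
  /-- the head symbol -/
  head : Option (Option P)
  /-- the variables in the head -/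
  arg : Key P → Var P
  /-- the pattern equations -/
  eqs : List (Var P × List (A ⊕ Var P))
  /-- the recursive atom -/
  call : Option (P × (Key P → Var P))

namespace RecallAutomaton

variable {A : Type*} {P : Type} [Finite P] (G : RecallAutomaton A P)

/-- The components of a tuple, in order. -/
noncomputable def keys : List (Key P) :=
  [.rest, .pend, .flag, .eps] ++ (Set.finite_univ (α := P)).toFinset.toList.map .seen ++
    G.mems.toList.map .mem

theorem rest_mem_keys : Key.rest ∈ G.keys := by simp [keys]

theorem pend_mem_keys : Key.pend ∈ G.keys := by simp [keys]

theorem flag_mem_keys : Key.flag ∈ G.keys := by simp [keys]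

theorem eps_mem_keys : Key.eps ∈ G.keys := by simp [keys]

theorem seen_mem_keys (p : P) : Key.seen p ∈ G.keys := by simp [keys]

theorem mem_mem_keys {x : ℕ} : Key.mem x ∈ G.keys ↔ x ∈ G.mems := by simp [keys]

/-- The arguments of the head of a rule. -/
noncomputable def args (σ : Schema A P) : List ℕ :=
  match σ.head with
  | none => []
  | some _ => G.keys.map (idx ∘ σ.arg)

/-- The atom that makes all variables of the head occur in the body. -/
noncomputable def anyAtom (σ : Schema A P) : List (Atom A (Option (Option P))) :=
  match σ.head with
  | some (some _) => [.rel (some none) (G.keys.map (idx ∘ σ.arg))]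
  | _ => []

/-- The recursive atom. -/
noncomputable def callAtom (σ : Schema A P) : List (Atom A (Option (Option P))) :=
  match σ.call with
  | none => []
  | some (q, f) => [.rel (some (some q)) (G.keys.map (idx ∘ f))]

/-- A pattern equation, with numbered variables. -/
noncomputable def eqAtom (e : Var P × List (A ⊕ Var P)) : Atom A (Option (Option P)) :=
  .eq (idx e.1) (e.2.map (Sum.map id idx))

/-- The rule of a schema. -/
noncomputable def toRule (σ : Schema A P) : Rule A (Option (Option P)) where
  head := σ.head
  args := G.args σ
  body := σ.eqs.map eqAtom ++ (G.anyAtom σ ++ G.callAtom σ)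

open Classical in
/-- The pattern for the contents of memory `x` after the memories in `D` have been erased. -/
noncomputable def source (p : P) (D : Set ℕ) (x : ℕ) : List (A ⊕ Var P) :=
  if x ∈ D then [] else
    .inr (.old (.mem x)) :: if x ∈ G.opened (some p) then [.inr (.old .pend)] else []

open Classical in
/-- The pattern for what is saved in memory `x` when the terminal `a` is read in `q`. -/
noncomputable def saved (q : P) (a : A) (x : ℕ) : List (A ⊕ Var P) :=
  if x ∈ G.opened (some q) then [.inl a] else []

/-- The configuration after a terminal has been read. -/
def charCall : Key P → Var P
  | .rest => .new .rest
  | .pend => .old .eps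
  -- The universe variable is the nonempty value of flags and marks; rules of the output symbol that
  -- call a position only apply to nonempty inputs.
  | .flag => .univ
  | .eps => .old .eps
  | .seen _ => .old .eps
  | .mem x => .new (.mem x)

open Classical in
/-- The flag for acceptance in a state. -/
noncomputable def flagVar (p : Option P) (v : Var P) : Var P :=
  if G.acc p then .old .eps else v

/-- The configuration after a nonempty pending word has been read and `y` is recalled. -/
noncomputable def recallCall (p : P) (y : ℕ) : Key P → Var P
  | .rest => .new .rest
  | .pend => .new (.mem y)
  -- The old flag is not inherited: a nonempty word has been read, which voids an acceptance
  -- recorded before it.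
  | .flag => G.flagVar (some p) .univ
  | .eps => .old .eps
  | .seen _ => .old .eps
  | .mem x => .new (.mem x)

open Classical in
/-- The head of the rule for an empty pending word. -/
noncomputable def passArg (p : P) (k : Key P) : Var P :=
  if k = .pend ∨ k = .seen p then .old .eps else .old k

open Classical in
/-- The variable with the contents of a memory after the memories in `D` have been erased. -/
noncomputable def memVar (D : Set ℕ) (x : ℕ) : Var P :=
  if x ∈ D then .old .eps else .old (.mem x)

open Classical in
/-- The configuration when `y` is recalled after an empty pending word. -/
noncomputable def passCall (p : P) (y : ℕ) (D : Set ℕ) : Key P → Var P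
  | .rest => .old .rest
  | .pend => memVar D y
  | .flag => G.flagVar (some p) (.old .flag)
  | .eps => .old .eps
  | .seen r => if r = p then .univ else .old (.seen r)
  -- An empty pending word adds nothing to the open memories, so each new content is an old one or ε
  -- and needs no equation.
  | .mem x => memVar D x

/-- The configuration when a memory is recalled at the start. -/
noncomputable def startCall : Key P → Var P
  | .rest => .univ
  | .flag => G.flagVar none .univ
  | _ => .old .eps

/-- The rule for accepting the empty word. -/
def ansNil : Schema A P where
  head := none
  arg := .old
  eqs := [(.univ, [])]
  call := none

/-- The rule for starting with the terminal `a`. -/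
noncomputable def ansChar (a : A) (q : P) : Schema A P where
  head := none
  arg := .old
  eqs := [(.univ, [.inl a, .inr (.new .rest)]), (.old .eps, [])] ++
    G.mems.toList.map fun x => (.new (.mem x), G.saved q a x)
  call := some (q, charCall)

/-- The rule for starting with a recall, on words with the first letter `a`. -/
noncomputable def ansRecall (a : A) (q : P) : Schema A P where
  head := none
  arg := .old
  eqs := [(.univ, [.inl a, .inr .aux]), (.old .eps, [])]
  call := some (q, G.startCall)

/-- The rule for the relation of all tuples. -/
noncomputable def anyTuple : Schema A P where
  head := some none
  arg := .old
  eqs := G.keys.map fun k => (.old k, [.inr (.new k)])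
  call := none

/-- The rule for reading the terminal `a` in a transition from `p` to `q`. -/
noncomputable def charRule (p : P) (a : A) (q : P) (D : Set ℕ) : Schema A P where
  head := some (some p)
  arg := .old
  eqs := [(.old .rest, [.inr (.old .pend), .inl a, .inr (.new .rest)]), (.old .eps, [])] ++
    G.mems.toList.map fun x => (.new (.mem x), G.source p D x ++ G.saved q a x)
  call := some (q, charCall)

/-- The rule for a transition from `p` to `q` that recalls `y`, when the pending word starts with
`a`. -/
noncomputable def recallRule (p : P) (a : A) (q : P) (y : ℕ) (D : Set ℕ) : Schema A P where
  head := some (some p)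
  arg := .old
  eqs := [(.old .rest, [.inr (.old .pend), .inr (.new .rest)]),
      -- Forces the pending word to be nonempty, which makes the preceding equation strictly
      -- decreasing.
      (.old .pend, [.inl a, .inr .aux]), (.old .eps, [])] ++
    G.mems.toList.map fun x => (.new (.mem x), G.source p D x)
  call := some (q, G.recallCall p y)

/-- The rule for a transition from `p` to `q` that recalls `y`, when the pending word is empty. -/
noncomputable def passRule (p : P) (q : P) (y : ℕ) (D : Set ℕ) : Schema A P where
  head := some (some p)
  -- Repeating `.old .eps` in the head tests that the pending word and the mark of `p` are empty
  -- without a pattern equation, so the rule stays outside `recRules`.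
  arg := passArg p
  eqs := []
  call := some (q, G.passCall p y D)

open Classical in
/-- The rule for accepting in a position without transitions that recall a memory. -/
noncomputable def acceptRule (p : P) : Schema A P where
  head := some (some p)
  arg := .old
  -- An empty mark separates this rule from `flagRule`, which handles repeated visits.
  eqs := (.old (.seen p), []) ::
    if G.acc (some p) then [(.old .rest, [.inr (.old .pend)])]
    else [(.old .rest, []), (.old .pend, []), (.old .flag, [])]
  call := none

/-- The rule for accepting because of the flag, when the pending word is nonempty or `p` is entered
repeatedly without reading. -/
def flagRule (p : P) (a : A) : Schema A P where
  head := some (some p)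
  arg := .old
  eqs := [(.old .rest, []), (.old .flag, []), (.old .eps, []),
    -- A single first-letter test for "pending word or mark nonempty". In the configurations that
    -- matter at most one of the two is nonempty, so the concatenation is a factor of the input.
    (.aux', [.inr (.old .pend), .inr (.old (.seen p))]), (.aux', [.inl a, .inr .aux])]
  call := none

/-- The positions of terminals. -/
abbrev CharPos : Type :=
  {p : P // ∃ a, G.lab p = Sum.inl a}

/-- The positions of recalls. -/
abbrev RecallPos : Type :=
  {p : P // ∃ x, G.lab p = Sum.inr x}

/-- Indices of the rules. -/
abbrev RuleIndex : Type :=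
  (Option G.CharPos ⊕ P × Option G.CharPos) ⊕ (G.RecallPos × G.CharPos ⊕ P)

/-- The rules of the program. -/
inductive IsRule : G.RuleIndex → Schema A P → Prop
  | ansNil : G.Accepts none [] (fun _ => []) → IsRule (.inl (.inl none)) ansNil
  | ansChar {c a q D} : G.lab c.1 = Sum.inl a → G.step none q D → G.lab q = Sum.inl a →
      IsRule (.inl (.inl (some c))) (G.ansChar a q)
  | ansRecall {c a q y D} : G.lab c.1 = Sum.inl a → G.step none q D → G.lab q = Sum.inr y →
      IsRule (.inl (.inl (some c))) (G.ansRecall a q)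
  -- All these indices give the same rule. Without positions there is no index and no such rule, as
  -- the bound 1 for `n = 0` requires.
  | anyTuple (p) : IsRule (.inr (.inr p)) G.anyTuple
  | charRule {p c a q D} : G.lab c.1 = Sum.inl a → G.step (some p) q D → G.lab q = Sum.inl a →
      IsRule (.inl (.inr (p, some c))) (G.charRule p a q D)
  | recallRule {p c a q y D} : G.lab c.1 = Sum.inl a → G.step (some p) q D →
      G.lab q = Sum.inr y → IsRule (.inl (.inr (p, some c))) (G.recallRule p a q y D)
  | passRule {p q y D} : G.step (some p) q D → G.lab q = Sum.inr y →
      IsRule (.inl (.inr (p, none))) (G.passRule p q y D)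
  | acceptRule {p} : (∀ q D y, G.step (some p) q D → G.lab q ≠ Sum.inr y) →
      IsRule (.inl (.inr (p, none))) (G.acceptRule p)
  | flagRule {p : G.RecallPos} {c a} : G.lab c.1 = Sum.inl a →
      IsRule (.inr (.inl (p, c))) (flagRule p.1 a)

/-- Terminal rules and recall rules share the indices given by a state and a letter, and passing and
accepting share one per position. There is no conflict, because a state with a recall transition has
no other transition, and `acceptRule` requires that there is none. -/
theorem IsRule.unique {G : RecallAutomaton A P} {i : G.RuleIndex} {σ τ : Schema A P}
    (h : G.IsRule i σ) (h' : G.IsRule i τ) : σ = τ := by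
  cases h with
  | ansNil => cases h'; rfl
  | anyTuple => cases h'; rfl
  | ansChar h1 h2 h3 =>
    cases h' with
    | ansChar h4 h5 h6 =>
      cases h1.symm.trans h4
      obtain ⟨rfl, -⟩ := G.step_unique h2 h5 (h3.trans h6.symm)
      rfl
    | ansRecall h4 h5 h6 => cases h3.symm.trans (G.step_recall h5 h6 h2)
  | ansRecall h1 h2 h3 =>
    cases h' with
    | ansChar h4 h5 h6 => cases h6.symm.trans (G.step_recall h2 h3 h5)
    | ansRecall h4 h5 h6 =>
      cases h1.symm.trans h4
      obtain ⟨rfl, -⟩ := G.step_unique h2 h5 (h3.trans (G.step_recall h2 h3 h5).symm)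
      rfl
  | charRule h1 h2 h3 =>
    cases h' with
    | charRule h4 h5 h6 =>
      cases h1.symm.trans h4
      obtain ⟨rfl, rfl⟩ := G.step_unique h2 h5 (h3.trans h6.symm)
      rfl
    | recallRule h4 h5 h6 => cases h3.symm.trans (G.step_recall h5 h6 h2)
  | recallRule h1 h2 h3 =>
    cases h' with
    | charRule h4 h5 h6 => cases h6.symm.trans (G.step_recall h2 h3 h5)
    | recallRule h4 h5 h6 =>
      cases h1.symm.trans h4
      cases h6.symm.trans (G.step_recall h2 h3 h5)
      obtain ⟨rfl, rfl⟩ := G.step_unique h2 h5 (h3.trans h6.symm)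
      rfl
  | passRule h2 h3 =>
    cases h' with
    | passRule h5 h6 =>
      cases h6.symm.trans (G.step_recall h2 h3 h5)
      obtain ⟨rfl, rfl⟩ := G.step_unique h2 h5 (h3.trans h6.symm)
      rfl
    | acceptRule h5 => exact (h5 _ _ _ h2 h3).elim
  | acceptRule h2 =>
    cases h' with
    | passRule h5 h6 => exact (h2 _ _ _ h5 h6).elim
    | acceptRule h5 => rfl
  | flagRule h1 =>
    cases h' with
    | flagRule h4 =>
      cases h1.symm.trans h4
      rfl

/-! ### The number of rules -/

/-- The set of rules. -/
def ruleSet : Set (Rule A (Option (Option P))) :=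
  {ρ | ∃ i σ, G.IsRule i σ ∧ G.toRule σ = ρ}

/-- An index of a rule. -/
noncomputable def ruleIndex (ρ : G.ruleSet) : G.RuleIndex :=
  ρ.2.choose

theorem ruleIndex_injective : Function.Injective G.ruleIndex := by
  intro ρ χ h
  obtain ⟨σ, h1, h2⟩ := ρ.2.choose_spec
  obtain ⟨τ, h3, h4⟩ := χ.2.choose_spec
  refine Subtype.ext (h2.symm.trans (Eq.trans ?_ h4))
  change ρ.2.choose = χ.2.choose at h
  rw [h] at h1
  rw [h1.unique h3]

instance : Finite G.ruleSet :=
  Finite.of_injective _ G.ruleIndex_injective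

theorem card_charPos_add_card_recallPos :
    Nat.card G.CharPos + Nat.card G.RecallPos = Nat.card P := by
  classical
  rw [← Nat.card_sum]
  refine Nat.card_congr ((Equiv.sumCongr (Equiv.refl _) (Equiv.subtypeEquivRight fun p => ?_)).trans
    (Equiv.sumCompl fun p => ∃ a, G.lab p = Sum.inl a))
  rcases G.lab p with a | x <;> simp

theorem card_ruleSet_le :
    Nat.card G.ruleSet ≤ Nat.card P * (Nat.card P + 3) + 1 := by
  refine (Nat.card_le_card_of_injective _ G.ruleIndex_injective).trans ?_
  have h := G.card_charPos_add_card_recallPos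
  simp only [Nat.card_sum, Nat.card_prod, Finite.card_option]
  rw [← h]
  generalize Nat.card G.CharPos = c
  generalize Nat.card G.RecallPos = r
  -- With `n = c + r`, the bound exceeds the number of indices by `r² + r`.
  nlinarith [Nat.zero_le (r * r)]

/-! ### Bodies of the rules, and the program -/

theorem args_eq {σ : Schema A P} {R : Option P} (h : σ.head = some R) :
    (G.toRule σ).args = G.keys.map (idx ∘ σ.arg) := by
  simp only [toRule, args, h]

theorem mem_body_rel {σ : Schema A P} {R : Option (Option P)} {ys : List ℕ}
    (h : Atom.rel R ys ∈ (G.toRule σ).body) :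
    (∃ p, σ.head = some (some p) ∧ R = some none ∧ ys = G.keys.map (idx ∘ σ.arg)) ∨
      ∃ q f, σ.call = some (q, f) ∧ R = some (some q) ∧ ys = G.keys.map (idx ∘ f) := by
  rcases List.mem_append.1 h with h | h
  · obtain ⟨e, -, he⟩ := List.mem_map.1 h
    cases he
  · rcases List.mem_append.1 h with h | h
    · left
      unfold anyAtom at h
      split at h
      · rename_i p hp
        cases List.mem_singleton.1 h
        exact ⟨p, hp, rfl, rfl⟩
      · cases h
    · right
      unfold callAtom at h
      split at h
      · cases h
      · rename_i q f hq
        cases List.mem_singleton.1 h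
        exact ⟨q, f, hq, rfl, rfl⟩

theorem any_mem_body {σ : Schema A P} {p : P} (h : σ.head = some (some p)) :
    Atom.rel (some none) (G.keys.map (idx ∘ σ.arg)) ∈ (G.toRule σ).body := by
  refine List.mem_append_right _ (List.mem_append_left _ ?_)
  simp only [anyAtom, h, List.mem_singleton]

theorem call_mem_body {σ : Schema A P} {q : P} {f : Key P → Var P} (h : σ.call = some (q, f)) :
    Atom.rel (some (some q)) (G.keys.map (idx ∘ f)) ∈ (G.toRule σ).body := by
  refine List.mem_append_right _ (List.mem_append_right _ ?_)
  simp only [callAtom, h, List.mem_singleton]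

theorem mem_body_eq {σ : Schema A P} {x : ℕ} {α : List (A ⊕ ℕ)} :
    Atom.eq x α ∈ (G.toRule σ).body ↔ ∃ e ∈ σ.eqs, x = idx e.1 ∧ α = e.2.map (Sum.map id idx) := by
  constructor
  · intro h
    rcases List.mem_append.1 h with h | h
    · obtain ⟨e, he, h⟩ := List.mem_map.1 h
      cases h
      exact ⟨e, he, rfl, rfl⟩
    · rcases List.mem_append.1 h with h | h
      · unfold anyAtom at h
        split at h <;> simp at h
      · unfold callAtom at h
        split at h <;> simp at h
  · rintro ⟨e, he, rfl, rfl⟩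
    exact List.mem_append_left _ (List.mem_map.2 ⟨e, he, rfl⟩)

theorem inr_idx_mem {α : List (A ⊕ Var P)} {v : Var P} :
    Sum.inr (idx v) ∈ α.map (Sum.map id idx) ↔ Sum.inr v ∈ α := by
  constructor
  · intro h
    obtain ⟨b, hb, h⟩ := List.mem_map.1 h
    rcases b with a | u
    · cases h
    · exact idx_injective (Sum.inr.inj h) ▸ hb
  · exact fun h => List.mem_map.2 ⟨_, h, rfl⟩

theorem not_mem_source {p : P} {D : Set ℕ} {x : ℕ} {k : Key P} :
    Sum.inr (Var.new k) ∉ (G.source p D x : List (A ⊕ Var P)) := by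
  unfold source
  split_ifs <;> simp

theorem not_mem_saved {q : P} {a : A} {x : ℕ} {v : Var P} :
    Sum.inr v ∉ (G.saved q a x : List (A ⊕ Var P)) := by
  unfold saved
  split_ifs <;> simp

theorem IsRule.eqs_notMem {G : RecallAutomaton A P} {i : G.RuleIndex} {σ : Schema A P}
    (h : G.IsRule i σ) {e : Var P × List (A ⊕ Var P)} (he : e ∈ σ.eqs) : Sum.inr e.1 ∉ e.2 := by
  cases h with
  | ansNil => simp_all [RecallAutomaton.ansNil]
  | anyTuple =>
    simp only [RecallAutomaton.anyTuple, List.mem_map] at he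
    obtain ⟨k, -, rfl⟩ := he
    simp
  | ansChar =>
    simp only [RecallAutomaton.ansChar, List.mem_append, List.mem_cons, List.mem_map,
      List.not_mem_nil, or_false] at he
    obtain (rfl | rfl) | ⟨x, -, rfl⟩ := he
    · simp
    · simp
    · exact G.not_mem_saved
  | ansRecall =>
    simp only [RecallAutomaton.ansRecall, List.mem_cons, List.not_mem_nil, or_false] at he
    obtain rfl | rfl := he <;> simp
  | charRule =>
    simp only [RecallAutomaton.charRule, List.mem_append, List.mem_cons, List.mem_map,
      List.not_mem_nil, or_false] at he
    obtain (rfl | rfl) | ⟨x, -, rfl⟩ := he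
    · simp
    · simp
    · exact fun h => (List.mem_append.1 h).elim G.not_mem_source G.not_mem_saved
  | recallRule =>
    simp only [RecallAutomaton.recallRule, List.mem_append, List.mem_cons, List.mem_map,
      List.not_mem_nil, or_false] at he
    obtain (rfl | rfl | rfl) | ⟨x, -, rfl⟩ := he
    · simp
    · simp
    · simp
    · exact G.not_mem_source
  | passRule => simp [RecallAutomaton.passRule] at he
  | acceptRule =>
    simp only [RecallAutomaton.acceptRule] at he
    split_ifs at he
    · simp only [List.mem_cons, List.not_mem_nil, or_false] at he
      obtain rfl | rfl := he <;> simp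
    · simp only [List.mem_cons, List.not_mem_nil, or_false] at he
      obtain rfl | rfl | rfl | rfl := he <;> simp
  | flagRule =>
    simp only [RecallAutomaton.flagRule, List.mem_cons, List.not_mem_nil, or_false] at he
    obtain rfl | rfl | rfl | rfl | rfl := he <;> simp

open Classical in
/-- The program of a recall automaton. -/
noncomputable abbrev toProgram : Program A where
  univ := idx (.univ : Var P)
  Rel := Option (Option P)
  finite_rel := inferInstance
  ar R := match R with
    | none => 0
    | some _ => G.keys.length
  ans := none
  rules := (Set.toFinite G.ruleSet).toFinset
  body_ne_nil := by
    intro ρ hρ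
    obtain ⟨i, σ, hσ, rfl⟩ := (Set.Finite.mem_toFinset _).1 hρ
    intro h
    have h1 := List.append_eq_nil_iff.1 h
    have h2 := List.append_eq_nil_iff.1 h1.2
    cases hσ <;> simp [ansNil, ansChar, ansRecall, anyTuple, charRule, recallRule, acceptRule,
      flagRule, passRule, callAtom, keys] at h1 h2
  length_args := by
    intro ρ hρ
    obtain ⟨i, σ, hσ, rfl⟩ := (Set.Finite.mem_toFinset _).1 hρ
    change (G.args σ).length = match σ.head with
      | none => 0
      | some _ => G.keys.length
    unfold args
    split <;> simp
  length_atom := by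
    intro ρ hρ R ys h
    obtain ⟨i, σ, hσ, rfl⟩ := (Set.Finite.mem_toFinset _).1 hρ
    obtain ⟨p, -, rfl, rfl⟩ | ⟨q, f, -, rfl, rfl⟩ := G.mem_body_rel h <;> simp
  args_mem_vars := by
    intro ρ hρ x hx
    obtain ⟨i, σ, hσ, rfl⟩ := (Set.Finite.mem_toFinset _).1 hρ
    change x ∈ G.args σ at hx
    unfold args at hx
    split at hx
    · cases hx
    · rename_i R hR
      rcases R with _ | p
      · cases hσ <;> cases hR
        obtain ⟨k, hk, rfl⟩ := List.mem_map.1 hx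
        exact ⟨_, G.mem_body_eq.2 ⟨_, List.mem_map.2 ⟨k, hk, rfl⟩, rfl, rfl⟩, Or.inl rfl⟩
      · exact ⟨_, G.any_mem_body hR, hx⟩
  eq_notMem := by
    intro ρ hρ x α h
    obtain ⟨i, σ, hσ, rfl⟩ := (Set.Finite.mem_toFinset _).1 hρ
    obtain ⟨e, he, rfl, rfl⟩ := G.mem_body_eq.1 h
    rw [inr_idx_mem]
    exact hσ.eqs_notMem he

theorem mem_rules {ρ : Rule A (Option (Option P))} :
    ρ ∈ G.toProgram.rules ↔ ∃ i σ, G.IsRule i σ ∧ G.toRule σ = ρ :=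
  (Set.Finite.mem_toFinset _)

theorem card_rules_le : G.toProgram.rules.card ≤ Nat.card P * (Nat.card P + 3) + 1 := by
  have : G.toProgram.rules.card = Nat.card G.ruleSet :=
    (Nat.card_eq_card_finite_toFinset (Set.toFinite G.ruleSet)).symm
  rw [this]
  exact G.card_ruleSet_le

theorem card_rel : Nat.card G.toProgram.Rel = Nat.card P + 2 := by
  change Nat.card (Option (Option P)) = _
  rw [Finite.card_option, Finite.card_option]

theorem isBoolean_toProgram : G.toProgram.IsBoolean := rfl

end RecallAutomaton

end DetRegex

/-! ### The program is SD-DOLLA+ -/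

namespace DetRegex

open FCDatalog

namespace RecallAutomaton

variable {A : Type*} {P : Type}

/-- The image of a pattern. -/
def patSubst {V : Type*} (η : V → List A) (α : List (A ⊕ V)) : List A :=
  α.flatMap (Sum.elim (fun a => [a]) η)

theorem subst_map {V : Type*} (θ : ℕ → List A) (f : V → ℕ) (α : List (A ⊕ V)) :
    subst θ (α.map (Sum.map id f)) = patSubst (fun v => θ (f v)) α := by
  rw [subst, patSubst, List.flatMap_map]
  congr 1
  ext1 b
  rcases b with a | v <;> rfl

/-- The substitution satisfies the pattern equations of the schema. -/
def Solves (η : Var P → List A) (σ : Schema A P) : Prop :=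
  ∀ e ∈ σ.eqs, η e.1 = patSubst η e.2

variable [Finite P] (G : RecallAutomaton A P)

theorem solves_of_satEqs {w : List A} {σ : Schema A P} {θ : ℕ → List A}
    (h : G.toProgram.SatEqs w (G.toRule σ) θ) :
    θ (idx (.univ : Var P)) = w ∧ Solves (fun v => θ (idx v)) σ := by
  refine ⟨h.1.1, fun e he => ?_⟩
  rw [← subst_map]
  exact h.2 _ _ (G.mem_body_eq.2 ⟨e, he, rfl, rfl⟩)

/-! ### Determinism -/

/-- The rules for a position, and the conditions on the components `rest`, `pend`, `eps` and `seen`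
of a tuple that follow from their pattern equations. -/
inductive StateRule (p : P) : Schema A P → List A → List A → List A → List A → Prop
  | charRule {a q D r g e s t} : G.step (some p) q D → G.lab q = Sum.inl a → r = g ++ a :: t →
      StateRule p (G.charRule p a q D) r g e s
  | recallRule {a q y D r g e s t t'} : G.step (some p) q D → G.lab q = Sum.inr y →
      r = g ++ t → g = a :: t' → e = [] → StateRule p (G.recallRule p a q y D) r g e s
  | passRule {q y D r g e s} : G.step (some p) q D → G.lab q = Sum.inr y → g = e → s = e →
      StateRule p (G.passRule p q y D) r g e s
  | acceptRule {r g e s} : (∀ q D y, G.step (some p) q D → G.lab q ≠ Sum.inr y) → s = [] →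
      (r = g ∨ r = [] ∧ g = []) → StateRule p (G.acceptRule p) r g e s
  | flagRule {a r g e s t} : r = [] → e = [] → g ++ s = a :: t →
      StateRule p (RecallAutomaton.flagRule p a) r g e s

/-- Four components of the head tuple already separate the rules of a position, so the equations for
the memories can be forgotten. -/
theorem stateRule_of_isRule {i : G.RuleIndex} {σ : Schema A P} (h : G.IsRule i σ) {p : P}
    (hp : σ.head = some (some p)) {η : Var P → List A} (hη : Solves η σ) :
    G.StateRule p σ (η (σ.arg .rest)) (η (σ.arg .pend)) (η (σ.arg .eps)) (η (σ.arg (.seen p))) := by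
  cases h with
  | ansNil => cases hp
  | anyTuple => cases hp
  | ansChar => cases hp
  | ansRecall => cases hp
  | charRule h1 h2 h3 =>
    cases hp
    change G.StateRule p _ (η (.old .rest)) (η (.old .pend)) (η (.old .eps)) (η (.old (.seen p)))
    refine .charRule (t := η (.new .rest)) h2 h3 ?_
    simpa [patSubst] using hη (.old .rest, _) (List.mem_append_left _ List.mem_cons_self)
  | recallRule h1 h2 h3 =>
    cases hp
    change G.StateRule p _ (η (.old .rest)) (η (.old .pend)) (η (.old .eps)) (η (.old (.seen p)))
    refine .recallRule (t := η (.new .rest)) (t' := η .aux) h2 h3 ?_ ?_ ?_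
    · simpa [patSubst] using hη (.old .rest, _) (List.mem_append_left _ List.mem_cons_self)
    · simpa [patSubst] using hη (.old .pend, _) (List.mem_append_left _
        (List.mem_cons_of_mem _ List.mem_cons_self))
    · simpa [patSubst] using hη (.old .eps, []) (List.mem_append_left _
        (List.mem_cons_of_mem _ (List.mem_cons_of_mem _ List.mem_cons_self)))
  | passRule h2 h3 =>
    cases hp
    exact .passRule h2 h3 (by simp [RecallAutomaton.passRule, passArg])
      (by simp [RecallAutomaton.passRule, passArg])
  | acceptRule h2 =>
    cases hp
    change G.StateRule p _ (η (.old .rest)) (η (.old .pend)) (η (.old .eps)) (η (.old (.seen p)))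
    refine .acceptRule h2 ?_ ?_
    · simpa [patSubst] using hη (.old (.seen p), []) List.mem_cons_self
    · simp only [Solves, RecallAutomaton.acceptRule] at hη
      by_cases hp : G.acc (some p)
      · left
        simpa [patSubst, hp, RecallAutomaton.acceptRule] using hη (.old .rest, [.inr (.old .pend)])
      · right
        have h3 := hη (.old .rest, [])
        have h4 := hη (.old .pend, [])
        simp only [patSubst, hp] at h3 h4
        simpa using And.intro h3 h4
  | @flagRule p' c a h1 =>
    cases hp
    change G.StateRule p'.1 _ (η (.old .rest)) (η (.old .pend)) (η (.old .eps))
      (η (.old (.seen p'.1)))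
    refine .flagRule (t := η .aux) ?_ ?_ ?_
    · simpa [patSubst] using hη (.old .rest, []) (by simp [RecallAutomaton.flagRule])
    · simpa [patSubst] using hη (.old .eps, []) (by simp [RecallAutomaton.flagRule])
    · have h3 := hη (.aux', [.inr (.old .pend), .inr (.old (.seen p'.1))])
        (by simp [RecallAutomaton.flagRule])
      have h4 := hη (.aux', [.inl a, .inr .aux]) (by simp [RecallAutomaton.flagRule])
      simpa [patSubst] using h3.symm.trans h4

/-- Two terminal rules differ in the letter after the pending word, two recall rules in its first
letter. Passing needs an empty pending word and an empty mark, once `eps` is known to be ε.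
Accepting by flag needs one of the two nonempty and no unread input, whereas terminal and recall
rules need unread input. The remaining pairs are excluded by the determinism of the automaton. -/
theorem StateRule.unique {G : RecallAutomaton A P} {p : P} {σ τ : Schema A P} {r g e s : List A}
    (h : G.StateRule p σ r g e s) (h' : G.StateRule p τ r g e s) : σ = τ := by
  cases h with
  | charRule h1 h2 h3 =>
    cases h' with
    | charRule h4 h5 h6 =>
      cases (List.append_cancel_left (h3.symm.trans h6))
      obtain ⟨rfl, rfl⟩ := G.step_unique h1 h4 (h2.trans h5.symm)
      rfl
    | recallRule h4 h5 => cases h2.symm.trans (G.step_recall h4 h5 h1)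
    | passRule h4 h5 => cases h2.symm.trans (G.step_recall h4 h5 h1)
    | acceptRule h4 h5 h6 => rcases h6 with h6 | h6 <;> simp_all
    | flagRule h4 => simp_all
  | recallRule h1 h2 h3 h7 h8 =>
    cases h' with
    | charRule h4 h5 h6 => cases h5.symm.trans (G.step_recall h1 h2 h4)
    | recallRule h4 h5 h6 h9 =>
      cases h7.symm.trans h9
      cases h5.symm.trans (G.step_recall h1 h2 h4)
      obtain ⟨rfl, rfl⟩ := G.step_unique h1 h4 (h2.trans h5.symm)
      rfl
    | passRule h4 h5 => simp_all
    | acceptRule h4 => exact (h4 _ _ _ h1 h2).elim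
    | flagRule h4 => simp_all
  | passRule h1 h2 h3 h7 =>
    cases h' with
    | charRule h4 h5 h6 => cases h5.symm.trans (G.step_recall h1 h2 h4)
    | recallRule h4 h5 h6 h9 => simp_all
    | passRule h4 h5 =>
      cases h5.symm.trans (G.step_recall h1 h2 h4)
      obtain ⟨rfl, rfl⟩ := G.step_unique h1 h4 (h2.trans h5.symm)
      rfl
    | acceptRule h4 => exact (h4 _ _ _ h1 h2).elim
    | flagRule h4 => simp_all
  | acceptRule h1 h2 h3 =>
    cases h' with
    | charRule h4 h5 h6 => rcases h3 with h3 | h3 <;> simp_all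
    | recallRule h4 h5 => exact (h1 _ _ _ h4 h5).elim
    | passRule h4 h5 => exact (h1 _ _ _ h4 h5).elim
    | acceptRule => rfl
    | flagRule h4 => rcases h3 with h3 | h3 <;> simp_all
  | flagRule h1 h2 h3 =>
    cases h' with
    | charRule h4 h5 h6 => simp_all
    | recallRule => simp_all
    | passRule => simp_all
    | acceptRule h4 h5 h6 => rcases h6 with h6 | h6 <;> simp_all
    | flagRule h4 h5 h6 =>
      cases h3.symm.trans h6
      rfl

/-- The rules for the output symbol, and the words on which their pattern equations can hold. -/
inductive StartRule : Schema A P → List A → Prop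
  | ansNil : StartRule ansNil []
  | ansChar {a q D t} : G.step none q D → G.lab q = Sum.inl a → StartRule (G.ansChar a q) (a :: t)
  | ansRecall {a q y D t} : G.step none q D → G.lab q = Sum.inr y →
      StartRule (G.ansRecall a q) (a :: t)

theorem startRule_of_isRule {i : G.RuleIndex} {σ : Schema A P} (h : G.IsRule i σ)
    (hp : σ.head = none) {η : Var P → List A} (hη : Solves η σ) :
    G.StartRule σ (η .univ) := by
  cases h with
  | ansNil =>
    have : η .univ = [] := by simpa [patSubst] using hη (.univ, []) List.mem_cons_self
    rw [this]
    exact .ansNil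
  | @ansChar c a q D h1 h2 h3 =>
    have : η .univ = a :: η (.new .rest) := by
      simpa [patSubst] using hη (.univ, _) (List.mem_append_left _ List.mem_cons_self)
    rw [this]
    exact .ansChar h2 h3
  | @ansRecall c a q y D h1 h2 h3 =>
    have : η .univ = a :: η .aux := by
      simpa [patSubst] using hη (.univ, _) List.mem_cons_self
    rw [this]
    exact .ansRecall h2 h3
  | anyTuple => cases hp
  | charRule => cases hp
  | recallRule => cases hp
  | passRule => cases hp
  | acceptRule => cases hp
  | flagRule => cases hp

theorem StartRule.unique {G : RecallAutomaton A P} {σ τ : Schema A P} {w : List A}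
    (h : G.StartRule σ w) (h' : G.StartRule τ w) : σ = τ := by
  cases h with
  | ansNil => cases h'; rfl
  | ansChar h1 h2 =>
    cases h' with
    | ansChar h3 h4 =>
      obtain ⟨rfl, -⟩ := G.step_unique h1 h3 (h2.trans h4.symm)
      rfl
    | ansRecall h3 h4 => cases h2.symm.trans (G.step_recall h3 h4 h1)
  | ansRecall h1 h2 =>
    cases h' with
    | ansChar h3 h4 => cases h4.symm.trans (G.step_recall h1 h2 h3)
    | ansRecall h3 h4 =>
      obtain ⟨rfl, -⟩ := G.step_unique h1 h3 (h2.trans (G.step_recall h1 h2 h3).symm)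
      rfl

theorem isGloballyDeterministic_toProgram : G.toProgram.IsGloballyDeterministic := by
  rintro w ρ hρ χ hχ hh hne ⟨t, t', t'', ⟨θ, hθ, ht⟩, ⟨θ', hθ', ht'⟩⟩
  obtain ⟨i, σ, hσ, rfl⟩ := G.mem_rules.1 hρ
  obtain ⟨j, τ, hτ, rfl⟩ := G.mem_rules.1 hχ
  change σ.head = τ.head at hh
  refine hne (congrArg G.toRule ?_)
  obtain ⟨hu, hs⟩ := G.solves_of_satEqs hθ
  obtain ⟨hu', hs'⟩ := G.solves_of_satEqs hθ'
  rcases hR : σ.head with _ | _ | p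
  · have h1 := G.startRule_of_isRule hσ hR hs
    have h2 := G.startRule_of_isRule hτ (hh ▸ hR) hs'
    rw [hu] at h1
    rw [hu'] at h2
    exact h1.unique h2
  · cases hσ <;> cases hR
    cases hτ <;> cases hh
    rfl
  · have e : (G.toRule σ).args.map θ = (G.toRule τ).args.map θ' := by
      have := (Prod.mk.inj ht).1.symm.trans (Prod.mk.inj ht').1
      simp only [Program.top, List.map_append] at this
      exact (List.append_inj' this rfl).1
    rw [G.args_eq hR, G.args_eq (hh ▸ hR), List.map_map, List.map_map, List.map_inj_left] at e
    have h1 := G.stateRule_of_isRule hσ hR hs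
    have h2 := G.stateRule_of_isRule hτ (hh ▸ hR) hs'
    have e1 := e _ G.rest_mem_keys
    have e2 := e _ G.pend_mem_keys
    have e3 := e _ G.eps_mem_keys
    have e4 := e _ (G.seen_mem_keys p)
    simp only [Function.comp] at e1 e2 e3 e4
    rw [← e1, ← e2, ← e3, ← e4] at h2
    exact h1.unique h2

/-! ### Recursion -/

/-- The relation of all tuples uses no symbol, and no rule uses the output symbol, so neither lies
on a cycle of dependencies. -/
theorem exists_of_uses {R R' : Option (Option P)} (h : G.toProgram.Uses R R') :
    R ≠ some none ∧ R' ≠ none := by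
  obtain ⟨ρ, hρ, rfl, ys, hys⟩ := h
  obtain ⟨i, σ, hσ, rfl⟩ := G.mem_rules.1 hρ
  constructor
  · intro h
    change σ.head = _ at h
    obtain ⟨p, hp, -⟩ | ⟨q, f, hf, -⟩ := G.mem_body_rel hys
    · cases h.symm.trans hp
    · cases hσ <;> cases h
      cases hf
  · rintro rfl
    obtain ⟨p, -, h, -⟩ | ⟨q, f, -, h, -⟩ := G.mem_body_rel hys <;> cases h

theorem exists_of_mutRec {R R' : Option (Option P)} (h : G.toProgram.MutRec R R') :
    (∃ p, R = some (some p)) ∧ ∃ p, R' = some (some p) := by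
  have key : ∀ {R R' : Option (Option P)}, Relation.TransGen G.toProgram.Uses R R' →
      R ≠ some none ∧ R' ≠ none := by
    intro R R' h
    induction h with
    | single h => exact G.exists_of_uses h
    | tail _ h ih => exact ⟨ih.1, (G.exists_of_uses h).2⟩
  have h1 := key h.1
  have h2 := key h.2
  constructor
  · rcases R with _ | _ | p
    · exact (h2.2 rfl).elim
    · exact (h1.1 rfl).elim
    · exact ⟨p, rfl⟩
  · rcases R' with _ | _ | p
    · exact (h1.2 rfl).elim
    · exact (h2.1 rfl).elim
    · exact ⟨p, rfl⟩

open Classical in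
-- The atom for all tuples is never recursive, so a rule has at most its call as recursive atom.
theorem recAtoms_toRule (σ : Schema A P) :
    G.toProgram.recAtoms (G.toRule σ) =
      (G.callAtom σ).filter fun φ => decide (G.toProgram.IsRecAtom (G.toRule σ) φ) := by
  unfold Program.recAtoms
  change ((σ.eqs.map eqAtom ++ (G.anyAtom σ ++ G.callAtom σ)).filter _) = _
  rw [List.filter_append, List.filter_append]
  have h1 : (σ.eqs.map eqAtom).filter
      (fun φ => decide (G.toProgram.IsRecAtom (G.toRule σ) φ)) = [] := by
    rw [List.filter_eq_nil_iff]
    intro φ hφ h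
    obtain ⟨e, -, rfl⟩ := List.mem_map.1 hφ
    exact of_decide_eq_true (p := G.toProgram.IsRecAtom (G.toRule σ) (eqAtom e)) h
  have h2 : (G.anyAtom σ).filter
      (fun φ => decide (G.toProgram.IsRecAtom (G.toRule σ) φ)) = [] := by
    rw [List.filter_eq_nil_iff]
    intro φ hφ h
    have h := of_decide_eq_true h
    unfold anyAtom at hφ
    split at hφ
    · cases List.mem_singleton.1 hφ
      obtain ⟨p, hp⟩ := (G.exists_of_mutRec h).2
      cases hp
    · cases hφ
  rw [h1, h2, List.nil_append, List.nil_append]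

theorem isLinear_toProgram : G.toProgram.IsLinear := by
  classical
  intro ρ hρ
  obtain ⟨i, σ, hσ, rfl⟩ := G.mem_rules.1 hρ
  rw [recAtoms_toRule]
  refine (List.length_filter_le _ _).trans ?_
  unfold callAtom
  split <;> simp

theorem bottom_toRule {σ : Schema A P} {q : P} {f : Key P → Var P} (hf : σ.call = some (q, f))
    (h : G.toProgram.MutRec σ.head (some (some q))) :
    G.toProgram.bottom (G.toRule σ) = G.keys.map (idx ∘ f) := by
  classical
  unfold Program.bottom
  rw [recAtoms_toRule]
  have h1 : G.callAtom σ = [.rel (some (some q)) (G.keys.map (idx ∘ f))] := by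
    simp only [callAtom, hf]
  rw [h1, List.filter_cons_of_pos]
  · simp
  · exact decide_eq_true h

/-! ### Uniquely defined variables -/

/-- The variables of a pattern equation. -/
def eqVars (e : Var P × List (A ⊕ Var P)) : Set (Var P) :=
  {v | v = e.1 ∨ Sum.inr v ∈ e.2}

/-- A variable is uniquely defined in the rule of a schema. -/
abbrev Defines (σ : Schema A P) (v : Var P) : Prop :=
  G.toProgram.UniquelyDefined (G.toRule σ) (idx v)

theorem defines_univ (σ : Schema A P) : G.Defines σ .univ :=
  .top _ (List.mem_append_right _ (List.mem_singleton.2 rfl))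

theorem defines_arg {σ : Schema A P} {R : Option P} (h : σ.head = some R) {k : Key P}
    (hk : k ∈ G.keys) : G.Defines σ (σ.arg k) := by
  refine .top _ (List.mem_append_left _ ?_)
  rw [G.args_eq h]
  exact List.mem_map.2 ⟨k, hk, rfl⟩

/-- One equation defines its single unknown `v`; afterwards all its variables are available. -/
theorem defines_eqVars {σ : Schema A P} {e : Var P × List (A ⊕ Var P)} (he : e ∈ σ.eqs) (v : Var P)
    (h : ∀ u ∈ eqVars e, u ≠ v → G.Defines σ u) : ∀ u ∈ eqVars e, G.Defines σ u := by
  intro u hu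
  by_cases huv : u = v
  · subst huv
    refine .step (idx e.1) (e.2.map (Sum.map id idx)) _ (G.mem_body_eq.2 ⟨e, he, rfl, rfl⟩) ?_ ?_
    · rcases hu with rfl | hu
      · exact Or.inl rfl
      · exact Or.inr (inr_idx_mem.2 hu)
    · rintro z (rfl | hz) hzu
      · exact h _ (Or.inl rfl) fun e' => hzu (congrArg idx e')
      · obtain ⟨b, hb, hbz⟩ := List.mem_map.1 hz
        rcases b with a | z'
        · cases hbz
        · cases hbz
          exact h _ (Or.inr hb) fun e' => hzu (congrArg idx e')
  · exact h u hu huv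

theorem uniquelyDefined_of_defines {σ : Schema A P}
    (h1 : ∀ e ∈ σ.eqs, ∀ v ∈ eqVars e, G.Defines σ v)
    (h2 : ∀ q f, σ.call = some (q, f) → ∀ k ∈ G.keys, G.Defines σ (f k)) {x : ℕ}
    (hx : x ∈ (G.toRule σ).vars ∨ x ∈ (G.toRule σ).args) :
    G.toProgram.UniquelyDefined (G.toRule σ) x := by
  rcases hx with ⟨φ, hφ, hx⟩ | hx
  · rcases φ with ⟨y, α⟩ | ⟨R, ys⟩
    · obtain ⟨e, he, rfl, rfl⟩ := G.mem_body_eq.1 hφ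
      rcases hx with rfl | hx
      · exact h1 e he _ (Or.inl rfl)
      · obtain ⟨b, hb, hbx⟩ := List.mem_map.1 hx
        rcases b with a | v
        · cases hbx
        · cases hbx
          exact h1 e he _ (Or.inr hb)
    · obtain ⟨p, hp, -, rfl⟩ | ⟨q, f, hf, -, rfl⟩ := G.mem_body_rel hφ
      · obtain ⟨k, hk, rfl⟩ := List.mem_map.1 hx
        exact G.defines_arg hp hk
      · obtain ⟨k, hk, rfl⟩ := List.mem_map.1 hx
        exact h2 q f hf k hk
  · exact .top _ (List.mem_append_left _ hx)

theorem eqVars_source {p : P} {D : Set ℕ} {x : ℕ} {v : Var P}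
    (h : Sum.inr v ∈ (G.source p D x : List (A ⊕ Var P))) :
    v = .old (.mem x) ∨ v = .old .pend := by
  unfold source at h
  split_ifs at h <;> simp at h <;> tauto

theorem defines_charCall {σ : Schema A P} (h1 : G.Defines σ (.new .rest))
    (h2 : G.Defines σ (.old .eps)) (h3 : ∀ x ∈ G.mems, G.Defines σ (.new (.mem x))) :
    ∀ k ∈ G.keys, G.Defines σ (charCall k) := by
  rintro (_ | _ | _ | _ | q | x) hk
  · exact h1
  · exact h2
  · exact G.defines_univ σ
  · exact h2
  · exact h2
  · exact h3 x (G.mem_mem_keys.1 hk)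

theorem defines_flagVar {σ : Schema A P} (p : Option P) {v : Var P} (h1 : G.Defines σ v)
    (h2 : G.Defines σ (.old .eps)) : G.Defines σ (G.flagVar p v) := by
  unfold flagVar
  split_ifs
  · exact h2
  · exact h1

theorem IsRule.uniquelyDefined {G : RecallAutomaton A P} {i : G.RuleIndex} {σ : Schema A P}
    (h : G.IsRule i σ) {x : ℕ} (hx : x ∈ (G.toRule σ).vars ∨ x ∈ (G.toRule σ).args) :
    G.toProgram.UniquelyDefined (G.toRule σ) x := by
  cases h with
  | ansNil =>
    refine G.uniquelyDefined_of_defines ?_ (by rintro q f ⟨⟩) hx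
    rintro e he v hv
    cases List.mem_singleton.1 he
    rcases hv with rfl | hv
    · exact G.defines_univ _
    · cases hv
  | anyTuple =>
    refine G.uniquelyDefined_of_defines ?_ (by rintro q f ⟨⟩) hx
    intro e he
    obtain ⟨k, hk, rfl⟩ := List.mem_map.1 he
    refine G.defines_eqVars he (.new k) ?_
    rintro u (rfl | hu) huv
    · exact G.defines_arg (σ := G.anyTuple) rfl hk
    · simp at hu
      exact (huv hu).elim
  | @ansChar c a q D h1 h2 h3 =>
    have e1 := G.defines_eqVars (σ := G.ansChar a q) (e := (.univ, [.inl a, .inr (.new .rest)]))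
      (by simp [RecallAutomaton.ansChar]) (.new .rest) (by
        rintro u (rfl | hu) huv
        · exact G.defines_univ _
        · simp at hu
          exact (huv hu).elim)
    have e2 := G.defines_eqVars (σ := G.ansChar a q) (e := (.old .eps, []))
      (by simp [RecallAutomaton.ansChar]) (.old .eps) (by
        rintro u (rfl | hu) huv
        · exact (huv rfl).elim
        · simp at hu)
    have e3 : ∀ y ∈ G.mems, ∀ u ∈ eqVars (Var.new (.mem y), (G.saved q a y : List (A ⊕ Var P))),
        G.Defines (G.ansChar a q) u := by
      intro y hy
      refine G.defines_eqVars (by simpa [RecallAutomaton.ansChar] using hy) (.new (.mem y)) ?_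
      rintro u (rfl | hu) huv
      · exact (huv rfl).elim
      · exact (G.not_mem_saved hu).elim
    refine G.uniquelyDefined_of_defines ?_ ?_ hx
    · intro e he
      simp only [RecallAutomaton.ansChar, List.mem_append, List.mem_cons, List.mem_map,
        List.not_mem_nil, or_false, Finset.mem_toList] at he
      obtain (rfl | rfl) | ⟨y, hy, rfl⟩ := he
      · exact e1
      · exact e2
      · exact e3 y hy
    · rintro q f ⟨⟩
      exact G.defines_charCall (e1 _ (Or.inr (by simp))) (e2 _ (Or.inl rfl))
        fun y hy => e3 y hy _ (Or.inl rfl)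
  | @ansRecall c a q y D h1 h2 h3 =>
    have e1 := G.defines_eqVars (σ := G.ansRecall a q) (e := (.univ, [.inl a, .inr .aux]))
      (by simp [RecallAutomaton.ansRecall]) .aux (by
        rintro u (rfl | hu) huv
        · exact G.defines_univ _
        · simp at hu
          exact (huv hu).elim)
    have e2 := G.defines_eqVars (σ := G.ansRecall a q) (e := (.old .eps, []))
      (by simp [RecallAutomaton.ansRecall]) (.old .eps) (by
        rintro u (rfl | hu) huv
        · exact (huv rfl).elim
        · simp at hu)
    refine G.uniquelyDefined_of_defines ?_ ?_ hx
    · intro e he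
      simp only [RecallAutomaton.ansRecall, List.mem_cons, List.not_mem_nil, or_false] at he
      obtain rfl | rfl := he
      · exact e1
      · exact e2
    · rintro q f ⟨⟩ k -
      have e3 := e2 _ (Or.inl rfl)
      cases k
      · exact G.defines_univ _
      · exact e3
      · exact G.defines_flagVar _ (G.defines_univ _) e3
      · exact e3
      · exact e3
      · exact e3
  | @charRule p c a q D h1 h2 h3 =>
    have e0 : ∀ k ∈ G.keys, G.Defines (G.charRule p a q D) (.old k) := fun k hk =>
      G.defines_arg (σ := G.charRule p a q D) rfl hk
    have e1 := G.defines_eqVars (σ := G.charRule p a q D)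
      (e := (.old .rest, [.inr (.old .pend), .inl a, .inr (.new .rest)]))
      (by simp [RecallAutomaton.charRule]) (.new .rest) (by
        rintro u (rfl | hu) huv
        · exact e0 _ G.rest_mem_keys
        · simp at hu
          rcases hu with rfl | rfl
          · exact e0 _ G.pend_mem_keys
          · exact (huv rfl).elim)
    have e3 : ∀ y ∈ G.mems, ∀ u ∈ eqVars (Var.new (.mem y), G.source p D y ++ G.saved q a y),
        G.Defines (G.charRule p a q D) u := by
      intro y hy
      refine G.defines_eqVars (by simpa [RecallAutomaton.charRule] using hy) (.new (.mem y)) ?_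
      rintro u (rfl | hu) huv
      · exact (huv rfl).elim
      · rcases List.mem_append.1 hu with hu | hu
        · rcases G.eqVars_source hu with rfl | rfl
          · exact e0 _ (G.mem_mem_keys.2 hy)
          · exact e0 _ G.pend_mem_keys
        · exact (G.not_mem_saved hu).elim
    refine G.uniquelyDefined_of_defines ?_ ?_ hx
    · intro e he
      simp only [RecallAutomaton.charRule, List.mem_append, List.mem_cons, List.mem_map,
        List.not_mem_nil, or_false, Finset.mem_toList] at he
      obtain (rfl | rfl) | ⟨y, hy, rfl⟩ := he
      · exact e1
      · rintro u (rfl | hu)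
        · exact e0 _ G.eps_mem_keys
        · cases hu
      · exact e3 y hy
    · rintro q f ⟨⟩
      exact G.defines_charCall (e1 _ (Or.inr (by simp))) (e0 _ G.eps_mem_keys)
        fun y hy => e3 y hy _ (Or.inl rfl)
  | @recallRule p c a q z D h1 h2 h3 =>
    have e0 : ∀ k ∈ G.keys, G.Defines (G.recallRule p a q z D) (.old k) := fun k hk =>
      G.defines_arg (σ := G.recallRule p a q z D) rfl hk
    have e1 := G.defines_eqVars (σ := G.recallRule p a q z D)
      (e := (.old .rest, [.inr (.old .pend), .inr (.new .rest)]))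
      (by simp [RecallAutomaton.recallRule]) (.new .rest) (by
        rintro u (rfl | hu) huv
        · exact e0 _ G.rest_mem_keys
        · simp at hu
          rcases hu with rfl | rfl
          · exact e0 _ G.pend_mem_keys
          · exact (huv rfl).elim)
    have e2 := G.defines_eqVars (σ := G.recallRule p a q z D)
      (e := (.old .pend, [.inl a, .inr .aux]))
      (by simp [RecallAutomaton.recallRule]) .aux (by
        rintro u (rfl | hu) huv
        · exact e0 _ G.pend_mem_keys
        · simp at hu
          exact (huv hu).elim)
    have e3 : ∀ y ∈ G.mems, ∀ u ∈ eqVars (Var.new (.mem y), G.source p D y),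
        G.Defines (G.recallRule p a q z D) u := by
      intro y hy
      refine G.defines_eqVars (by simpa [RecallAutomaton.recallRule] using hy) (.new (.mem y)) ?_
      rintro u (rfl | hu) huv
      · exact (huv rfl).elim
      · rcases G.eqVars_source hu with rfl | rfl
        · exact e0 _ (G.mem_mem_keys.2 hy)
        · exact e0 _ G.pend_mem_keys
    refine G.uniquelyDefined_of_defines ?_ ?_ hx
    · intro e he
      simp only [RecallAutomaton.recallRule, List.mem_append, List.mem_cons, List.mem_map,
        List.not_mem_nil, or_false, Finset.mem_toList] at he
      obtain (rfl | rfl | rfl) | ⟨y, hy, rfl⟩ := he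
      · exact e1
      · exact e2
      · rintro u (rfl | hu)
        · exact e0 _ G.eps_mem_keys
        · cases hu
      · exact e3 y hy
    · rintro q' f hf k hk
      cases hf
      rcases k with _ | _ | _ | _ | r | x
      · exact e1 (.new .rest) (Or.inr (by simp))
      · exact e3 z (G.lab_mem h3) _ (Or.inl rfl)
      · exact G.defines_flagVar _ (G.defines_univ _) (e0 _ G.eps_mem_keys)
      · exact e0 _ G.eps_mem_keys
      · exact e0 _ G.eps_mem_keys
      · exact e3 x (G.mem_mem_keys.1 hk) _ (Or.inl rfl)
  | @passRule p q y D h2 h3 =>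
    have e0 : ∀ k ∈ G.keys, k ≠ .pend → k ≠ .seen p →
        G.Defines (G.passRule p q y D) (.old k) := by
      intro k hk h4 h5
      have := G.defines_arg (σ := G.passRule p q y D) rfl hk
      simpa [RecallAutomaton.passRule, passArg, h4, h5] using this
    have e1 := e0 _ G.eps_mem_keys (by simp) (by simp)
    have e2 : ∀ x ∈ G.mems, G.Defines (G.passRule p q y D) (memVar D x) := by
      intro x hx
      unfold memVar
      split_ifs
      · exact e1
      · exact e0 _ (G.mem_mem_keys.2 hx) (by simp) (by simp)
    refine G.uniquelyDefined_of_defines (fun e he => by cases he) ?_ hx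
    intro q' f hf k hk
    cases hf
    rcases k with _ | _ | _ | _ | r | x
    · exact e0 _ G.rest_mem_keys (by simp) (by simp)
    · exact e2 y (G.lab_mem h3)
    · exact G.defines_flagVar _ (e0 _ G.flag_mem_keys (by simp) (by simp)) e1
    · exact e1
    · simp only [passCall]
      split_ifs with hr
      · exact G.defines_univ _
      · exact e0 _ (G.seen_mem_keys r) (by simp) (by simpa using hr)
    · exact e2 x (G.mem_mem_keys.1 hk)
  | @acceptRule p h2 =>
    have e0 : ∀ k ∈ G.keys, G.Defines (G.acceptRule p) (.old k) := fun k hk =>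
      G.defines_arg (σ := G.acceptRule p) rfl hk
    refine G.uniquelyDefined_of_defines ?_ (by rintro q f ⟨⟩) hx
    intro e he
    have key : ∀ v ∈ eqVars e, ∃ k ∈ G.keys, v = .old k := by
      simp only [RecallAutomaton.acceptRule] at he
      rintro v hv
      split_ifs at he <;> simp only [List.mem_cons, List.not_mem_nil, or_false] at he
      · obtain rfl | rfl := he <;> simp only [eqVars, List.mem_cons, List.not_mem_nil, or_false,
          Set.mem_ofPred_eq, Sum.inr.injEq] at hv
        · exact ⟨_, G.seen_mem_keys p, hv⟩
        · exact hv.elim (fun h => ⟨_, G.rest_mem_keys, h⟩) fun h => ⟨_, G.pend_mem_keys, h⟩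
      · obtain rfl | rfl | rfl | rfl := he <;> simp only [eqVars, List.not_mem_nil, or_false,
          Set.mem_ofPred_eq] at hv
        · exact ⟨_, G.seen_mem_keys p, hv⟩
        · exact ⟨_, G.rest_mem_keys, hv⟩
        · exact ⟨_, G.pend_mem_keys, hv⟩
        · exact ⟨_, G.flag_mem_keys, hv⟩
    intro v hv
    obtain ⟨k, hk, rfl⟩ := key v hv
    exact e0 k hk
  | @flagRule p c a h1 =>
    have e0 : ∀ k ∈ G.keys, G.Defines (RecallAutomaton.flagRule p.1 a) (.old k) := fun k hk =>
      G.defines_arg (σ := RecallAutomaton.flagRule p.1 a) rfl hk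
    have e1 := G.defines_eqVars (σ := RecallAutomaton.flagRule p.1 a)
      (e := (.aux', [.inr (.old .pend), .inr (.old (.seen p.1))]))
      (by simp [RecallAutomaton.flagRule]) .aux' (by
        rintro u (rfl | hu) huv
        · exact (huv rfl).elim
        · simp at hu
          rcases hu with rfl | rfl
          · exact e0 _ G.pend_mem_keys
          · exact e0 _ (G.seen_mem_keys p.1))
    have e2 := G.defines_eqVars (σ := RecallAutomaton.flagRule p.1 a)
      (e := (.aux', [.inl a, .inr .aux])) (by simp [RecallAutomaton.flagRule]) .aux (by
        rintro u (rfl | hu) huv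
        · exact e1 _ (Or.inl rfl)
        · simp at hu
          exact (huv hu).elim)
    refine G.uniquelyDefined_of_defines ?_ (by rintro q f ⟨⟩) hx
    intro e he
    simp only [RecallAutomaton.flagRule, List.mem_cons, List.not_mem_nil, or_false] at he
    obtain rfl | rfl | rfl | rfl | rfl := he
    · rintro u (rfl | hu)
      · exact e0 _ G.rest_mem_keys
      · cases hu
    · rintro u (rfl | hu)
      · exact e0 _ G.flag_mem_keys
      · cases hu
    · rintro u (rfl | hu)
      · exact e0 _ G.eps_mem_keys
      · cases hu
    · exact e1
    · exact e2

theorem isDollaPlus_toProgram : G.toProgram.IsDollaPlus := by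
  refine ⟨G.isLinear_toProgram, G.isGloballyDeterministic_toProgram, ?_⟩
  intro ρ hρ x hx
  obtain ⟨i, σ, hσ, rfl⟩ := G.mem_rules.1 hρ
  exact hσ.uniquelyDefined hx

/-! ### Strict decrease -/

/-- Only `charRule` and `recallRule` remain: rules of the output symbol are not recursive,
`passRule` has no equation, and the other rules have no call. The two that remain remove a terminal
or a nonempty pending word from the unread input. -/
theorem exists_of_mem_recRules {ρ : Rule A (Option (Option P))} (h : ρ ∈ G.toProgram.recRules) :
    ∃ σ p q f α, G.toRule σ = ρ ∧ σ.head = some (some p) ∧ σ.arg = .old ∧ σ.call = some (q, f) ∧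
      G.toProgram.MutRec σ.head (some (some q)) ∧ f .rest = .new .rest ∧
      (.old .rest, α) ∈ σ.eqs ∧ Sum.inr (.new .rest) ∈ α ∧
      ∀ η : Var P → List A, Solves η σ → (η (.new .rest)).length < (η (.old .rest)).length := by
  obtain ⟨hρ, ⟨φ, hφ, hrec⟩, x, β, hβ⟩ := h
  obtain ⟨i, σ, hσ, rfl⟩ := G.mem_rules.1 hρ
  rcases φ with ⟨y, γ⟩ | ⟨R, ys⟩
  · exact hrec.elim
  change G.toProgram.MutRec σ.head R at hrec
  obtain ⟨⟨p, hp⟩, r, rfl⟩ := G.exists_of_mutRec hrec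
  obtain ⟨-, -, h, -⟩ | ⟨q, f, hf, hq, -⟩ := G.mem_body_rel hφ
  · cases h
  cases hq
  cases hσ with
  | ansNil => cases hp
  | anyTuple => cases hp
  | ansChar => cases hp
  | ansRecall => cases hp
  | charRule h1 h2 h3 =>
    cases hf
    refine ⟨_, _, _, _, _, rfl, rfl, rfl, rfl, hrec, rfl,
      List.mem_append_left _ List.mem_cons_self, by simp, fun η hη => ?_⟩
    have := hη (.old .rest, _) (List.mem_append_left _ List.mem_cons_self)
    simp only [patSubst, List.flatMap_cons, Sum.elim_inr, Sum.elim_inl, List.flatMap_nil] at this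
    rw [this]
    simp
    omega
  | recallRule h1 h2 h3 =>
    cases hf
    refine ⟨_, _, _, _, _, rfl, rfl, rfl, rfl, hrec, rfl,
      List.mem_append_left _ List.mem_cons_self, by simp, fun η hη => ?_⟩
    have e1 := hη (.old .rest, _) (List.mem_append_left _ List.mem_cons_self)
    have e2 := hη (.old .pend, _) (List.mem_append_left _
      (List.mem_cons_of_mem _ List.mem_cons_self))
    simp only [patSubst, List.flatMap_cons, Sum.elim_inr, Sum.elim_inl, List.flatMap_nil] at e1 e2
    rw [e1, e2]
    simp
  | passRule =>
    obtain ⟨e, he, -⟩ := G.mem_body_eq.1 hβ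
    cases he
  | acceptRule => cases hf
  | flagRule => cases hf

theorem isStrictlyDecreasing_toProgram : G.toProgram.IsStrictlyDecreasing := by
  -- The unread input before and after the rule. It occupies the same component in every tuple, so
  -- the new value of the caller is the old value of the called rule.
  refine ⟨fun _ => idx (.old .rest : Var P), fun _ => idx (.new .rest : Var P), fun ρ hρ => ?_⟩
  obtain ⟨σ, p, q, f, α, rfl, hp, harg, hf, hrec, hrest, he, hα, hlt⟩ := G.exists_of_mem_recRules hρ
  refine ⟨⟨?_, ?_, ⟨_, _, G.mem_body_eq.2 ⟨_, he, rfl, rfl⟩, Or.inl rfl,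
    Or.inr (inr_idx_mem.2 hα)⟩, fun w θ hθ => ?_⟩, ?_⟩
  · refine List.mem_append_left _ ?_
    rw [G.args_eq hp, harg]
    exact List.mem_map.2 ⟨_, G.rest_mem_keys, rfl⟩
  · rw [G.bottom_toRule hf hrec]
    exact List.mem_map.2 ⟨_, G.rest_mem_keys, congrArg idx hrest⟩
  · exact hlt _ (G.solves_of_satEqs hθ.1).2
  · intro R ys hys hR χ hχ hχR w θ θ' hθ hθ' heq
    obtain ⟨τ, p', -, -, -, rfl, hp', harg', -⟩ := G.exists_of_mem_recRules hχ
    obtain ⟨r, hr⟩ := (G.exists_of_mutRec hR).2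
    obtain ⟨-, -, h, -⟩ | ⟨q', f', hf', -, rfl⟩ := G.mem_body_rel hys
    · cases h.symm.trans hr
    · cases hf.symm.trans hf'
      rw [G.args_eq hp', harg', List.map_map, List.map_map, List.map_inj_left] at heq
      have := heq _ G.rest_mem_keys
      simp only [Function.comp, hrest] at this
      exact this.symm

theorem isSDDollaPlus_toProgram : G.toProgram.IsSDDollaPlus :=
  ⟨G.isDollaPlus_toProgram, G.isStrictlyDecreasing_toProgram⟩

end RecallAutomaton

end DetRegex

/-! ### The program accepts the language of the automaton -/

namespace DetRegex

open FCDatalog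

namespace RecallAutomaton

variable {A : Type*} {P : Type}

theorem save_nil (O : Set ℕ) (m : ℕ → List A) : save O [] m = m := by
  ext1 x
  simp [save]

theorem Accepts.char {G : RecallAutomaton A P} {p : Option P} {q : P} {D : Set ℕ} {a : A}
    {z : List A} {m : ℕ → List A} (h : G.step p q D) (hq : G.lab q = Sum.inl a)
    (hz : G.Accepts (some q) z (save (G.opened (some q)) [a] (erase D m))) :
    G.Accepts p (a :: z) m := by
  have := Accepts.step (z := z) (m := m) h
  rw [hq] at this
  exact this hz

theorem Accepts.recall {G : RecallAutomaton A P} {p : Option P} {q : P} {D : Set ℕ} {y : ℕ}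
    {z : List A} {m : ℕ → List A} (h : G.step p q D) (hq : G.lab q = Sum.inr y)
    (hz : G.Accepts (some q) z (save (G.opened (some q)) (erase D m y) (erase D m))) :
    G.Accepts p (erase D m y ++ z) m := by
  have := Accepts.step (z := z) (m := m) h
  rw [hq] at this
  exact this hz

variable (G : RecallAutomaton A P)

/-- The contents of the memories in a configuration at `p`. -/
noncomputable def memory (p : P) (val : Key P → List A) : ℕ → List A :=
  save (G.opened (some p)) (val .pend) fun x => val (.mem x)

/-- The configuration after something has been read. -/
def nextVal (r g f : List A) (m : ℕ → List A) : Key P → List A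
  | .rest => r
  | .pend => g
  | .flag => f
  | .eps => []
  | .seen _ => []
  | .mem x => m x

theorem patSubst_append {V : Type*} (η : V → List A) (α β : List (A ⊕ V)) :
    patSubst η (α ++ β) = patSubst η α ++ patSubst η β :=
  List.flatMap_append

/-- The stored contents lag behind the run by the pending word; `source` appends it to the open
memories and then erases `D`. -/
theorem patSubst_source {η : Var P → List A} {p : P} {D : Set ℕ} {x : ℕ} {val : Key P → List A}
    (h1 : η (.old .pend) = val .pend) (h2 : η (.old (.mem x)) = val (.mem x)) :
    patSubst η (G.source p D x) = erase D (G.memory p val) x := by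
  unfold source erase memory save
  split_ifs <;> simp [patSubst, h1, h2]

theorem patSubst_source_saved {η : Var P → List A} {p q : P} {D : Set ℕ} {x : ℕ} {a : A}
    {val : Key P → List A} (h1 : η (.old .pend) = val .pend)
    (h2 : η (.old (.mem x)) = val (.mem x)) :
    patSubst η (G.source p D x ++ G.saved q a x) =
      save (G.opened (some q)) [a] (erase D (G.memory p val)) x := by
  rw [patSubst_append, G.patSubst_source h1 h2]
  unfold saved
  unfold save
  split_ifs <;> simp [patSubst]

theorem erase_nil (D : Set ℕ) : erase D (fun _ => ([] : List A)) = fun _ => [] := by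
  ext1 x
  simp [erase]

theorem patSubst_saved {η : Var P → List A} {q : P} {D : Set ℕ} {x : ℕ} {a : A} :
    patSubst η (G.saved q a x) =
      save (G.opened (some q)) [a] (erase D fun _ => []) x := by
  unfold saved
  rw [erase_nil]
  unfold save
  split_ifs <;> simp [patSubst]

theorem _root_.FCDatalog.Program.Derives.induct {Q : Program A} {w : List A}
    {C : Q.Rel → List (List A) → Prop}
    (hC : ∀ ρ θ, ρ ∈ Q.rules → Q.SatEqs w ρ θ →
      (∀ R ys, Atom.rel R ys ∈ ρ.body → C R (ys.map θ)) → C ρ.head (ρ.args.map θ))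
    {R : Q.Rel} {t : List (List A)} (h : Q.Derives w R t) : C R t := by
  induction h with
  | intro ρ θ hρ hθ _ ih => exact hC ρ θ hρ hθ ih

variable [Finite P]

/-! ### Soundness -/

/-- What the derivation of a tuple for `p` means. -/
def Correct (p : P) (val : Key P → List A) : Prop :=
  (∃ z, val .rest = val .pend ++ z ∧ G.Accepts (some p) z (G.memory p val)) ∨
    val .flag = [] ∧ val .rest = []

/-- Each rule is a step of the automaton read backwards. If the called tuple is justified by its
flag, then either the flag was set here, so `p` is accepting and the run stops, or `passRule`
inherited it. The nonempty value `w` excludes all other sources. -/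
theorem correct_state {i : G.RuleIndex} {σ : Schema A P} (hσ : G.IsRule i σ) {p : P}
    (hp : σ.head = some (some p)) {w : List A} (hw : w ≠ []) {η : Var P → List A}
    (hu : η .univ = w) (hη : Solves η σ)
    (hcall : ∀ q f, σ.call = some (q, f) → ∀ val : Key P → List A,
      (∀ k ∈ G.keys, η (f k) = val k) → val .eps = [] → G.Correct q val)
    {val : Key P → List A} (hval : ∀ k ∈ G.keys, η (σ.arg k) = val k) (he : val .eps = []) :
    G.Correct p val := by
  have v1 := hval _ G.rest_mem_keys
  have v2 := hval _ G.pend_mem_keys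
  have v3 := hval _ G.flag_mem_keys
  have v4 := hval _ G.eps_mem_keys
  have v5 := fun x hx => hval _ (G.mem_mem_keys (x := x).2 hx)
  cases hσ with
  | ansNil => cases hp
  | anyTuple => cases hp
  | ansChar => cases hp
  | ansRecall => cases hp
  | @charRule p c a q D h1 h2 h3 =>
    cases hp
    change η (.old _) = _ at v1 v2 v3 v4
    have e1 := hη (.old .rest, _) (List.mem_append_left _ List.mem_cons_self)
    have e3 : ∀ x ∈ G.mems, η (.new (.mem x)) =
        save (G.opened (some q)) [a] (erase D (G.memory p val)) x := by
      intro x hx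
      rw [← G.patSubst_source_saved v2 (v5 x hx)]
      exact hη (.new (.mem x), _) (List.mem_append_right _
        (List.mem_map.2 ⟨x, Finset.mem_toList.2 hx, rfl⟩))
    have e4 : η (.old .rest) = η (.old .pend) ++ a :: η (.new .rest) := by
      simpa [patSubst] using e1
    rcases hcall q _ rfl (nextVal (η (.new .rest)) [] w
        (save (G.opened (some q)) [a] (erase D (G.memory p val)))) (by
          rintro (_ | _ | _ | _ | r | x) hk
          exacts [rfl, v4.trans he, hu, v4.trans he, v4.trans he, e3 x (G.mem_mem_keys.1 hk)]) rfl
      with ⟨z, hz, hacc⟩ | h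
    · left
      refine ⟨a :: z, ?_, Accepts.char h2 h3 ?_⟩
      · rw [← v1, ← v2, e4]
        exact congrArg (fun t => _ ++ a :: t) hz
      · unfold memory at hacc
        change G.Accepts (some q) z (save _ [] _) at hacc
        rwa [save_nil] at hacc
    -- After a terminal the flag is `w`, so the call cannot be justified by the flag.
    · exact (hw h.1).elim
  | @recallRule p c a q y D h1 h2 h3 =>
    cases hp
    change η (.old _) = _ at v1 v2 v3 v4
    have e1 := hη (.old .rest, _) (List.mem_append_left _ List.mem_cons_self)
    have e3 : ∀ x ∈ G.mems, η (.new (.mem x)) = erase D (G.memory p val) x := by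
      intro x hx
      rw [← G.patSubst_source v2 (v5 x hx)]
      exact hη (.new (.mem x), _) (List.mem_append_right _
        (List.mem_map.2 ⟨x, Finset.mem_toList.2 hx, rfl⟩))
    have e4 : η (.old .rest) = η (.old .pend) ++ η (.new .rest) := by
      simpa [patSubst] using e1
    rcases hcall q _ rfl (nextVal (η (.new .rest)) (erase D (G.memory p val) y)
        (η (G.flagVar (some p) .univ)) (erase D (G.memory p val))) (by
          rintro (_ | _ | _ | _ | r | x) hk
          exacts [rfl, e3 y (G.lab_mem h3), rfl, v4.trans he, v4.trans he,
            e3 x (G.mem_mem_keys.1 hk)]) rfl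
      with ⟨z, hz, hacc⟩ | h
    · left
      refine ⟨erase D (G.memory p val) y ++ z, ?_, Accepts.recall h2 h3 hacc⟩
      rw [← v1, ← v2, e4]
      exact congrArg (fun t => _ ++ t) hz
    · have h4 : η (G.flagVar (some p) .univ) = [] := h.1
      have h5 : η (.new .rest) = [] := h.2
      unfold flagVar at h4
      split_ifs at h4 with hacc
      · left
        exact ⟨[], by rw [← v1, ← v2, e4, h5], .done hacc⟩
      · exact (hw (hu.symm.trans h4)).elim
  | @passRule p q y D h2 h3 =>
    cases hp
    have v1 : η (.old .rest) = val .rest := by simpa [RecallAutomaton.passRule, passArg] using v1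
    have v2 : η (.old .eps) = val .pend := by simpa [RecallAutomaton.passRule, passArg] using v2
    have v3 : η (.old .flag) = val .flag := by simpa [RecallAutomaton.passRule, passArg] using v3
    have v4 : η (.old .eps) = val .eps := by simpa [RecallAutomaton.passRule, passArg] using v4
    have v5 : ∀ x ∈ G.mems, η (.old (.mem x)) = val (.mem x) := by
      simpa [RecallAutomaton.passRule, passArg] using v5
    have hg : val .pend = [] := v2.symm.trans (v4.trans he)
    have hm : G.memory p val = fun x => val (.mem x) := by rw [memory, hg, save_nil]
    have e3 : ∀ x ∈ G.mems, η (memVar D x) = erase D (G.memory p val) x := by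
      intro x hx
      rw [hm]
      unfold memVar erase
      split_ifs
      · exact v4.trans he
      · exact v5 x hx
    -- Only components in `G.keys` are prescribed by the tuple. For memories outside `G.mems` the
    -- values are chosen to agree with the run.
    rcases hcall q _ rfl (fun k => match k with
        | .pend => erase D (G.memory p val) y
        | .eps => []
        | .mem x => erase D (G.memory p val) x
        | k => η (G.passCall p y D k)) (by
          rintro (_ | _ | _ | _ | r | x) hk
          exacts [rfl, e3 y (G.lab_mem h3), rfl, v4.trans he, rfl, e3 x (G.mem_mem_keys.1 hk)]) rfl
      with ⟨z, hz, hacc⟩ | ⟨h4, h5⟩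
    · left
      refine ⟨erase D (G.memory p val) y ++ z, ?_, Accepts.recall h2 h3 hacc⟩
      rw [hg, List.nil_append, ← v1]
      exact hz
    · have h5 : η (.old .rest) = [] := h5
      change η (G.flagVar (some p) (.old .flag)) = [] at h4
      unfold flagVar at h4
      split_ifs at h4 with hacc
      · left
        exact ⟨[], by rw [← v1, hg, h5]; rfl, .done hacc⟩
      · right
        exact ⟨v3.symm.trans h4, v1.symm.trans h5⟩
  | @acceptRule p h2 =>
    cases hp
    change η (.old _) = _ at v1 v2 v3 v4
    by_cases hacc : G.acc (some p)
    · left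
      refine ⟨[], ?_, .done hacc⟩
      rw [← v1, ← v2]
      simpa [patSubst] using hη (.old .rest, [.inr (.old .pend)])
        (by simp [RecallAutomaton.acceptRule, hacc])
    · right
      rw [← v1, ← v3]
      exact ⟨hη (.old .flag, []) (by simp [RecallAutomaton.acceptRule, hacc]),
        hη (.old .rest, []) (by simp [RecallAutomaton.acceptRule, hacc])⟩
  | flagRule h1 =>
    cases hp
    change η (.old _) = _ at v1 v2 v3 v4
    right
    rw [← v1, ← v3]
    exact ⟨hη (.old .flag, []) (by simp [RecallAutomaton.flagRule]),
      hη (.old .rest, []) (by simp [RecallAutomaton.flagRule])⟩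

/-- At the start all memories are empty, so an initial recall reads nothing; since `w` is nonempty,
the flag alone cannot justify the call. -/
theorem accepts_start {i : G.RuleIndex} {σ : Schema A P} (hσ : G.IsRule i σ)
    (hp : σ.head = none) {w : List A} {η : Var P → List A}
    (hu : η .univ = w) (hη : Solves η σ)
    (hcall : w ≠ [] → ∀ q f, σ.call = some (q, f) → ∀ val : Key P → List A,
      (∀ k ∈ G.keys, η (f k) = val k) → val .eps = [] → G.Correct q val) :
    G.Accepts none w fun _ => [] := by
  cases hσ with
  | ansNil h =>
    have : η .univ = [] := by simpa [patSubst] using hη (.univ, []) List.mem_cons_self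
    rw [← hu, this]
    exact h
  | @ansChar c a q D h1 h2 h3 =>
    have e1 : w = a :: η (.new .rest) := by
      simpa [patSubst, hu] using hη (.univ, _) (List.mem_append_left _ List.mem_cons_self)
    have e2 : η (.old .eps) = [] := by
      simpa [patSubst] using hη (.old .eps, []) (List.mem_append_left _
        (List.mem_cons_of_mem _ List.mem_cons_self))
    have e3 : ∀ x ∈ G.mems, η (.new (.mem x)) =
        save (G.opened (some q)) [a] (erase D fun _ => []) x := by
      intro x hx
      rw [← G.patSubst_saved (η := η)]
      exact hη (.new (.mem x), _) (List.mem_append_right _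
        (List.mem_map.2 ⟨x, Finset.mem_toList.2 hx, rfl⟩))
    have hw : w ≠ [] := by rw [e1]; simp
    rcases hcall hw q _ rfl (nextVal (η (.new .rest)) [] w
        (save (G.opened (some q)) [a] (erase D fun _ => []))) (by
          rintro (_ | _ | _ | _ | r | x) hk
          exacts [rfl, e2, hu, e2, e2, e3 x (G.mem_mem_keys.1 hk)]) rfl
      with ⟨z, hz, hacc⟩ | h
    · have hz : η (.new .rest) = z := hz
      rw [e1, hz]
      refine Accepts.char h2 h3 ?_
      unfold memory at hacc
      change G.Accepts (some q) z (save _ [] _) at hacc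
      rwa [save_nil] at hacc
    · exact (hw h.1).elim
  | @ansRecall c a q y D h1 h2 h3 =>
    have e1 : w = a :: η .aux := by
      simpa [patSubst, hu] using hη (.univ, _) List.mem_cons_self
    have e2 : η (.old .eps) = [] := by
      simpa [patSubst] using hη (.old .eps, []) (List.mem_cons_of_mem _ List.mem_cons_self)
    have hw : w ≠ [] := by rw [e1]; simp
    rcases hcall hw q _ rfl (nextVal w [] (η (G.flagVar none .univ)) fun _ => []) (by
          rintro (_ | _ | _ | _ | r | x) hk
          exacts [hu, e2, rfl, e2, e2, e2]) rfl
      with ⟨z, hz, hacc⟩ | h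
    · have hz : w = z := hz
      have := Accepts.recall (m := fun _ => []) (z := w) h2 h3
      rw [erase_nil] at this
      refine this ?_
      rw [hz]
      exact hacc
    · exact (hw h.2).elim
  | anyTuple => cases hp
  | charRule => cases hp
  | recallRule => cases hp
  | passRule => cases hp
  | acceptRule => cases hp
  | flagRule => cases hp

/-- The induction runs over both kinds of symbols at once; nothing is claimed about the relation of
all tuples. -/
theorem correct_of_derives {w : List A} {R : Option (Option P)} {t : List (List A)}
    (h : G.toProgram.Derives w R t) :
    (R = none → G.Accepts none w fun _ => []) ∧
      (w ≠ [] → ∀ p, R = some (some p) → ∀ val : Key P → List A, t = G.keys.map val →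
        val .eps = [] → G.Correct p val) := by
  refine h.induct (C := fun R t => (R = none → G.Accepts none w fun _ => []) ∧
      (w ≠ [] → ∀ p, R = some (some p) → ∀ val : Key P → List A, t = G.keys.map val →
        val .eps = [] → G.Correct p val)) ?_
  · intro ρ θ hρ hθ ih
    obtain ⟨i, σ, hσ, rfl⟩ := G.mem_rules.1 hρ
    obtain ⟨hu, hs⟩ := G.solves_of_satEqs hθ
    have hcall : w ≠ [] → ∀ q f, σ.call = some (q, f) → ∀ val : Key P → List A,
        (∀ k ∈ G.keys, θ (idx (f k)) = val k) → val .eps = [] → G.Correct q val := by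
      intro hw q f hf val hv he
      refine (ih _ _ (G.call_mem_body hf)).2 hw q rfl val ?_ he
      rw [List.map_map, List.map_inj_left]
      exact hv
    refine ⟨fun hR => G.accepts_start hσ hR hu hs hcall, fun hw p hp val ht he => ?_⟩
    refine G.correct_state hσ hp hw hu hs (hcall hw) ?_ he
    rw [G.args_eq hp, List.map_map, List.map_inj_left] at ht
    exact ht

end RecallAutomaton

end DetRegex

namespace DetRegex

open FCDatalog

namespace RecallAutomaton

variable {A : Type*} {P : Type}

/-! ### Completeness -/

/-- The values of the variables. -/
def assign (w : List A) (val val' : Key P → List A) (s s' : List A) : Var P → List A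
  | .univ => w
  | .old k => val k
  | .new k => val' k
  | .aux => s
  | .aux' => s'

theorem assign_infix {w : List A} {val val' : Key P → List A} {s s' : List A}
    (h : ∀ k, val k <:+: w) (h' : ∀ k, val' k <:+: w) (hs : s <:+: w) (hs' : s' <:+: w)
    (v : Var P) : assign w val val' s s' v <:+: w := by
  cases v
  · exact List.infix_rfl
  · exact h _
  · exact h' _
  · exact hs
  · exact hs'

theorem nextVal_infix {w r g f : List A} {m : ℕ → List A} (hr : r <:+: w) (hg : g <:+: w)
    (hf : f <:+: w) (hm : ∀ x, m x <:+: w) (k : Key P) : nextVal r g f m k <:+: w := by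
  cases k
  · exact hr
  · exact hg
  · exact hf
  · exact List.nil_infix
  · exact List.nil_infix
  · exact hm _

section Derive

variable [Finite P] (G : RecallAutomaton A P)

/-- A valuation `η` of the symbolic variables becomes a substitution; numbers that are not codes of
variables receive ε, which is always a factor. -/
theorem derives_rule {i : G.RuleIndex} {σ : Schema A P} (hσ : G.IsRule i σ) {w : List A}
    {η : Var P → List A} (hu : η .univ = w) (hw : ∀ v, η v <:+: w) (hη : Solves η σ)
    (hany : ∀ p, σ.head = some (some p) →
      G.toProgram.Derives w (some none) (G.keys.map fun k => η (σ.arg k)))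
    (hcall : ∀ q f, σ.call = some (q, f) →
      G.toProgram.Derives w (some (some q)) (G.keys.map fun k => η (f k))) :
    G.toProgram.Derives w σ.head ((G.toRule σ).args.map (Function.extend idx η fun _ => [])) := by
  have hext : ∀ v, Function.extend idx η (fun _ => []) (idx v) = η v :=
    fun v => idx_injective.extend_apply η _ v
  have hmap : ∀ f : Key P → Var P, (G.keys.map (idx ∘ f)).map
      (Function.extend idx η fun _ => []) = G.keys.map fun k => η (f k) := by
    intro f
    rw [List.map_map]
    exact List.map_congr_left fun k _ => hext _
  refine Program.Derives.intro (P := G.toProgram) (G.toRule σ) _ (G.mem_rules.2 ⟨i, σ, hσ, rfl⟩)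
    ⟨⟨(hext _).trans hu, ?_⟩, ?_⟩ ?_
  · rintro x -
    by_cases hx : ∃ v : Var P, idx v = x
    · obtain ⟨v, rfl⟩ := hx
      rw [hext]
      exact hw v
    · rw [Function.extend_apply' _ _ _ hx]
      exact List.nil_infix
  · intro x α h
    obtain ⟨e, he, rfl, rfl⟩ := G.mem_body_eq.1 h
    rw [subst_map, hext]
    simp only [hext]
    exact hη e he
  · intro R ys h
    obtain ⟨p, hp, rfl, rfl⟩ | ⟨q, f, hf, rfl, rfl⟩ := G.mem_body_rel h
    · rw [hmap]
      exact hany p hp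
    · rw [hmap]
      exact hcall q f hf

theorem derives_any (p : P) {w : List A} {val : Key P → List A} (hval : ∀ k, val k <:+: w) :
    G.toProgram.Derives w (some none) (G.keys.map val) := by
  have := G.derives_rule (.anyTuple p) (η := assign w val val [] []) rfl
    (assign_infix hval hval List.nil_infix List.nil_infix) (by
      intro e he
      obtain ⟨k, -, rfl⟩ := List.mem_map.1 he
      simp [patSubst, assign]) (by rintro p ⟨⟩) (by rintro q f ⟨⟩)
  rw [G.args_eq rfl, List.map_map] at this
  refine Eq.mp (congrArg _ (List.map_congr_left fun k _ => ?_)) this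
  exact idx_injective.extend_apply _ _ (Var.old k : Var P)

theorem derives_state {i : G.RuleIndex} {σ : Schema A P} (hσ : G.IsRule i σ) {p : P}
    (hp : σ.head = some (some p)) {w : List A} {val : Key P → List A} (hval : ∀ k, val k <:+: w)
    {η : Var P → List A} (hu : η .univ = w) (hw : ∀ v, η v <:+: w) (hη : Solves η σ)
    (harg : ∀ k ∈ G.keys, η (σ.arg k) = val k)
    (hcall : ∀ q f, σ.call = some (q, f) →
      G.toProgram.Derives w (some (some q)) (G.keys.map fun k => η (f k))) :
    G.toProgram.Derives w (some (some p)) (G.keys.map val) := by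
  have e : (G.keys.map fun k => η (σ.arg k)) = G.keys.map val := List.map_congr_left harg
  have := G.derives_rule hσ hu hw hη (fun p' _ => e ▸ G.derives_any p hval) hcall
  rw [G.args_eq hp, hp, List.map_map] at this
  convert this using 1
  exact List.map_congr_left fun k hk =>
    (harg k hk).symm.trans (idx_injective.extend_apply _ _ (σ.arg k)).symm

theorem derives_char {p q : P} {c : G.CharPos} {a : A} {D : Set ℕ} (hc : G.lab c.1 = Sum.inl a)
    (h : G.step (some p) q D) (hq : G.lab q = Sum.inl a) {w z : List A} {val : Key P → List A}
    (hval : ∀ k, val k <:+: w) (he : val .eps = []) (hz : val .rest = val .pend ++ a :: z)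
    (hval' : ∀ k : Key P, nextVal z [] w
      (save (G.opened (some q)) [a] (erase D (G.memory p val))) k <:+: w)
    (hd : G.toProgram.Derives w (some (some q)) (G.keys.map
      (nextVal z [] w (save (G.opened (some q)) [a] (erase D (G.memory p val)))))) :
    G.toProgram.Derives w (some (some p)) (G.keys.map val) := by
  refine G.derives_state (.charRule hc h hq) rfl hval (η := assign w val (nextVal z [] w
    (save (G.opened (some q)) [a] (erase D (G.memory p val)))) [] []) rfl
    (assign_infix hval hval' List.nil_infix List.nil_infix) ?_ (fun _ _ => rfl) ?_
  · intro e hm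
    simp only [RecallAutomaton.charRule, List.mem_append, List.mem_cons, List.mem_map,
      List.not_mem_nil, or_false] at hm
    obtain (rfl | rfl) | ⟨x, -, rfl⟩ := hm
    · simpa [patSubst, assign, nextVal] using hz
    · simpa [patSubst, assign] using he
    · exact (G.patSubst_source_saved (val := val) rfl rfl).symm
  · intro q' f hf
    cases hf
    convert hd using 1
    refine List.map_congr_left fun k _ => ?_
    cases k
    exacts [rfl, he, rfl, he, he, rfl]

theorem derives_recall {p q : P} {c : G.CharPos} {a : A} {y : ℕ} {D : Set ℕ}
    (hc : G.lab c.1 = Sum.inl a) (h : G.step (some p) q D) (hq : G.lab q = Sum.inr y)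
    {w z t f : List A} {val : Key P → List A} (hval : ∀ k, val k <:+: w) (he : val .eps = [])
    (hz : val .rest = val .pend ++ z) (ht : val .pend = a :: t)
    (hf : f = [] ∧ G.acc (some p) ∨ f = w ∧ ¬ G.acc (some p))
    (hval' : ∀ k : Key P, nextVal z (erase D (G.memory p val) y) f
      (erase D (G.memory p val)) k <:+: w)
    (hd : G.toProgram.Derives w (some (some q)) (G.keys.map
      (nextVal z (erase D (G.memory p val) y) f (erase D (G.memory p val))))) :
    G.toProgram.Derives w (some (some p)) (G.keys.map val) := by
  have hta : t <:+: w := (List.suffix_cons a t).isInfix.trans (ht ▸ hval .pend)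
  refine G.derives_state (.recallRule hc h hq) rfl hval (η := assign w val (nextVal z
    (erase D (G.memory p val) y) f (erase D (G.memory p val))) t []) rfl
    (assign_infix hval hval' hta List.nil_infix) ?_ (fun _ _ => rfl) ?_
  · intro e hm
    simp only [RecallAutomaton.recallRule, List.mem_append, List.mem_cons, List.mem_map,
      List.not_mem_nil, or_false] at hm
    obtain (rfl | rfl | rfl) | ⟨x, -, rfl⟩ := hm
    · simpa [patSubst, assign, nextVal] using hz
    · simpa [patSubst, assign] using ht
    · simpa [patSubst, assign] using he
    · exact (G.patSubst_source (val := val) rfl rfl).symm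
  · intro q' f' hf'
    cases hf'
    convert hd using 1
    refine List.map_congr_left fun k _ => ?_
    cases k
    · rfl
    · rfl
    · unfold recallCall flagVar
      rcases hf with ⟨rfl, hacc⟩ | ⟨rfl, hacc⟩
      · simpa [hacc, assign, nextVal] using he
      · simp [hacc, assign, nextVal]
    · exact he
    · exact he
    · rfl

/-- The configuration after an empty pending word. -/
noncomputable def passVal (w : List A) (val : Key P → List A) (p : P) (y : ℕ) (D : Set ℕ) :
    Key P → List A :=
  fun k => assign w val val [] [] (G.passCall p y D k)

theorem derives_pass {p q : P} {y : ℕ} {D : Set ℕ} (h : G.step (some p) q D)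
    (hq : G.lab q = Sum.inr y) {w : List A} {val : Key P → List A} (hval : ∀ k, val k <:+: w)
    (he : val .eps = []) (hg : val .pend = []) (hp : val (.seen p) = [])
    (hd : G.toProgram.Derives w (some (some q)) (G.keys.map (G.passVal w val p y D))) :
    G.toProgram.Derives w (some (some p)) (G.keys.map val) := by
  refine G.derives_state (.passRule h hq) rfl hval (η := assign w val val [] []) rfl
    (assign_infix hval hval List.nil_infix List.nil_infix) (fun e hm => by cases hm) ?_ ?_
  · intro k _
    change assign w val val [] [] (passArg p k) = val k
    unfold passArg
    split_ifs with hk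
    · rcases hk with rfl | rfl
      · exact he.trans hg.symm
      · exact he.trans hp.symm
    · rfl
  · intro q' f hf
    cases hf
    exact hd

theorem derives_accept {p : P} (h : ∀ q D y, G.step (some p) q D → G.lab q ≠ Sum.inr y)
    {w : List A} {val : Key P → List A} (hval : ∀ k, val k <:+: w) (hs : val (.seen p) = [])
    (hacc : val .rest = val .pend ∧ (G.acc (some p) ∨ val .pend = [] ∧ val .flag = [])) :
    G.toProgram.Derives w (some (some p)) (G.keys.map val) := by
  refine G.derives_state (.acceptRule h) rfl hval (η := assign w val val [] []) rfl
    (assign_infix hval hval List.nil_infix List.nil_infix) ?_ (fun _ _ => rfl) (by rintro q f ⟨⟩)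
  intro e hm
  simp only [RecallAutomaton.acceptRule, List.mem_cons] at hm
  rcases hm with rfl | hm
  · simpa [patSubst, assign] using hs
  · by_cases ha : G.acc (some p)
    · rw [if_pos ha] at hm
      cases List.mem_singleton.1 hm
      simpa [patSubst, assign] using hacc.1
    · rw [if_neg ha] at hm
      obtain ⟨h1, h2 | ⟨h2, h3⟩⟩ := hacc
      · exact (ha h2).elim
      · simp only [List.mem_cons, List.not_mem_nil, or_false] at hm
        obtain rfl | rfl | rfl := hm
        · simpa [patSubst, assign] using h1.trans h2
        · simpa [patSubst, assign] using h2
        · simpa [patSubst, assign] using h3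

theorem derives_flag {p : P} {x : ℕ} (hp : G.lab p = Sum.inr x) {w : List A}
    (hl : ∀ a ∈ w, ∃ c, G.lab c = Sum.inl a) {val : Key P → List A} (hval : ∀ k, val k <:+: w)
    (hr : val .rest = []) (hf : val .flag = []) (he : val .eps = [])
    (hi : val .pend ++ val (.seen p) <:+: w) (hne : val .pend ++ val (.seen p) ≠ []) :
    G.toProgram.Derives w (some (some p)) (G.keys.map val) := by
  obtain ⟨a, t, ht⟩ := List.exists_cons_of_ne_nil hne
  have ha : a ∈ w := hi.subset (by rw [ht]; exact List.mem_cons_self)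
  obtain ⟨c, hc⟩ := hl a ha
  have hta : t <:+: w := (List.suffix_cons a t).isInfix.trans (ht ▸ hi)
  refine G.derives_state (.flagRule (p := ⟨p, x, hp⟩) (c := ⟨c, a, hc⟩) hc) rfl hval
    (η := assign w val val t (val .pend ++ val (.seen p))) rfl
    (assign_infix hval hval hta hi) ?_ (fun _ _ => rfl) (by rintro q f ⟨⟩)
  intro e hm
  simp only [RecallAutomaton.flagRule, List.mem_cons, List.not_mem_nil, or_false] at hm
  obtain rfl | rfl | rfl | rfl | rfl := hm
  · simpa [patSubst, assign] using hr
  · simpa [patSubst, assign] using hf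
  · simpa [patSubst, assign] using he
  · simp [patSubst, assign]
  · simpa [patSubst, assign] using ht

end Derive

/-! ### Invariants of the computations -/

variable (G : RecallAutomaton A P)

/-- The configurations that occur in computations on `w`. -/
structure Reachable (w : List A) (p : P) (val : Key P → List A) : Prop where
  isInfix : ∀ k, val k <:+: w
  eps : val .eps = []
  seen : ∀ q, val (.seen q) = [] ∨ val (.seen q) = w
  pend_char : ∀ a, G.lab p = Sum.inl a → val .pend = [] ∧ ∀ q, val (.seen q) = []
  pend_recall : ∀ y, G.lab p = Sum.inr y → val .pend = val (.mem y)
  seen_mem : ∀ q, val (.seen q) ≠ [] → ∀ y, G.lab q = Sum.inr y → val (.mem y) = []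
  seen_flag : ∀ q, val (.seen q) ≠ [] → G.acc (some q) → val .flag = []
  seen_step : ∀ q, val (.seen q) ≠ [] → ∃ r D y, G.step (some q) r D ∧ G.lab r = Sum.inr y ∧
    (r = p ∨ val (.seen r) ≠ [])

theorem reachable_nextVal {w r g f : List A} {m : ℕ → List A} {q : P} (hr : r <:+: w)
    (hg : g <:+: w) (hf : f <:+: w) (hm : ∀ x, m x <:+: w)
    (h1 : ∀ a, G.lab q = Sum.inl a → g = []) (h2 : ∀ y, G.lab q = Sum.inr y → g = m y) :
    G.Reachable w q (nextVal r g f m) where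
  isInfix := nextVal_infix hr hg hf hm
  eps := rfl
  seen _ := Or.inl rfl
  pend_char a h := ⟨h1 a h, fun _ => rfl⟩
  pend_recall := h2
  seen_mem _ h := (h rfl).elim
  seen_flag _ h := (h rfl).elim
  seen_step _ h := (h rfl).elim

/-- A marked position recalls a memory that is still empty, and the pending word at a recall
position is the content of that memory. -/
theorem Reachable.pend_of_seen {G : RecallAutomaton A P} {w : List A} {p : P}
    {val : Key P → List A} (h : G.Reachable w p val) (hp : val (.seen p) ≠ []) :
    val .pend = [] := by
  rcases hl : G.lab p with a | y
  · exact (h.pend_char a hl).1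
  · exact (h.pend_recall y hl).trans (h.seen_mem p hp y hl)

theorem Reachable.pend_append_seen {G : RecallAutomaton A P} {w : List A} {p : P}
    {val : Key P → List A} (h : G.Reachable w p val) : val .pend ++ val (.seen p) <:+: w := by
  by_cases hp : val (.seen p) = []
  · rw [hp, List.append_nil]
    exact h.isInfix _
  · rw [h.pend_of_seen hp, List.nil_append]
    exact h.isInfix _

theorem Reachable.memory_eq {G : RecallAutomaton A P} {p : P}
    {val : Key P → List A} (hp : val .pend = []) :
    G.memory p val = fun x => val (.mem x) := by
  rw [memory, hp, save_nil]

theorem passVal_mem (w : List A) {val : Key P → List A} (he : val .eps = []) (p : P)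
    (y : ℕ) (D : Set ℕ) (x : ℕ) :
    G.passVal w val p y D (.mem x) = erase D (fun x => val (.mem x)) x := by
  change assign w val val [] [] (memVar D x) = _
  unfold memVar erase
  split_ifs
  · exact he
  · rfl

theorem passVal_pend (w : List A) {val : Key P → List A} (he : val .eps = []) (p : P)
    (y : ℕ) (D : Set ℕ) :
    G.passVal w val p y D .pend = erase D (fun x => val (.mem x)) y :=
  G.passVal_mem w he p y D y

theorem passVal_flag (w : List A) {val : Key P → List A} (he : val .eps = []) (p : P)
    (y : ℕ) (D : Set ℕ) :
    (G.acc (some p) → G.passVal w val p y D .flag = []) ∧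
      (val .flag = [] → G.passVal w val p y D .flag = []) := by
  change (_ → assign w val val [] [] (G.flagVar (some p) (.old .flag)) = []) ∧
    (_ → assign w val val [] [] (G.flagVar (some p) (.old .flag)) = [])
  unfold flagVar
  split_ifs with h
  · exact ⟨fun _ => he, fun _ => he⟩
  · exact ⟨fun h' => (h h').elim, id⟩

theorem passVal_seen (w : List A) (val : Key P → List A) (p : P) (y : ℕ) (D : Set ℕ) :
    G.passVal w val p y D (.seen p) = w ∧
      ∀ r ≠ p, G.passVal w val p y D (.seen r) = val (.seen r) := by
  constructor
  · simp [passVal, passCall, assign]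
  · intro r hr
    simp [passVal, passCall, assign, hr]

/-- Passing marks `p`, whose memory is empty because the pending word is. Erasing keeps empty
memories empty, and the transition from `p` to `q` is the new link in the chain of marked positions.
-/
theorem Reachable.pass {G : RecallAutomaton A P} {w : List A} (hw : w ≠ []) {p q : P}
    {val : Key P → List A} (h : G.Reachable w p val) {D : Set ℕ} {y : ℕ}
    (hs : G.step (some p) q D) (hq : G.lab q = Sum.inr y) (hg : val .pend = []) :
    G.Reachable w q (G.passVal w val p y D) := by
  obtain ⟨s1, s2⟩ := G.passVal_seen w val p y D
  have hm := G.passVal_mem w h.eps p y D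
  have hmem : ∀ x, val (.mem x) = [] → G.passVal w val p y D (.mem x) = [] := by
    intro x hx
    rw [hm]
    unfold erase
    split_ifs
    · rfl
    · exact hx
  obtain ⟨f1, f2⟩ := G.passVal_flag w h.eps p y D
  refine ⟨?_, h.eps, ?_, ?_, ?_, ?_, ?_, ?_⟩
  · exact fun k => assign_infix h.isInfix h.isInfix List.nil_infix List.nil_infix _
  · intro r
    by_cases hr : r = p
    · exact Or.inr (hr ▸ s1)
    · rw [s2 r hr]
      exact h.seen r
  · intro a ha
    cases hq.symm.trans ha
  · intro y' hy'
    cases hq.symm.trans hy'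
    rw [G.passVal_pend w h.eps, hm]
  · intro r hr y' hy'
    refine hmem _ ?_
    by_cases hrp : r = p
    · subst hrp
      rw [← h.pend_recall y' hy', hg]
    · rw [s2 r hrp] at hr
      exact h.seen_mem r hr y' hy'
  · intro r hr hacc
    by_cases hrp : r = p
    · exact f1 (hrp ▸ hacc)
    · rw [s2 r hrp] at hr
      exact f2 (h.seen_flag r hr hacc)
  · intro r hr
    by_cases hrp : r = p
    · subst hrp
      exact ⟨q, D, y, hs, hq, Or.inl rfl⟩
    · rw [s2 r hrp] at hr
      obtain ⟨r', D', y', h1, h2, h3⟩ := h.seen_step r hr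
      refine ⟨r', D', y', h1, h2, Or.inr ?_⟩
      by_cases hrp' : r' = p
      · rw [hrp', s1]
        exact hw
      · rw [s2 r' hrp']
        exact h3.resolve_left hrp'

/-- In a cycle of recalls of empty memories nothing is read. -/
theorem eq_nil_of_accepts {S : Set P} {p : Option P} {z : List A} {m : ℕ → List A}
    (h : G.Accepts p z m)
    (hS : ∀ q ∈ S, ∃ r D y, G.step (some q) r D ∧ G.lab r = Sum.inr y ∧ r ∈ S)
    (hm : ∀ q ∈ S, ∀ y, G.lab q = Sum.inr y → m y = []) (hp : ∃ q ∈ S, p = some q) :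
    z = [] ∧ ∃ q ∈ S, G.acc (some q) := by
  induction h with
  | done h =>
    obtain ⟨q, hq, rfl⟩ := hp
    exact ⟨rfl, q, hq, h⟩
  | @step p q D z m h _ ih =>
    obtain ⟨p, hp, rfl⟩ := hp
    obtain ⟨r, D', y, h1, h2, h3⟩ := hS p hp
    have h4 := G.step_recall h1 h2 h
    -- By determinism, the step taken by the run is the recall that stays in `S`.
    obtain ⟨rfl, rfl⟩ := G.step_unique h1 h (h2.trans h4.symm)
    have h5 : ∀ q ∈ S, ∀ y, G.lab q = Sum.inr y → erase D' m y = [] := by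
      intro q hq y hy
      unfold erase
      split_ifs
      · rfl
      · exact hm q hq y hy
    have h6 : letter (erase D' m) (G.lab r) = [] := by
      rw [h2]
      exact h5 r h3 y h2
    rw [h6, save_nil] at ih
    rw [h6, List.nil_append]
    exact ih h5 ⟨r, h3, rfl⟩

/-- The memories contain factors of the input, and the open ones suffixes of what has been read. -/
def History (w : List A) (p : Option P) (z : List A) (m : ℕ → List A) : Prop :=
  ∃ u, w = u ++ z ∧ ∀ x, m x <:+: w ∧ (x ∈ G.opened p → m x <:+ u)

/-- A memory that is open in `q` was open before or has just been erased, so its content is a suffix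
of what has been read. Appending `c` to both keeps it a suffix, hence a factor of `w`, as
substitutions require. -/
theorem History.step {G : RecallAutomaton A P} {w : List A} {p : Option P} {c z : List A}
    {m : ℕ → List A} {q : P} {D : Set ℕ} (h : G.History w p (c ++ z) m) (hs : G.step p q D) :
    G.History w (some q) z (save (G.opened (some q)) c (erase D m)) := by
  obtain ⟨u, rfl, hm⟩ := h
  have key : ∀ x ∈ G.opened (some q), erase D m x <:+ u := by
    intro x hx
    unfold erase
    split_ifs with hD
    · exact List.nil_suffix
    · exact (hm x).2 ((G.opened_step hs hx).resolve_left hD)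
  refine ⟨u ++ c, by simp, fun x => ?_⟩
  unfold save
  split_ifs with hx
  · obtain ⟨t, ht⟩ := key x hx
    have h1 : erase D m x ++ c <:+ u ++ c := ⟨t, by rw [← ht, List.append_assoc]⟩
    refine ⟨?_, fun _ => h1⟩
    rw [← List.append_assoc]
    exact h1.isInfix.trans (List.prefix_append _ _).isInfix
  · refine ⟨?_, fun h => (hx h).elim⟩
    unfold erase
    split_ifs
    · exact List.nil_infix
    · exact (hm x).1

theorem History.erase_infix {G : RecallAutomaton A P} {w : List A} {p : Option P} {z : List A}
    {m : ℕ → List A} (h : G.History w p z m) (D : Set ℕ) (x : ℕ) : erase D m x <:+: w := by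
  obtain ⟨u, -, hm⟩ := h
  unfold erase
  split_ifs
  · exact List.nil_infix
  · exact (hm x).1

theorem History.rest_infix {G : RecallAutomaton A P} {w : List A} {p : Option P} {c z : List A}
    {m : ℕ → List A} (h : G.History w p (c ++ z) m) : z <:+: w := by
  obtain ⟨u, rfl, -⟩ := h
  exact ⟨u ++ c, [], by simp⟩

/-- Memories only repeat what was read at terminal positions, so testing the letters of the terminal
positions covers every first letter of a nonempty factor of an accepted input. -/
theorem mem_of_accepts {p : Option P} {z : List A} {m : ℕ → List A} (h : G.Accepts p z m)
    (hm : ∀ x, ∀ a ∈ m x, ∃ c, G.lab c = Sum.inl a) : ∀ a ∈ z, ∃ c, G.lab c = Sum.inl a := by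
  induction h with
  | done => simp
  | @step p q D z m _ _ ih =>
    have h1 : ∀ x, ∀ a ∈ erase D m x, ∃ c, G.lab c = Sum.inl a := by
      intro x a ha
      unfold erase at ha
      split_ifs at ha
      · cases ha
      · exact hm x a ha
    have h2 : ∀ a ∈ letter (erase D m) (G.lab q), ∃ c, G.lab c = Sum.inl a := by
      intro a ha
      rcases hq : G.lab q with b | y
      · rw [hq] at ha
        cases List.mem_singleton.1 ha
        exact ⟨q, hq⟩
      · rw [hq] at ha
        exact h1 y a ha
    intro a ha
    refine (List.mem_append.1 ha).elim (h2 a) (ih ?_ a)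
    intro x b hb
    unfold save at hb
    split_ifs at hb
    · exact (List.mem_append.1 hb).elim (h1 x b) (h2 b)
    · exact h1 x b hb

theorem Accepts.start {G : RecallAutomaton A P} {p : Option P} {w : List A} {m : ℕ → List A}
    (h : G.Accepts p w m) (hw : w ≠ []) :
    ∃ q D z, G.step p q D ∧ w = letter (erase D m) (G.lab q) ++ z ∧
      G.Accepts (some q) z
        (save (G.opened (some q)) (letter (erase D m) (G.lab q)) (erase D m)) := by
  cases h with
  | done => exact (hw rfl).elim
  | step hs hacc => exact ⟨_, _, _, hs, rfl, hacc⟩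

/-! ### From accepting runs to derivations -/

variable [Finite P]

/-- Acceptance is already recorded and only has to be honoured. If no rule does so at `p`,
`passRule` applies and marks `p`; the number of unmarked positions drops, so this ends. -/
theorem derives_of_flag {w : List A} (hw : w ≠ []) (hl : ∀ a ∈ w, ∃ c, G.lab c = Sum.inl a)
    (n : ℕ) {p : P} {x : ℕ} (hp : G.lab p = Sum.inr x) {val : Key P → List A}
    (h : G.Reachable w p val) (hr : val .rest = []) (hf : val .flag = [])
    (hn : {q | val (.seen q) = []}.ncard ≤ n) :
    G.toProgram.Derives w (some (some p)) (G.keys.map val) := by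
  induction n generalizing p x val with
  | zero =>
    refine G.derives_flag hp hl h.isInfix hr hf h.eps h.pend_append_seen fun h0 => ?_
    have h1 := (List.append_eq_nil_iff.1 h0).2
    have h2 := (Set.ncard_eq_zero (Set.toFinite _)).1 (Nat.le_zero.1 hn)
    exact (h2 ▸ h1 : p ∈ (∅ : Set P))
  | succ n ih =>
    by_cases hne : val .pend ++ val (.seen p) = []
    · obtain ⟨hg, hs⟩ := List.append_eq_nil_iff.1 hne
      by_cases hrec : ∃ q D y, G.step (some p) q D ∧ G.lab q = Sum.inr y
      · obtain ⟨q, D, y, h1, h2⟩ := hrec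
        refine G.derives_pass h1 h2 h.isInfix h.eps hg hs ?_
        refine ih h2 (h.pass hw h1 h2 hg) hr ((G.passVal_flag w h.eps p y D).2 hf) ?_
        obtain ⟨s1, s2⟩ := G.passVal_seen w val p y D
        refine Nat.le_of_lt_succ (lt_of_lt_of_le (Set.ncard_lt_ncard ⟨?_, ?_⟩ (Set.toFinite _)) hn)
        · intro r hr
          by_cases hrp : r = p
          · exact hrp ▸ hs
          · exact (s2 r hrp).symm.trans hr
        · intro hsub
          exact hw (s1.symm.trans (hsub hs))
      · refine G.derives_accept (fun q D y h1 h2 => hrec ⟨q, D, y, h1, h2⟩) h.isInfix hs ?_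
        exact ⟨hr.trans hg.symm, Or.inr ⟨hg, hf⟩⟩
    · exact G.derives_flag hp hl h.isInfix hr hf h.eps h.pend_append_seen hne

/-- Each step of the run is one rule application, with two exceptions: a run that ends in a state
with a recall transition continues by `derives_of_flag` or ends with `flagRule`, and a run that
returns to a marked position with an empty pending word by a recall is cut off. -/
theorem derives_of_accepts {w : List A} (hw : w ≠ []) (hl : ∀ a ∈ w, ∃ c, G.lab c = Sum.inl a)
    {p₀ : Option P} {z : List A} {m : ℕ → List A} (h : G.Accepts p₀ z m) {p : P}
    (hp : p₀ = some p) {val : Key P → List A} (hv : G.Reachable w p val)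
    (hm : G.memory p val = m) (hz : val .rest = val .pend ++ z) (hh : G.History w p₀ z m) :
    G.toProgram.Derives w (some (some p)) (G.keys.map val) := by
  -- This fact and the next depend on `val`, so the induction generalizes them, and they are
  -- supplied again for each called configuration.
  have hpos : ∀ a t, val .pend = a :: t → ∃ c : G.CharPos, G.lab c.1 = Sum.inl a := by
    intro a t ht
    have ha : a ∈ w := (hv.isInfix .pend).subset (by rw [ht]; exact List.mem_cons_self)
    obtain ⟨c, hc⟩ := hl a ha
    exact ⟨⟨c, a, hc⟩, hc⟩
  have hrecall : val .pend ≠ [] ∨ val (.seen p) ≠ [] → ∃ x, G.lab p = Sum.inr x := by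
    intro hne
    rcases hlab : G.lab p with a | x
    · obtain ⟨h1, h2⟩ := hv.pend_char a hlab
      rcases hne with hne | hne
      · exact (hne h1).elim
      · exact (hne (h2 p)).elim
    · exact ⟨x, rfl⟩
  induction h generalizing p val with
  | @done p₀ m hacc =>
    subst hp
    rw [List.append_nil] at hz
    by_cases hrec : ∃ q D y, G.step (some p) q D ∧ G.lab q = Sum.inr y
    · obtain ⟨q, D, y, h1, h2⟩ := hrec
      rcases hg : val .pend with _ | ⟨a, t⟩
      · by_cases hs : val (.seen p) = []
        · refine G.derives_pass h1 h2 hv.isInfix hv.eps hg hs ?_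
          exact G.derives_of_flag hw hl _ h2 (hv.pass hw h1 h2 hg) (hz.trans hg)
            ((G.passVal_flag w hv.eps p y D).1 hacc) le_rfl
        · obtain ⟨x, hx⟩ := hrecall (Or.inr hs)
          exact G.derives_flag hx hl hv.isInfix (hz.trans hg) (hv.seen_flag p hs hacc) hv.eps
            hv.pend_append_seen fun h0 => hs (List.append_eq_nil_iff.1 h0).2
      · obtain ⟨c, hc⟩ := hpos a t hg
        have hi : ∀ x, erase D (G.memory p val) x <:+: w := fun x => hm ▸ hh.erase_infix D x
        -- The run stops in `p`, but the derivation has to follow the recall: the pending word uses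
        -- up the unread input, and the empty flag keeps the acceptance.
        refine G.derives_recall hc h1 h2 (f := []) (z := []) hv.isInfix hv.eps
          (by rw [hz, List.append_nil]) hg (Or.inl ⟨rfl, hacc⟩)
          (nextVal_infix List.nil_infix (hi y) List.nil_infix hi) ?_
        refine G.derives_of_flag hw hl _ h2 (G.reachable_nextVal List.nil_infix (hi y)
          List.nil_infix hi (fun a ha => ?_) fun y' hy' => ?_) rfl rfl le_rfl
        · cases h2.symm.trans ha
        · cases h2.symm.trans hy'
          rfl
    · refine G.derives_accept (fun q D y h1 h2 => hrec ⟨q, D, y, h1, h2⟩) hv.isInfix ?_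
        ⟨hz, Or.inl hacc⟩
      by_contra hs
      obtain ⟨r, D, y, h1, h2, -⟩ := hv.seen_step p hs
      exact hrec ⟨r, D, y, h1, h2⟩
  | @step p₀ q D z m hs hacc ih =>
    subst hp
    subst hm
    have hi : ∀ x, erase D (G.memory p val) x <:+: w := fun x => hh.erase_infix D x
    have hrest := hh.rest_infix
    have hh' := hh.step hs
    have hi' := fun x => (hh'.choose_spec.2 x).1
    rcases hq : G.lab q with a | y
    · rw [hq] at hz hacc ih hh' hi'
      change val .rest = val .pend ++ a :: z at hz
      have hr := G.reachable_nextVal (q := q) hrest List.nil_infix List.infix_rfl hi'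
        (fun _ _ => rfl) (fun y hy => by cases hq.symm.trans hy)
      refine G.derives_char (c := ⟨q, a, hq⟩) hq hs hq hv.isInfix hv.eps hz hr.isInfix ?_
      refine ih rfl hr (save_nil _ _) rfl hh' ?_ ?_
      · rintro b t ⟨⟩
      · rintro (h | h) <;> exact (h rfl).elim
    · rw [hq] at hz hacc ih hh' hi' hh
      change val .rest = val .pend ++ (erase D (G.memory p val) y ++ z) at hz
      rcases hg : val .pend with _ | ⟨a, t⟩
      · have hmem := Reachable.memory_eq (G := G) (p := p) hg
        by_cases hsn : val (.seen p) = []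
        · refine G.derives_pass hs hq hv.isInfix hv.eps hg hsn ?_
          have hr := hv.pass hw hs hq hg
          refine ih rfl hr ?_ ?_ hh' ?_ ?_
          · rw [memory, G.passVal_pend w hv.eps, hmem]
            exact congrArg _ (funext (G.passVal_mem w hv.eps p y D))
          · rw [G.passVal_pend w hv.eps, ← hmem]
            change val .rest = _
            rw [hz, hg]
            rfl
          · intro b t ht
            have hb : b ∈ w := (hr.isInfix .pend).subset (by rw [ht]; exact List.mem_cons_self)
            obtain ⟨c, hc⟩ := hl b hb
            exact ⟨⟨c, b, hc⟩, hc⟩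
          · exact fun _ => ⟨y, hq⟩
        · obtain ⟨x, hx⟩ := hrecall (Or.inr hsn)
          -- The marked positions are closed under recall steps: by `seen_step` the successor is
          -- marked or is `p`, and here `p` itself is marked. So the rest of the run reads nothing
          -- and ends in a marked accepting position, which has set the flag.
          have := G.eq_nil_of_accepts (S := {q | val (.seen q) ≠ []}) (Accepts.recall hs hq hacc)
            (fun r hr => ?_) (fun r hr y' hy' => ?_) ⟨p, hsn, rfl⟩
          · obtain ⟨h1, r, hr, hracc⟩ := this
            refine G.derives_flag hx hl hv.isInfix ?_ (hv.seen_flag r hr hracc) hv.eps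
              hv.pend_append_seen fun h0 => hsn (List.append_eq_nil_iff.1 h0).2
            rw [hz, h1, hg]
            rfl
          · obtain ⟨r', D', y', h1, h2, h3⟩ := hv.seen_step r hr
            refine ⟨r', D', y', h1, h2, h3.elim (fun h => ?_) id⟩
            exact h ▸ hsn
          · rw [hmem]
            exact hv.seen_mem r hr y' hy'
      · obtain ⟨c, hc⟩ := hpos a t hg
        obtain ⟨f, hf, hfw⟩ : ∃ f : List A,
            (f = [] ∧ G.acc (some p) ∨ f = w ∧ ¬ G.acc (some p)) ∧ f <:+: w := by
          by_cases hacc : G.acc (some p)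
          · exact ⟨[], Or.inl ⟨rfl, hacc⟩, List.nil_infix⟩
          · exact ⟨w, Or.inr ⟨rfl, hacc⟩, List.infix_rfl⟩
        have hr : G.Reachable w q (nextVal (erase D (G.memory p val) y ++ z)
            (erase D (G.memory p val) y) f (erase D (G.memory p val))) := by
          refine G.reachable_nextVal ?_ (hi y) hfw hi (fun a ha => ?_) fun y' hy' => ?_
          · obtain ⟨u, hu, -⟩ := hh
            exact ⟨u, [], by rw [List.append_nil]; exact hu.symm⟩
          · cases hq.symm.trans ha
          · cases hq.symm.trans hy'
            rfl
        refine G.derives_recall hc hs hq hv.isInfix hv.eps hz hg hf hr.isInfix ?_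
        refine ih rfl hr rfl rfl hh' ?_ fun _ => ⟨y, hq⟩
        intro b t ht
        have hb : b ∈ w := (hr.isInfix .pend).subset (by rw [ht]; exact List.mem_cons_self)
        obtain ⟨c, hc⟩ := hl b hb
        exact ⟨⟨c, b, hc⟩, hc⟩

/-- The empty input needs `ansNil`, since no nonempty flag value would exist. Otherwise the first
step of the run selects the rule, and the first letter of `w` supplies its index. -/
theorem derives_ans {w : List A} (h : G.Accepts none w fun _ => []) :
    G.toProgram.Derives w none [] := by
  have hl := G.mem_of_accepts h (by simp)
  have hh : G.History w none w fun _ => [] :=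
    ⟨[], rfl, fun x => ⟨List.nil_infix, fun _ => List.nil_suffix⟩⟩
  by_cases hw : w = []
  · subst hw
    refine G.derives_rule (.ansNil h) (η := fun _ => []) rfl (fun _ => List.nil_infix) ?_
      (by rintro p ⟨⟩) (by rintro q f ⟨⟩)
    intro e he
    cases List.mem_singleton.1 he
    rfl
  obtain ⟨a, t, hat⟩ := List.exists_cons_of_ne_nil hw
  obtain ⟨c, hc⟩ := hl a (by rw [hat]; exact List.mem_cons_self)
  obtain ⟨q, D, z, hs, hz, hacc⟩ := h.start hw
  rcases hq : G.lab q with b | y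
  · rw [hq] at hz hacc
    change w = b :: z at hz
    obtain ⟨rfl, rfl⟩ := List.cons.inj (hat.symm.trans hz)
    have hh' := History.step (c := [a]) (hat ▸ hh) hs
    rw [← hat] at hh'
    have hr := G.reachable_nextVal (q := q) (List.suffix_cons a t).isInfix
      List.nil_infix List.infix_rfl (hat ▸ fun x => (hh'.choose_spec.2 x).1)
      (fun _ _ => rfl) (fun y hy => by cases hq.symm.trans hy)
    rw [← hat] at hr
    refine G.derives_rule (.ansChar (c := ⟨c, a, hc⟩) hc hs hq) (η := assign w (fun _ => [])
      (nextVal t [] w (save (G.opened (some q)) [a] (erase D fun _ => []))) [] []) rfl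
      (assign_infix (fun _ => List.nil_infix) hr.isInfix List.nil_infix List.nil_infix) ?_
      (by rintro p ⟨⟩) ?_
    · intro e hm
      simp only [RecallAutomaton.ansChar, List.mem_append, List.mem_cons, List.mem_map,
        List.not_mem_nil, or_false] at hm
      obtain (rfl | rfl) | ⟨x, -, rfl⟩ := hm
      · simpa [patSubst, assign, nextVal] using hat
      · simp [patSubst, assign]
      · exact (G.patSubst_saved (D := D)).symm
    · intro q' f hf
      cases hf
      convert G.derives_of_accepts hw hl hacc rfl hr (save_nil _ _) rfl hh' using 2
      funext k
      cases k <;> rfl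
  · rw [hq] at hz hacc
    change w = erase D (fun _ => []) y ++ z at hz
    rw [erase_nil, List.nil_append] at hz
    subst hz
    change G.Accepts (some q) w (save _ (erase D (fun _ => []) y) _) at hacc
    have hh' := History.step (c := []) hh hs
    rw [erase_nil] at hacc hh'
    obtain ⟨f, hf, hfw⟩ : ∃ f : List A, assign w (fun _ : Key P => []) (fun _ => []) t []
        (G.flagVar none .univ) = f ∧ f <:+: w :=
      ⟨_, rfl, assign_infix (fun _ => List.nil_infix) (fun _ => List.nil_infix)
        (hat ▸ (List.suffix_cons a t).isInfix) List.nil_infix _⟩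
    have hr := G.reachable_nextVal (q := q) (m := fun _ => []) List.infix_rfl List.nil_infix hfw
      (fun _ => List.nil_infix) (fun _ _ => rfl) (fun _ _ => rfl)
    refine G.derives_rule (.ansRecall (c := ⟨c, a, hc⟩) hc hs hq)
      (η := assign w (fun _ => []) (fun _ => []) t []) rfl
      (assign_infix (fun _ => List.nil_infix) (fun _ => List.nil_infix)
        (hat ▸ (List.suffix_cons a t).isInfix) List.nil_infix) ?_ (by rintro p ⟨⟩) ?_
    · intro e hm
      simp only [RecallAutomaton.ansRecall, List.mem_cons, List.not_mem_nil, or_false] at hm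
      obtain rfl | rfl := hm
      · simpa [patSubst, assign] using hat
      · simp [patSubst, assign]
    · intro q' f' hf'
      cases hf'
      convert G.derives_of_accepts hw hl hacc rfl hr rfl rfl hh' using 2
      funext k
      cases k
      exacts [rfl, rfl, hf, rfl, rfl, rfl]

theorem language_toProgram :
    G.toProgram.language = {w | G.Accepts none w fun _ => []} :=
  Set.ext fun _ => ⟨fun h => (G.correct_of_derives h).1 rfl, G.derives_ans⟩

end RecallAutomaton

end DetRegex

theorem mainTheorem12 {A : Type*} [Finite A] (γ : DetRegex.Regex A) (hγ : γ.IsDRX) :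
    ∃ P : FCDatalog.Program A, P.IsBoolean ∧ P.IsSDDollaPlus ∧ P.language = γ.language ∧
      Nat.card P.Rel ≤ γ.occ + 2 ∧ P.rules.card ≤ γ.occ * (γ.occ + 3) + 1 := by
  obtain ⟨_, hcard⟩ := γ.finite_pos
  refine ⟨(γ.recallAutomaton hγ).toProgram, DetRegex.RecallAutomaton.isBoolean_toProgram _,
    DetRegex.RecallAutomaton.isSDDollaPlus_toProgram _, ?_, ?_, ?_⟩
  · rw [DetRegex.RecallAutomaton.language_toProgram]
    exact Set.ext fun w => (DetRegex.Regex.mem_language_iff_accepts hγ).symm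
  · rw [DetRegex.RecallAutomaton.card_rel, hcard]
  · rw [← hcard]
    exact DetRegex.RecallAutomaton.card_rules_le _
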